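/- Let $\mu$ be a probability measure on the unit circle $\partial\mathbb D$ that is not supported on a finite set. Let $\Phi_n$ and $\varphi_n=\Phi_n/\|\Phi_n\|$ be its monic and orthonormal polynomials, and $\alpha_n=-\overline{\Phi_{n+1}(0)}$ its Verblunsky coefficients. Write $d\mu=w\,\frac{d\theta}{2\pi}+d\mu_{\mathrm s}$ with $\mu_{\mathrm s}$ singular, and let $$D(z)=\exp\Big(\frac1{4\pi}\int_{-\pi}^{\pi}\frac{e^{i\theta}+z}{e^{i\theta}-z}\log w(e^{i\theta})\,d\theta\Big),\qquad |z|<1,$$ be its Szegő function. Assume the BLS condition: $\alpha_n=Cb^n+O((b\Delta)^n)$ with $b,\Delta\in(0,1)$ and $C\in\mathbb C$, $C\neq0$. Let $|z_0|=1$ and let $k\ge1$ be an integer such that $\overline{D(1/\bar z)}^{\,-1}$ has a zero of order $k$ at $bz_0$, where $D^{-1}$ is continued analytically from $\mathbb D$ to a neighborhood of $1/\overline{bz_0}$ (on an open set that contains $\mathbb D$ and is star-shaped about $0$). Then there are $\Delta_2\in(0,1)$, $\delta\in(0,b\Delta_2^{-1})$ and real constants $D_0$, $A$ such that, with (using the principal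 argument $\arg\in(-\pi,\pi]$) $$\mathbb A=\{z:\Delta_2<|z/b|<\Delta_2^{-1}\},\qquad S=\{z\in\mathbb A:|\arg(z/z_0)|<\delta\},$$ there is an $N$ for which the following hold for all $n\ge N$. 1. Every zero $z\in S$ of $\varphi_n$ satisfies $1-\frac{D_0}{n}\le\left|\frac zb\right|\le1+2k\,\frac{\log n}{n}$. 2. For every $z_1\in S$ there is a zero $z\in\mathbb A$ of $\varphi_n$ with $|\arg(z/z_1)|\le\frac{2\pi}{n}$; moreover $z\in S$ if $|\arg(z_1/z_0)|+\frac{2\pi}n<\delta$. 3. Every zero $z\in S$ of $\varphi_n$ is simple, and there are two further zeros $z_+\ne z_-$ of $\varphi_n$, both different from $z$, which are the two zeros nearest to $z$ (every other zero $w\neq z$ satisfies $|w-z|>\max(|z_+-z|,|z_--z|)$) and are its neighbors in angle (no other zero $w\in\mathbb A$, $w\ne z$, has $\arg(z_- /z)\le\arg(w/z)\le\arg(z_+/z)$), and $$\Big|\arg\frac{z_\pm}{z}\mp\frac{2\pi}{n}\Big|\le\frac{A}{n\log n},\qquad\Big|\,\Big|\frac{z_\pm}{z}\Big|-1\Big|\le\frac{A}{n\log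 n}.$$ In addition, for every real $\kappa<k$ (in particular for $\kappa=k/2$) there is an $N_\kappa$ such that for all $n\ge N_\kappa$ every zero $z\in S$ of $\varphi_n$ satisfies $\left|\frac zb-z_0\right|\ge\kappa\,\frac{\log n}{n}$. -/

import Mathlib

open MeasureTheory Filter Polynomial
open scoped ComplexConjugate

noncomputable section

namespace OPUC

/-- The Borel σ-algebra on the unit circle. -/
instance instMeasurableSpaceCircle : MeasurableSpace Circle := borel Circle

instance instBorelSpaceCircle : BorelSpace Circle := ⟨rfl⟩

/-- `μ` is nontrivial: it is not supported on a finite set. -/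
def Nontrivial (μ : Measure Circle) : Prop :=
  ∀ s : Set Circle, s.Finite → μ sᶜ ≠ 0

/-- The inner product `⟨p, q⟩ = ∫ conj p · q dμ` of polynomials in `L²(∂𝔻, μ)`. -/
def polyInner (μ : Measure Circle) (p q : ℂ[X]) : ℂ :=
  ∫ ζ : Circle, conj (p.eval (ζ : ℂ)) * q.eval (ζ : ℂ) ∂μ

/-- The monic orthogonal polynomials `Φ_n` of `μ`, obtained by the Gram-Schmidt procedure
from the monomials. -/
def monicOP (μ : Measure Circle) (n : ℕ) : ℂ[X] :=
  X ^ n - ∑ j : Fin n,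
    C (polyInner μ (monicOP μ j) (X ^ n) / polyInner μ (monicOP μ j) (monicOP μ j)) * monicOP μ j
termination_by n
decreasing_by all_goals exact j.2

/-- The orthonormal polynomials `φ_n = Φ_n / ‖Φ_n‖`. -/
def orthonormalOP (μ : Measure Circle) (n : ℕ) : ℂ[X] :=
  C (((√(polyInner μ (monicOP μ n) (monicOP μ n)).re : ℝ) : ℂ)⁻¹) * monicOP μ n

/-- The Verblunsky coefficients `α_n = -conj (Φ_{n+1}(0))`. -/
def verblunsky (μ : Measure Circle) (n : ℕ) : ℂ :=
  -conj ((monicOP μ (n + 1)).eval 0)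

/-- Normalized arc length `dθ / 2π` on the unit circle. -/
def arcLength : Measure Circle :=
  (ENNReal.ofReal (2 * Real.pi))⁻¹ •
    (volume.restrict (Set.Ioc (-Real.pi) Real.pi)).map Circle.exp

/-- The weight `w` in the decomposition `dμ = w dθ/2π + dμ_s`. -/
def weight (μ : Measure Circle) (ζ : Circle) : ℝ :=
  (μ.rnDeriv arcLength ζ).toReal

/-- The Szegő function
`D(z) = exp ((1/4π) ∫ (e^{iθ} + z) / (e^{iθ} - z) log w(θ) dθ)`, for `|z| < 1`. -/
def szego (μ : Measure Circle) (z : ℂ) : ℂ :=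
  Complex.exp ((1 / 2) *
    ∫ ζ : Circle, (((ζ : ℂ) + z) / ((ζ : ℂ) - z)) * (Real.log (weight μ ζ) : ℂ) ∂arcLength)

/-- The Barrios-López-Saff condition `α_n = C b^n + O((b Δ)^n)` for some `Δ ∈ (0, 1)`. -/
def BLS (α : ℕ → ℂ) (b : ℝ) (c : ℂ) : Prop :=
  ∃ Δ : ℝ, 0 < Δ ∧ Δ < 1 ∧
    (fun n : ℕ => α n - c * (b : ℂ) ^ n) =O[atTop] (fun n : ℕ => (b * Δ) ^ n)

/-- The function `z ↦ conj (D (1 / conj z))⁻¹`, where `1 / D`, originally given on the unit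
disk, is continued analytically outwards, has a zero of order `k` at the point `p`.

The domain `U` of the continuation is star-shaped about `0`, so the continuation is the one along
the radial segment from `0` to `1 / conj p`, and it is unique near that point. -/
def HasReflectedZeroOfOrder (D : ℂ → ℂ) (p : ℂ) (k : ℕ) : Prop :=
  ∃ (U : Set ℂ) (E : ℂ → ℂ), IsOpen U ∧ StarConvex ℝ 0 U ∧
    Metric.ball 0 1 ⊆ U ∧ (conj p)⁻¹ ∈ U ∧
    AnalyticOnNhd ℂ E U ∧ Set.EqOn E (fun z => (D z)⁻¹) (Metric.ball 0 1) ∧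
    analyticOrderAt (fun z => conj (E (conj z)⁻¹)) p = k

/-- The annulus `ρ < |z / b| < 1 / ρ`. -/
def annulus (b ρ : ℝ) : Set ℂ :=
  {z | ρ < ‖z / (b : ℂ)‖ ∧ ‖z / (b : ℂ)‖ < ρ⁻¹}

/-- The part of the annulus in which `|arg (z / z₀)| < δ`. -/
def sector (b ρ δ : ℝ) (z₀ : ℂ) : Set ℂ :=
  {z | z ∈ annulus b ρ ∧ |(z / z₀).arg| < δ}

end OPUC

end

/-! ### Solutions of `exp (n u) * u ^ k = c * g u` near the origin -/

/-! Write `F` for the limit of the reversed polynomials `Φ_n^*`. Exponential decay of `α_n` makes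
this limit exist and be holomorphic in `|z| < 1/b`, without zeros in the closed disk. The moments of
`|Φ_n|² dμ` of nonzero order tend to `0`, so `|F|² dμ` is a multiple of arc length; taking a
logarithm of `F` and applying the Schwarz formula shows that `D⁻¹` is a positive multiple of `F`
(`exists_inv_szego_eq`). Solving the Szegő recursion for `Φ_n(z) / z^n` and replacing `conj α_j
Φ_j^*` by `conj C b^j F` produces a geometric sum. Near `b z₀` this gives `Φ_n = z^n G + b^n H +
O((bΔ)^n)`, where `H = conj C F / (z - b)` (`exists_asymptotics`). For `b < |z| < 1` the first term
dominates, so `G(z) = conj (F(1 / conj z))` there. Hence `G` is the continuation of the reflected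
`D⁻¹` up to a constant, and it has a zero of order `k` at `b z₀`, where `H` does not vanish. In the
coordinate `z = b z₀ exp u` the zeros are therefore the solutions of `exp (n u) u^k = c g(u)`, with
`|c|` independent of `n` and `g` holomorphic and close to `1` (`exists_localForm`). Comparing moduli
forces `Re u ≥ -O(1/n)` and `|u| ≥ κ log n / n` for each `κ < k`. On that region `n u + k log u -
log g` has derivative `n (1 + O(1 / log n))`, so it is almost `n u`, and solutions form a chain with
steps `2πi/n`, up to a relative error `O(1 / log n)`. Existence follows by solving the modulus
equation along a horizontal line (intermediate values) and then correcting the phase (quantitative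
inverse function theorem). Since `g` and the argument of `c` vary with `n`, the estimates for large
`n` are uniform in `g` and `c`: these are quantified inside `∀ᶠ n`. -/

namespace ZeroSpacing

open Metric Set Topology

/-- `g` is holomorphic on the disk of radius `r` and takes values close to `1`. -/
structure NearOne (r : ℝ) (g : ℂ → ℂ) : Prop where
  differentiableOn : DifferentiableOn ℂ g (ball 0 r)
  close : ∀ u ∈ ball (0 : ℂ) r, ‖g u - 1‖ ≤ 1 / 2

/-- `n u + k log u - log g(u)`. -/
noncomputable def phase (k n : ℕ) (g : ℂ → ℂ) (u : ℂ) : ℂ :=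
  n * u + k * Complex.log u - Complex.log (g u)

/-- The part of the disk of radius `r / 2` on which `phase` is almost linear. -/
def phaseDomain (r D : ℝ) (n : ℕ) : Set ℂ :=
  -- Solutions satisfy `‖u‖ ≥ log n / (2 n)` and `n Re u ≥ -D`. The weaker constants `8` and `20`
  -- leave room for the segments and disks around solutions, and still keep the negative real axis
  -- out for large `n`.
  {w | ‖w‖ < r / 2 ∧ Real.log n / (8 * n) ≤ ‖w‖ ∧ -(D + 20) ≤ n * w.re}

variable {r ρ : ℝ} {g : ℂ → ℂ} {k n : ℕ} {u v : ℂ}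

lemma NearOne.norm_ge (hg : NearOne r g) (hu : u ∈ ball (0 : ℂ) r) : 1 / 2 ≤ ‖g u‖ := by
  have h1 := hg.close u hu
  have h2 := norm_sub_norm_le (1 : ℂ) (g u)
  rw [norm_sub_rev, norm_one] at h2
  linarith

lemma NearOne.norm_le (hg : NearOne r g) (hu : u ∈ ball (0 : ℂ) r) : ‖g u‖ ≤ 3 / 2 := by
  have h1 := hg.close u hu
  have h2 := norm_sub_norm_le (g u) 1
  rw [norm_one] at h2
  linarith

lemma NearOne.ne_zero (hg : NearOne r g) (hu : u ∈ ball (0 : ℂ) r) : g u ≠ 0 := by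
  have := hg.norm_ge hu
  intro h
  rw [h, norm_zero] at this
  norm_num at this

lemma NearOne.mem_slitPlane (hg : NearOne r g) (hu : u ∈ ball (0 : ℂ) r) :
    g u ∈ Complex.slitPlane := by
  left
  have h1 := (Complex.abs_re_le_norm (g u - 1)).trans (hg.close u hu)
  rw [abs_le] at h1
  simp at h1
  linarith

/-- Cauchy's estimate on circles of radius `s < r / 2`, where `‖g‖ ≤ 3 / 2`, followed by `s → r /
2`. -/
lemma NearOne.norm_deriv_le (hg : NearOne r g) (hr : 0 < r) (hu : ‖u‖ < r / 2) :
    ‖deriv g u‖ ≤ 3 / r := by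
  have hsub : closedBall u (r / 4) ⊆ ball (0 : ℂ) r := by
    intro w hw
    rw [mem_closedBall, dist_eq_norm] at hw
    rw [mem_ball, dist_zero_right]
    have := norm_le_norm_add_norm_sub' w u
    linarith
  have hsub2 : ∀ s < r / 2, closedBall u s ⊆ ball (0 : ℂ) r := by
    intro s hs w hw
    rw [mem_closedBall, dist_eq_norm] at hw
    rw [mem_ball, dist_zero_right]
    have := norm_le_norm_add_norm_sub' w u
    linarith
  have hd : DifferentiableOn ℂ g (ball u (r / 2)) := by
    refine hg.differentiableOn.mono ?_
    intro w hw
    rw [mem_ball, dist_eq_norm] at hw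
    rw [mem_ball, dist_zero_right]
    have := norm_le_norm_add_norm_sub' w u
    linarith
  have key : ∀ s, 0 < s → s < r / 2 → ‖deriv g u‖ ≤ (3 / 2) / s := by
    intro s hs0 hs
    refine Complex.norm_deriv_le_of_forall_mem_sphere_norm_le hs0 ?_ ?_
    · refine (hd.mono ?_).diffContOnCl
      rw [closure_ball _ hs0.ne']
      exact closedBall_subset_ball hs
    · intro w hw
      exact hg.norm_le (hsub2 s hs (sphere_subset_closedBall hw))
  have ht : Tendsto (fun s : ℝ => (3 / 2) / s) (𝓝[<] (r / 2)) (𝓝 ((3 / 2) / (r / 2))) := by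
    refine Tendsto.mono_left ?_ nhdsWithin_le_nhds
    exact tendsto_const_nhds.div tendsto_id (by positivity)
  have h3 : (3 / 2) / (r / 2) = 3 / r := by field_simp
  rw [h3] at ht
  refine ge_of_tendsto ht ?_
  filter_upwards [Ioo_mem_nhdsLT (show (0:ℝ) < r / 2 by positivity)] with s hs
  exact key s hs.1 hs.2

lemma norm_exp_mul_pow (n k : ℕ) (u : ℂ) :
    ‖Complex.exp (n * u) * u ^ k‖ = Real.exp (n * u.re) * ‖u‖ ^ k := by
  rw [norm_mul, Complex.norm_exp, norm_pow]
  simp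

/-- Solutions of the modulus equation are not far to the left of the imaginary axis. -/
lemma le_mul_re (hr1 : r ≤ 1) (hρ : 0 < ρ) (hg : NearOne r g) (hu : u ∈ ball (0 : ℂ) r)
    (h : ‖Complex.exp (n * u) * u ^ k‖ = ρ * ‖g u‖) : -|Real.log (ρ / 2)| ≤ n * u.re := by
  rw [norm_exp_mul_pow] at h
  have h1 := hg.norm_ge hu
  have h2 : ‖u‖ ^ k ≤ 1 := by
    apply pow_le_one₀ (norm_nonneg _)
    rw [mem_ball, dist_zero_right] at hu
    linarith
  have h3 : ρ / 2 ≤ Real.exp (n * u.re) := by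
    have : ρ / 2 ≤ ρ * ‖g u‖ := by nlinarith
    have h4 := mul_le_mul_of_nonneg_left h2 (Real.exp_pos (n * u.re)).le
    linarith
  have h4 : Real.log (ρ / 2) ≤ n * u.re := by
    rw [Real.log_le_iff_le_exp (by positivity)]
    exact h3
  linarith [neg_abs_le (Real.log (ρ / 2))]

lemma tendsto_log_natCast : Tendsto (fun n : ℕ => Real.log n) atTop atTop :=
  Real.tendsto_log_atTop.comp tendsto_natCast_atTop_atTop

lemma tendsto_log_div_natCast : Tendsto (fun n : ℕ => Real.log n / n) atTop (𝓝 0) := by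
  have := (Real.isLittleO_log_id_atTop).tendsto_div_nhds_zero
  exact this.comp tendsto_natCast_atTop_atTop

/-- Solutions of the modulus equation are not far to the right of the imaginary axis. -/
lemma eventually_re_le (hk : 1 ≤ k) (ρ : ℝ) :
    ∀ᶠ n : ℕ in atTop, ∀ x y : ℝ, x ≤ y → Real.exp (n * x) * y ^ k ≤ 3 / 2 * ρ →
      x ≤ Real.log (1 + 2 * k * (Real.log n / n)) := by
  have hlim : Tendsto (fun n : ℕ => 2 * k * (Real.log n / n)) atTop (𝓝 0) := by
    simpa using tendsto_log_div_natCast.const_mul (2 * (k : ℝ))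
  have h2 : Tendsto (fun n : ℕ => Real.exp (Real.log n / 2)) atTop atTop :=
    Real.tendsto_exp_atTop.comp (tendsto_log_natCast.atTop_div_const (by norm_num))
  filter_upwards [hlim.eventually (gt_mem_nhds (show (0 : ℝ) < 1 / 3 by norm_num)),
    h2.eventually_gt_atTop (3 / 2 * ρ), tendsto_log_natCast.eventually_ge_atTop 1,
    eventually_gt_atTop 0] with n h13 hbig hlog hn x y hxy hle
  -- With `t = 2 k log n / n < 1 / 3` one has `log (1 + t) ≥ t / (1 + t) ≥ 3 t / 4`. So `x > 3 t /
  -- 4` gives `exp (n x) ≥ n ^ (3 k / 2)`, while `y ^ k ≥ n ^ (-k)`; the product is at least `√n`,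
  -- hence unbounded.
  by_contra! hcon
  have hn' : (0 : ℝ) < n := by exact_mod_cast hn
  have hk' : (1 : ℝ) ≤ k := by exact_mod_cast hk
  set t := 2 * k * (Real.log n / n) with ht
  have ht0 : 0 < t := by positivity
  have hlt : 3 / 4 * t ≤ Real.log (1 + t) := by
    have := Real.one_sub_inv_le_log_of_pos (show 0 < 1 + t by linarith)
    refine le_trans ?_ this
    have : 1 - (1 + t)⁻¹ = t / (1 + t) := by field_simp; ring
    rw [this, le_div_iff₀ (by linarith)]
    nlinarith
  have hx : 3 / 4 * t < x := by linarith
  have hnx : k * (3 / 2 * Real.log n) ≤ n * x := by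
    have : k * (3 / 2 * Real.log n) = n * (3 / 4 * t) := by rw [ht]; field_simp; ring
    rw [this]
    gcongr
  have hxn : (n : ℝ)⁻¹ ≤ y := by
    refine le_trans ?_ (hx.le.trans hxy)
    have : 3 / 4 * t = (3 / 2 * k * Real.log n) * (n : ℝ)⁻¹ := by rw [ht]; field_simp; ring
    rw [this]
    have : 1 ≤ 3 / 2 * k * Real.log n := by nlinarith
    exact le_mul_of_one_le_left (by positivity) this
  have h5 : Real.exp (Real.log n / 2) ≤ Real.exp (n * x) * y ^ k := by
    calc Real.exp (Real.log n / 2) ≤ (Real.exp (Real.log n / 2)) ^ k :=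
          le_self_pow₀ (Real.one_le_exp (by positivity)) (by omega)
      _ = (Real.exp (3 / 2 * Real.log n) * (n : ℝ)⁻¹) ^ k := by
          congr 1
          have hninv : (n : ℝ)⁻¹ = Real.exp (-Real.log n) := by rw [Real.exp_neg, Real.exp_log hn']
          rw [hninv, ← Real.exp_add]
          congr 1
          ring
      _ = Real.exp (k * (3 / 2 * Real.log n)) * ((n : ℝ)⁻¹) ^ k := by
          rw [mul_pow, ← Real.exp_nat_mul]
      _ ≤ _ := by gcongr
  linarith

/-- Solutions of the modulus equation stay away from the origin. -/
lemma eventually_le_norm (hρ : 0 < ρ) {κ : ℝ} (hκ : κ < k) :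
    ∀ᶠ n : ℕ in atTop, ∀ x y : ℝ, 0 ≤ y → x ≤ y → ρ / 2 ≤ Real.exp (n * x) * y ^ k →
      κ * (Real.log n / n) ≤ y := by
  rcases le_or_gt κ 0 with h0 | h0
  · filter_upwards with n x y hy _ _
    have : 0 ≤ Real.log n / n := by
      apply div_nonneg (Real.log_natCast_nonneg n) (Nat.cast_nonneg n)
    nlinarith
  have hlim : Tendsto (fun n : ℕ => κ ^ k *
      ((Real.log n) ^ (k : ℝ) * Real.exp (-(k - κ) * Real.log n))) atTop (𝓝 0) := by
    have := (tendsto_rpow_mul_exp_neg_mul_atTop_nhds_zero k (k - κ) (by linarith)).comp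
      tendsto_log_natCast
    simpa using this.const_mul (κ ^ k)
  filter_upwards [hlim.eventually (gt_mem_nhds (show (0 : ℝ) < ρ / 2 by positivity)),
    eventually_gt_atTop 0] with n hsmall hn x y hy hxy hle
  -- If `y` were smaller, then `exp (n x) ≤ n ^ κ`, and the product would be at most `κ ^ k (log n)
  -- ^ k n ^ (κ - k)`, which tends to `0`.
  by_contra! hcon
  have hn' : (0 : ℝ) < n := by exact_mod_cast hn
  have hnx : n * x ≤ κ * Real.log n := by
    have : n * x ≤ n * (κ * (Real.log n / n)) := by
      gcongr
      linarith
    have h2 : n * (κ * (Real.log n / n)) = κ * Real.log n := by field_simp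
    linarith
  have : Real.exp (n * x) * y ^ k ≤ κ ^ k *
      ((Real.log n) ^ (k : ℝ) * Real.exp (-(k - κ) * Real.log n)) := by
    calc Real.exp (n * x) * y ^ k ≤ Real.exp (κ * Real.log n) * (κ * (Real.log n / n)) ^ k := by
          gcongr
      _ = _ := by
          have : Real.exp (-(k - κ) * Real.log n) = Real.exp (κ * Real.log n) / (n : ℝ) ^ k := by
            have h3 : (n : ℝ) ^ k = Real.exp (k * Real.log n) := by
              rw [Real.exp_nat_mul, Real.exp_log hn']
            rw [h3, ← Real.exp_sub]
            congr 1
            ring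
          rw [this, Real.rpow_natCast, mul_pow, div_pow]
          ring
  linarith

/-- The choice of branch disappears under `exp`, so two solutions of the equation have phases that
differ by a multiple of `2πi`. -/
lemma exp_phase (hg : g u ≠ 0) (hu : u ≠ 0) :
    Complex.exp (phase k n g u) = Complex.exp (n * u) * u ^ k / g u := by
  rw [phase, Complex.exp_sub, Complex.exp_add, Complex.exp_log hg,
    Complex.exp_nat_mul (Complex.log u) k, Complex.exp_log hu]

lemma mem_ball_of_mem_phaseDomain {D : ℝ} (hr : 0 < r) (h : u ∈ phaseDomain r D n) :
    u ∈ ball (0 : ℂ) r := by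
  rw [mem_ball, dist_zero_right]
  linarith [h.1]

/-- The derivative of `phase` is close to `n`. -/
lemma eventually_norm_deriv_le (hr : 0 < r) (D : ℝ) (k : ℕ) :
    ∀ᶠ n : ℕ in atTop, ∀ g, NearOne r g → ∀ w ∈ phaseDomain r D n,
      w ∈ Complex.slitPlane ∧ ‖k / w - deriv g w / g w‖ ≤ (8 * k + 1) / Real.log n * n := by
  filter_upwards [tendsto_log_natCast.eventually_gt_atTop (8 * (D + 20)),
    tendsto_log_natCast.eventually_ge_atTop 1, eventually_gt_atTop 0,
    tendsto_log_div_natCast.eventually (gt_mem_nhds (show (0 : ℝ) < r / 6 by positivity))]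
    with n hD hlog hn hsmall g hg w hw
  have hn' : (0 : ℝ) < n := by exact_mod_cast hn
  have hpos : 0 < Real.log n := by linarith
  have hball := mem_ball_of_mem_phaseDomain hr hw
  obtain ⟨h1, h2, h3⟩ := hw
  constructor
  -- On the negative axis `‖w‖ = -w.re ≤ (D + 20) / n`, which is below `log n / (8 n)` for large
  -- `n`.
  · by_contra hcon
    rw [Complex.mem_slitPlane_iff, not_or, not_lt, not_not] at hcon
    have h4 : ‖w‖ = -w.re := by
      have : w = (w.re : ℂ) := by
        apply Complex.ext <;> simp [hcon.2]
      rw [this, Complex.norm_real, Real.norm_eq_abs, Complex.ofReal_re, abs_of_nonpos hcon.1]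
    rw [h4, div_le_iff₀ (by positivity)] at h2
    nlinarith
  have hwpos : 0 < ‖w‖ := lt_of_lt_of_le (by positivity) h2
  refine (norm_sub_le _ _).trans ?_
  rw [norm_div, norm_div, Complex.norm_natCast]
  have e1 : (k : ℝ) / ‖w‖ ≤ 8 * k / Real.log n * n := by
    rw [div_le_iff₀ hwpos]
    calc (k : ℝ) = 8 * k / Real.log n * n * (Real.log n / (8 * n)) := by field_simp
      _ ≤ _ := by gcongr
  have e2 : ‖deriv g w‖ / ‖g w‖ ≤ 1 / Real.log n * n := by
    have h5 := hg.norm_deriv_le hr h1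
    have h6 := hg.norm_ge hball
    calc ‖deriv g w‖ / ‖g w‖ ≤ (3 / r) / (1 / 2) := by gcongr
      _ = 6 / r := by ring
      _ ≤ _ := by
        rw [div_mul_eq_mul_div, one_mul, div_le_div_iff₀ hr hpos]
        rw [div_lt_iff₀ hn'] at hsmall
        linarith
  calc _ ≤ 8 * k / Real.log n * n + 1 / Real.log n * n := add_le_add e1 e2
    _ = _ := by ring

/-- On the domain, `phase` is close to the linear map `u ↦ n u`. -/
lemma eventually_norm_phase_sub_le (hr : 0 < r) (D : ℝ) (k : ℕ) :
    ∀ᶠ n : ℕ in atTop, ∀ g, NearOne r g → ∀ u v, segment ℝ u v ⊆ phaseDomain r D n →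
      ‖phase k n g v - phase k n g u - n * (v - u)‖ ≤
        (8 * k + 1) / Real.log n * (n * ‖v - u‖) := by
  filter_upwards [eventually_norm_deriv_le hr D k] with n hn g hg u v huv
  have hder : ∀ w ∈ segment ℝ u v, HasDerivWithinAt
      (fun w => k * Complex.log w - Complex.log (g w)) (k / w - deriv g w / g w)
      (segment ℝ u v) w := by
    intro w hw
    have hball := mem_ball_of_mem_phaseDomain hr (huv hw)
    have hgd : HasDerivAt g (deriv g w) w :=
      (hg.differentiableOn.differentiableAt (isOpen_ball.mem_nhds hball)).hasDerivAt
    have := ((Complex.hasDerivAt_log (hn g hg w (huv hw)).1).const_mul (k : ℂ)).sub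
      (hgd.clog (hg.mem_slitPlane hball))
    rw [div_eq_mul_inv (k : ℂ)]
    exact this.hasDerivWithinAt
  have := Convex.norm_image_sub_le_of_norm_hasDerivWithin_le hder
    (fun w hw => (hn g hg w (huv hw)).2)
    (convex_segment u v) (left_mem_segment ℝ u v) (right_mem_segment ℝ u v)
  rw [← mul_assoc]
  refine le_trans (le_of_eq ?_) this
  congr 1
  simp only [phase]
  ring

/-- Solutions of the modulus equation are bounded away from the origin and from the left. -/
lemma eventually_bounds (hr1 : r ≤ 1) (hρ : 0 < ρ) (hk : 1 ≤ k) :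
    ∀ᶠ n : ℕ in atTop, ∀ g, NearOne r g → ∀ u ∈ ball (0 : ℂ) r,
      ‖Complex.exp (n * u) * u ^ k‖ = ρ * ‖g u‖ →
      -|Real.log (ρ / 2)| ≤ n * u.re ∧ Real.log n / (2 * n) ≤ ‖u‖ := by
  have hκ : (1 / 2 : ℝ) < k := by
    have : (1 : ℝ) ≤ k := by exact_mod_cast hk
    linarith
  filter_upwards [eventually_le_norm hρ hκ] with n hn g hg u hu h
  refine ⟨le_mul_re hr1 hρ hg hu h, ?_⟩
  have h1 := hg.norm_ge hu
  rw [norm_exp_mul_pow] at h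
  have := hn u.re ‖u‖ (norm_nonneg _) (Complex.re_le_norm u) (by nlinarith)
  calc Real.log n / (2 * n) = 1 / 2 * (Real.log n / n) := by ring
    _ ≤ _ := this

/-- Otherwise `|Re u| ≤ R / 2`, and Pythagoras gives `‖u‖² ≤ (1 / 4 + 9 / 16) R² < R²`. -/
lemma half_le_re {R t : ℝ} (h : R ≤ ‖u‖) (him : |u.im| ≤ 3 / 4 * R) (hre : -t ≤ u.re)
    (ht : t < R / 2) (hR : 0 < R) : R / 2 ≤ u.re := by
  by_contra! hcon
  have h1 : |u.re| ≤ R / 2 := by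
    rw [abs_le]; constructor <;> linarith
  have h2 := Complex.sq_norm u
  rw [Complex.normSq_apply] at h2
  have h3 := sq_abs u.re
  have h4 := sq_abs u.im
  have h5 : |u.re| ^ 2 ≤ (R / 2) ^ 2 := by gcongr
  have h6 : |u.im| ^ 2 ≤ (3 / 4 * R) ^ 2 := by gcongr
  have h7 : R ^ 2 ≤ ‖u‖ ^ 2 := by gcongr
  nlinarith

/-- The domain omits a disk about `0`, so it is not convex and the segment has to be kept away from
the origin. With `R = log n / (2 n)`: if `|Im u| ≥ R / 2`, the imaginary part varies by at most `20
/ n ≤ R / 4` along the segment; otherwise both endpoints, hence all points, have real part at least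
`R / 2`. -/
lemma eventually_segment_subset (r D : ℝ) :
    ∀ᶠ n : ℕ in atTop, ∀ u v : ℂ, ‖u‖ < r / 2 → ‖v‖ < r / 2 →
      -D ≤ n * u.re → -D ≤ n * v.re → Real.log n / (2 * n) ≤ ‖u‖ → Real.log n / (2 * n) ≤ ‖v‖ →
      |(v - u).im| ≤ 20 / n → segment ℝ u v ⊆ phaseDomain r D n := by
  filter_upwards [tendsto_log_natCast.eventually_gt_atTop (4 * D),
    tendsto_log_natCast.eventually_ge_atTop 160, eventually_gt_atTop 0]
    with n hD hlog hn u v hu hv hu1 hv1 hu2 hv2 him w hw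
  have hn' : (0 : ℝ) < n := by exact_mod_cast hn
  set R := Real.log n / (2 * n) with hR
  have hRpos : 0 < R := by positivity
  have hR20 : 20 / n ≤ R / 4 := by
    rw [hR, div_div, div_le_div_iff₀ (by positivity) (by positivity)]
    nlinarith
  have hDR : D / n < R / 2 := by
    rw [hR, div_div, div_lt_div_iff₀ (by positivity) (by positivity)]
    nlinarith
  have hR4 : Real.log n / (8 * n) = R / 4 := by rw [hR]; ring
  have hu3 : -(D / n) ≤ u.re := by
    rw [← neg_div, div_le_iff₀ hn']
    linarith
  have hv3 : -(D / n) ≤ v.re := by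
    rw [← neg_div, div_le_iff₀ hn']
    linarith
  have hwball : w ∈ ball (0 : ℂ) (r / 2) :=
    (convex_ball (0 : ℂ) (r / 2)).segment_subset (by simpa using hu) (by simpa using hv) hw
  obtain ⟨a, c, ha, hc, hac, rfl⟩ := hw
  have hre : (a • u + c • v).re = a * u.re + c * v.re := by simp
  have him' : (a • u + c • v).im = u.im + c * (v - u).im := by
    have : a = 1 - c := by linarith
    simp [this]; ring
  refine ⟨by simpa using hwball, ?_, ?_⟩
  · rw [hR4]
    rcases le_or_gt (R / 2) |u.im| with h | h
    · refine le_trans ?_ (Complex.abs_im_le_norm _)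
      rw [him']
      have h1 : |c * (v - u).im| ≤ R / 4 := by
        rw [abs_mul, abs_of_nonneg hc]
        have : c * |(v - u).im| ≤ 1 * |(v - u).im| := by
          gcongr; linarith
        linarith
      have := abs_sub_abs_le_abs_sub u.im (-(c * (v - u).im))
      rw [abs_neg, sub_neg_eq_add] at this
      linarith
    · refine le_trans ?_ (Complex.re_le_norm _)
      rw [hre]
      have h1 : R / 2 ≤ u.re := half_le_re hu2 (by linarith) hu3 hDR hRpos
      have h2 : R / 2 ≤ v.re := by
        refine half_le_re hv2 ?_ hv3 hDR hRpos
        have := abs_sub_abs_le_abs_sub v.im u.im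
        rw [← Complex.sub_im] at this
        linarith
      have : a * (R / 2) + c * (R / 2) ≤ a * u.re + c * v.re := by gcongr
      rw [← add_mul, hac] at this
      linarith
  · rw [hre]
    nlinarith

/-- The radius `13 / n` exceeds `4 π / n`, the largest displacement needed for a phase shift of size
`2 π`. -/
lemma eventually_closedBall_subset (hr : 0 < r) (D : ℝ) :
    ∀ᶠ n : ℕ in atTop, ∀ u : ℂ, ‖u‖ < r / 4 →
      -D ≤ n * u.re → Real.log n / (2 * n) ≤ ‖u‖ →
      closedBall u (13 / n) ⊆ phaseDomain r D n := by
  have h13 : Tendsto (fun n : ℕ => (13 : ℝ) / n) atTop (𝓝 0) :=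
    tendsto_const_div_atTop_nhds_zero_nat 13
  filter_upwards [tendsto_log_natCast.eventually_ge_atTop 160, eventually_gt_atTop 0,
    h13.eventually (gt_mem_nhds (show (0 : ℝ) < r / 4 by positivity))]
    with n hlog hn hsmall u hu hu1 hu2 w hw
  have hn' : (0 : ℝ) < n := by exact_mod_cast hn
  rw [mem_closedBall, dist_eq_norm] at hw
  refine ⟨?_, ?_, ?_⟩
  · have := norm_le_norm_add_norm_sub' w u
    linarith
  · have := norm_le_norm_add_norm_sub w u
    have h1 : Real.log n / (8 * n) + 13 / n ≤ Real.log n / (2 * n) := by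
      rw [div_add_div _ _ (by positivity) (by positivity),
        div_le_div_iff₀ (by positivity) (by positivity)]
      nlinarith [sq_nonneg (n : ℝ), mul_pos hn' hn', mul_pos (mul_pos hn' hn') hn']
    linarith
  · have h1 := (Complex.abs_re_le_norm (w - u)).trans hw
    rw [Complex.sub_re, abs_le] at h1
    have h2 : (n : ℝ) * (13 / n) = 13 := by field_simp
    have h3 : n * (-(13 / n)) ≤ n * (w.re - u.re) := by
      apply mul_le_mul_of_nonneg_left h1.1 hn'.le
    nlinarith

/-- Two solutions whose imaginary parts are close differ by almost a multiple of `2 π i / n`. -/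
lemma eventually_exists_int (hr : 0 < r) (hr1 : r ≤ 1) (hρ : 0 < ρ) (hk : 1 ≤ k) :
    ∀ᶠ n : ℕ in atTop, ∀ g, NearOne r g → ∀ c : ℂ, ‖c‖ = ρ → ∀ u v : ℂ, ‖u‖ < r / 2 → ‖v‖ < r / 2 →
      Complex.exp (n * u) * u ^ k = c * g u → Complex.exp (n * v) * v ^ k = c * g v →
      |(v - u).im| ≤ 20 / n →
      ∃ m : ℤ, ‖n * (v - u) - m * (2 * Real.pi * Complex.I)‖ ≤
        (8 * k + 1) / Real.log n * (4 * Real.pi * |(m : ℝ)|) := by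
  filter_upwards [eventually_bounds hr1 hρ hk,
    eventually_segment_subset r |Real.log (ρ / 2)|,
    eventually_norm_phase_sub_le hr |Real.log (ρ / 2)| k,
    tendsto_log_natCast.eventually_ge_atTop (2 * (8 * k + 1)), eventually_gt_atTop 1]
    with n hbd hseg happrox hlog hn g hg c hc u v hu hv hsu hsv him
  have hlogpos : 0 < Real.log n := Real.log_pos (by exact_mod_cast hn)
  have hub : u ∈ ball (0 : ℂ) r := by rw [mem_ball, dist_zero_right]; linarith
  have hvb : v ∈ ball (0 : ℂ) r := by rw [mem_ball, dist_zero_right]; linarith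
  obtain ⟨hu1, hu2⟩ := hbd g hg u hub (by rw [hsu, norm_mul, hc])
  obtain ⟨hv1, hv2⟩ := hbd g hg v hvb (by rw [hsv, norm_mul, hc])
  have hpos : 0 < Real.log n / (2 * n) := by positivity
  have hu0 : u ≠ 0 := norm_pos_iff.1 (hpos.trans_le hu2)
  have hv0 : v ≠ 0 := norm_pos_iff.1 (hpos.trans_le hv2)
  have hap := happrox g hg u v (hseg u v hu hv hu1 hv1 hu2 hv2 him)
  have hexp : Complex.exp (phase k n g v) = Complex.exp (phase k n g u) := by
    rw [exp_phase (hg.ne_zero hub) hu0, exp_phase (hg.ne_zero hvb) hv0, hsu, hsv,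
      mul_div_cancel_right₀ _ (hg.ne_zero hub), mul_div_cancel_right₀ _ (hg.ne_zero hvb)]
  obtain ⟨m, hm⟩ := Complex.exp_eq_exp_iff_exists_int.1 hexp
  refine ⟨m, ?_⟩
  rw [hm, add_sub_cancel_left, norm_sub_rev] at hap
  refine hap.trans (mul_le_mul_of_nonneg_left ?_ (by positivity))
  -- A relative error at most `1 / 2` can be absorbed: `n ‖v - u‖ ≤ 4 π |m|`. The final bound is
  -- thus proportional to `|m|`, so `m = 0` will force `u = v`.
  have hε : (8 * k + 1) / Real.log n ≤ 1 / 2 := by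
    rw [div_le_iff₀ hlogpos]; linarith
  have h1 : ‖(n : ℂ) * (v - u)‖ = n * ‖v - u‖ := by simp
  have h2 : ‖(m : ℂ) * (2 * Real.pi * Complex.I)‖ = 2 * Real.pi * |(m : ℝ)| := by
    simp [abs_of_pos Real.pi_pos]
    ring
  have h3 := norm_le_norm_add_norm_sub' ((n : ℂ) * (v - u)) (m * (2 * Real.pi * Complex.I))
  rw [h1, h2] at h3
  have h4 : (8 * k + 1) / Real.log n * (n * ‖v - u‖) ≤ 1 / 2 * (n * ‖v - u‖) := by gcongr
  linarith

/-- Starting from a solution of the modulus equation, one can shift the phase by any amount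
that is not too large. -/
lemma eventually_exists_shift (hr : 0 < r) (hr1 : r ≤ 1) (hρ : 0 < ρ) (hk : 1 ≤ k) :
    ∀ᶠ n : ℕ in atTop, ∀ g, NearOne r g → ∀ u : ℂ, ‖u‖ < r / 4 →
      ‖Complex.exp (n * u) * u ^ k‖ = ρ * ‖g u‖ → ∀ τ : ℂ, ‖τ‖ ≤ 2 * Real.pi →
      ∃ v : ℂ, ‖v‖ < r / 2 ∧ ‖v - u‖ ≤ 2 * ‖τ‖ / n ∧
        ‖n * (v - u) - τ‖ ≤ (8 * k + 1) / Real.log n * (4 * Real.pi) ∧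
        Complex.exp (n * v) * v ^ k / g v =
          Complex.exp τ * (Complex.exp (n * u) * u ^ k / g u) := by
  filter_upwards [eventually_bounds hr1 hρ hk,
    eventually_closedBall_subset hr |Real.log (ρ / 2)|,
    eventually_norm_phase_sub_le hr |Real.log (ρ / 2)| k,
    tendsto_log_natCast.eventually_ge_atTop (2 * (8 * k + 1)), eventually_gt_atTop 1]
    with n hbd hball happrox hlog hn g hg u hu hmod τ hτ
  have hn' : (0 : ℝ) < n := by
    have : 0 < n := by omega
    exact_mod_cast this
  have hlogpos : 0 < Real.log n := Real.log_pos (by exact_mod_cast hn)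
  have hub : u ∈ ball (0 : ℂ) r := by rw [mem_ball, dist_zero_right]; linarith
  obtain ⟨hu1, hu2⟩ := hbd g hg u hub hmod
  have hdom := hball u hu hu1 hu2
  have hpos : 0 < Real.log n / (8 * n) := by positivity
  have hpi : 2 * ‖τ‖ / n ≤ 13 / n := by
    gcongr
    linarith [Real.pi_lt_d2]
  have hε : (8 * k + 1) / Real.log n ≤ 1 / 2 := by
    rw [div_le_iff₀ hlogpos]; linarith
  have hmem : ∀ x ∈ closedBall u (2 * ‖τ‖ / n), x ∈ closedBall u (13 / n) :=
    fun x hx => closedBall_subset_closedBall hpi hx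
  -- `phase / n` differs from the identity by a map with Lipschitz constant `1 / 2`. Hence the image
  -- of the disk of radius `2 ‖τ‖ / n` covers the disk of radius `‖τ‖ / n` about the image of `u`,
  -- and the target lies on its boundary.
  have hap : ApproximatesLinearOn (fun w => (n : ℂ)⁻¹ * phase k n g w)
      ((ContinuousLinearEquiv.refl ℂ ℂ : ℂ ≃L[ℂ] ℂ) : ℂ →L[ℂ] ℂ)
      (closedBall u (2 * ‖τ‖ / n)) (1 / 2) := by
    intro x hx y hy
    have h1 := happrox g hg y x (((convex_closedBall u (13 / n)).segment_subset
      (hmem y hy) (hmem x hx)).trans hdom)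
    have hnc : (n : ℂ) ≠ 0 := by
      have : n ≠ 0 := by omega
      exact_mod_cast this
    have h2 : (n : ℂ)⁻¹ * phase k n g x - (n : ℂ)⁻¹ * phase k n g y - (x - y) =
        (n : ℂ)⁻¹ * (phase k n g x - phase k n g y - n * (x - y)) := by
      field_simp
    simp only [ContinuousLinearEquiv.coe_coe, ContinuousLinearEquiv.coe_refl', id_eq]
    rw [h2, norm_mul, norm_inv, Complex.norm_natCast, inv_mul_le_iff₀ hn']
    refine h1.trans ?_
    have h3 : (8 * k + 1) / Real.log n * (n * ‖x - y‖) ≤ 1 / 2 * (n * ‖x - y‖) := by gcongr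
    refine h3.trans (le_of_eq ?_)
    push_cast
    ring
  have hsurj := hap.surjOn_closedBall_of_nonlinearRightInverse
    (ContinuousLinearEquiv.refl ℂ ℂ).toNonlinearRightInverse (by positivity) subset_rfl
  have hnn : (((ContinuousLinearEquiv.refl ℂ ℂ).toNonlinearRightInverse.nnnorm : NNReal) : ℝ)
      = 1 := by
    change ‖(((ContinuousLinearEquiv.refl ℂ ℂ).symm : ℂ ≃L[ℂ] ℂ) : ℂ →L[ℂ] ℂ)‖ = 1
    exact ContinuousLinearMap.norm_id
  rw [hnn] at hsurj
  have hnc : (n : ℂ) ≠ 0 := by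
    have : n ≠ 0 := by omega
    exact_mod_cast this
  obtain ⟨v, hv, hveq⟩ := hsurj (show (n : ℂ)⁻¹ * (phase k n g u + τ) ∈ _ by
    rw [mem_closedBall, dist_eq_norm, ← mul_sub, add_sub_cancel_left, norm_mul, norm_inv,
      Complex.norm_natCast]
    apply le_of_eq
    push_cast
    field_simp
    norm_num)
  have hveq' : phase k n g v = phase k n g u + τ := by
    simpa [hnc] using hveq
  have hvd := hdom (hmem v hv)
  have hvb := mem_ball_of_mem_phaseDomain hr hvd
  rw [mem_closedBall, dist_eq_norm] at hv
  refine ⟨v, hvd.1, hv, ?_, ?_⟩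
  · have h1 := happrox g hg u v (((convex_closedBall u (13 / n)).segment_subset
      (mem_closedBall_self (by positivity)) (hmem v (by rwa [mem_closedBall, dist_eq_norm]))).trans
        hdom)
    rw [hveq', add_sub_cancel_left, norm_sub_rev] at h1
    refine h1.trans (mul_le_mul_of_nonneg_left ?_ (by positivity))
    calc n * ‖v - u‖ ≤ n * (2 * ‖τ‖ / n) := by gcongr
      _ = 2 * ‖τ‖ := by field_simp
      _ ≤ _ := by linarith
  · have hv0 : v ≠ 0 := norm_pos_iff.1 (hpos.trans_le hvd.2.1)
    have hu0 : u ≠ 0 := norm_pos_iff.1 (lt_of_lt_of_le (by positivity) hu2)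
    rw [← exp_phase (hg.ne_zero hvb) hv0, ← exp_phase (hg.ne_zero hub) hu0, hveq',
      Complex.exp_add, mul_comm]

/-- Solutions are simple. -/
lemma eventually_deriv_ne_zero (hr : 0 < r) (hr1 : r ≤ 1) (hρ : 0 < ρ) (hk : 1 ≤ k) :
    ∀ᶠ n : ℕ in atTop, ∀ g, NearOne r g → ∀ c : ℂ, ‖c‖ = ρ → ∀ u : ℂ, ‖u‖ < r / 4 →
      Complex.exp (n * u) * u ^ k = c * g u →
      ¬ HasDerivAt (fun w => Complex.exp (n * w) * w ^ k - c * g w) 0 u := by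
  filter_upwards [eventually_bounds hr1 hρ hk,
    eventually_closedBall_subset hr |Real.log (ρ / 2)|,
    eventually_norm_deriv_le hr |Real.log (ρ / 2)| k,
    tendsto_log_natCast.eventually_ge_atTop (2 * (8 * k + 1)), eventually_gt_atTop 1]
    with n hbd hball hder hlog hn g hg c hc u hu hsu hcon
  have hn' : (0 : ℝ) < n := by
    have : 0 < n := by omega
    exact_mod_cast this
  have hlogpos : 0 < Real.log n := Real.log_pos (by exact_mod_cast hn)
  have hub : u ∈ ball (0 : ℂ) r := by rw [mem_ball, dist_zero_right]; linarith
  obtain ⟨hu1, hu2⟩ := hbd g hg u hub (by rw [hsu, norm_mul, hc])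
  have hdom := hball u hu hu1 hu2 (mem_closedBall_self (by positivity))
  have hu0 : u ≠ 0 := norm_pos_iff.1 (lt_of_lt_of_le (by positivity) hu2)
  have hbound := (hder g hg u hdom).2
  have hg0 := hg.ne_zero hub
  have hc0 : c ≠ 0 := by
    rw [← norm_pos_iff, hc]; exact hρ
  have hgd : HasDerivAt g (deriv g u) u :=
    (hg.differentiableOn.differentiableAt (isOpen_ball.mem_nhds hub)).hasDerivAt
  have h1 : HasDerivAt (fun w => Complex.exp (n * w) * w ^ k - c * g w)
      (Complex.exp (n * u) * (n * 1) * u ^ k + Complex.exp (n * u) * (k * u ^ (k - 1))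
        - c * deriv g u) u := by
    have := ((((hasDerivAt_id u).const_mul (n : ℂ)).cexp).mul (hasDerivAt_pow k u)).sub
      (hgd.const_mul c)
    exact this
  have h2 := h1.unique hcon
  have h3 : u ^ k = u * u ^ (k - 1) := by
    rw [← pow_succ', Nat.sub_add_cancel hk]
  -- At a solution, a vanishing derivative means that the derivative of `phase` vanishes; but it
  -- differs from `n` by at most `n / 2`.
  have h4 : (n : ℂ) = -(k / u - deriv g u / g u) := by
    have h5 : c * g u * (n + (k / u - deriv g u / g u)) = 0 := by
      rw [← h2, mul_add, mul_sub]
      have h6 : c * g u * (deriv g u / g u) = c * deriv g u := by field_simp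
      rw [h6, ← hsu, h3]
      field_simp
      ring
    rcases mul_eq_zero.1 h5 with h | h
    · exact absurd h (mul_ne_zero hc0 hg0)
    · linear_combination h
  have h5 : ‖(n : ℂ)‖ = n := Complex.norm_natCast n
  rw [h4, norm_neg] at h5
  rw [h5] at hbound
  have hε : (8 * k + 1) / Real.log n ≤ 1 / 2 := by
    rw [div_le_iff₀ hlogpos]; linarith
  have : (8 * k + 1) / Real.log n * n ≤ 1 / 2 * n := by gcongr
  linarith

end ZeroSpacing

/-! ### The coordinate `z = b z₀ exp u`; existence and uniqueness of solutions -/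

namespace ZeroSpacing

open Metric Set Topology

lemma arg_exp {w : ℂ} (h : |w.im| < Real.pi) : (Complex.exp w).arg = w.im := by
  rw [abs_lt] at h
  rw [← Complex.log_im, Complex.log_exp h.1 h.2.le]

lemma mul_exp_div_mul_exp {ζ : ℂ} (hζ : ζ ≠ 0) (u v : ℂ) :
    ζ * Complex.exp v / (ζ * Complex.exp u) = Complex.exp (v - u) := by
  rw [mul_div_mul_left _ _ hζ, Complex.exp_sub]

section Coordinates

variable {b s : ℝ} {z₀ z : ℂ}

lemma norm_mul_exp_div (hb : 0 < b) (hz₀ : ‖z₀‖ = 1) (u : ℂ) :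
    ‖b * z₀ * Complex.exp u / b‖ = Real.exp u.re := by
  have : (b : ℂ) ≠ 0 := by exact_mod_cast hb.ne'
  rw [mul_assoc, mul_div_cancel_left₀ _ this, norm_mul, hz₀, one_mul, Complex.norm_exp]

/-- The inner radius is written `exp (-s)` so that the sector becomes the square `|Re u|, |Im u| <
s` in the coordinate `u`. -/
lemma mem_annulus_iff (hb : 0 < b) (hz₀ : ‖z₀‖ = 1) (u : ℂ) :
    b * z₀ * Complex.exp u ∈ OPUC.annulus b (Real.exp (-s)) ↔ |u.re| < s := by
  rw [OPUC.annulus, mem_ofPred_eq, norm_mul_exp_div hb hz₀, ← Real.exp_neg, neg_neg,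
    Real.exp_lt_exp, Real.exp_lt_exp, abs_lt]

lemma mul_exp_div (hz₀ : ‖z₀‖ = 1) (u : ℂ) :
    b * z₀ * Complex.exp u / z₀ = b * Complex.exp u := by
  have : z₀ ≠ 0 := by
    rw [← norm_pos_iff, hz₀]; exact one_pos
  field_simp

lemma mem_sector_iff (hb : 0 < b) (hz₀ : ‖z₀‖ = 1) {u : ℂ} (hu : |u.im| < Real.pi) :
    b * z₀ * Complex.exp u ∈ OPUC.sector b (Real.exp (-s)) s z₀ ↔ |u.re| < s ∧ |u.im| < s := by
  rw [OPUC.sector, mem_ofPred_eq, mem_annulus_iff hb hz₀, mul_exp_div hz₀,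
    Complex.arg_real_mul _ hb, arg_exp hu]

/-- The branch of the logarithm is based at `u`, so that `Im (v - u)` is exactly the principal
argument of the quotient, as the comparison of angles requires. -/
lemma exists_eq_of_mem_annulus (hb : 0 < b) (hz₀ : ‖z₀‖ = 1)
    (hz : z ∈ OPUC.annulus b (Real.exp (-s))) (u : ℂ) :
    ∃ v : ℂ, z = b * z₀ * Complex.exp v ∧ |v.re| < s ∧
      (v - u).im = (z / (b * z₀ * Complex.exp u)).arg := by
  have hz₀' : z₀ ≠ 0 := by
    rw [← norm_pos_iff, hz₀]; exact one_pos
  have hb' : (b : ℂ) ≠ 0 := by exact_mod_cast hb.ne'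
  have hz0 : z ≠ 0 := by
    rintro rfl
    have := hz.1
    simp only [zero_div, norm_zero] at this
    linarith [Real.exp_pos (-s)]
  have hζu : b * z₀ * Complex.exp u ≠ 0 := mul_ne_zero (mul_ne_zero hb' hz₀') (Complex.exp_ne_zero u)
  have hz1 : z = b * z₀ * Complex.exp (u + Complex.log (z / (b * z₀ * Complex.exp u))) := by
    rw [Complex.exp_add, Complex.exp_log (div_ne_zero hz0 hζu)]
    field_simp
  refine ⟨_, hz1, ?_, ?_⟩
  · rw [hz1, mem_annulus_iff hb hz₀] at hz
    exact hz
  · rw [add_sub_cancel_left, Complex.log_im]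

lemma exists_eq_of_mem_sector (hb : 0 < b) (hz₀ : ‖z₀‖ = 1)
    (hz : z ∈ OPUC.sector b (Real.exp (-s)) s z₀) :
    ∃ u : ℂ, z = b * z₀ * Complex.exp u ∧ |u.re| < s ∧ |u.im| < s := by
  obtain ⟨u, hzu, hre, him⟩ := exists_eq_of_mem_annulus hb hz₀ hz.1 0
  refine ⟨u, hzu, hre, ?_⟩
  have h1 := hz.2
  have h2 : z / z₀ = b * (z / (b * z₀ * Complex.exp 0)) := by
    have hz₀' : z₀ ≠ 0 := by
      rw [← norm_pos_iff, hz₀]; exact one_pos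
    have hb' : (b : ℂ) ≠ 0 := by exact_mod_cast hb.ne'
    rw [Complex.exp_zero]
    field_simp
  rw [h2, Complex.arg_real_mul _ hb, ← him, sub_zero] at h1
  exact h1

end Coordinates

lemma norm_exp_sub_one_le {x : ℂ} (hx : ‖x‖ ≤ 1) : ‖Complex.exp x - 1‖ ≤ ‖x‖ + ‖x‖ ^ 2 := by
  have h1 := Complex.norm_exp_sub_one_sub_id_le hx
  have h2 := norm_le_norm_add_norm_sub' (Complex.exp x - 1) x
  linarith

/-- From `log (1 + x) = x + O(x²)`. The factor `1 + q` tends to `1` as `q → 0`, so passing from `u`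
to `exp u - 1` costs only an arbitrarily small part of `κ`. -/
lemma norm_le_of_norm_exp_sub_one {u : ℂ} (hu : |u.im| < Real.pi) {q : ℝ}
    (hq : q ≤ 1 / 2) (h : ‖Complex.exp u - 1‖ ≤ q) : ‖u‖ ≤ q * (1 + q) := by
  set x := Complex.exp u - 1 with hx
  rw [abs_lt] at hu
  have hlog : Complex.log (1 + x) = u := by
    rw [hx, add_sub_cancel, Complex.log_exp hu.1 hu.2.le]
  have h1 := Complex.norm_log_one_add_sub_self_le (show ‖x‖ < 1 by linarith)
  rw [hlog] at h1
  have h2 := norm_le_norm_add_norm_sub' u x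
  have h3 : (1 - ‖x‖)⁻¹ ≤ 2 := by
    rw [inv_le_comm₀ (by linarith) (by norm_num)]
    linarith
  have h4 : ‖x‖ ^ 2 * (1 - ‖x‖)⁻¹ / 2 ≤ ‖x‖ ^ 2 := by
    have := mul_le_mul_of_nonneg_left h3 (sq_nonneg ‖x‖)
    linarith
  nlinarith [norm_nonneg x]

variable {r ρ : ℝ} {k : ℕ}

/-- A ray in the direction of the real axis contains a solution of the modulus equation. -/
lemma eventually_exists_modulus (hr1 : r ≤ 1) (hρ : 0 < ρ) (hk : 1 ≤ k)
    {s : ℝ} (hs : 0 < s) (hsr : s ≤ r / 8) :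
    ∀ᶠ n : ℕ in atTop, ∀ g, NearOne r g → ∀ y : ℝ, |y| < s →
      ∃ u : ℂ, u.im = y ∧ ‖u‖ < r / 4 ∧ ‖Complex.exp (n * u) * u ^ k‖ = ρ * ‖g u‖ := by
  set D := |Real.log (ρ / 2)| with hD
  have h1 : Tendsto (fun n : ℕ => D / n) atTop (𝓝 0) := tendsto_const_div_atTop_nhds_zero_nat D
  have h2 : Tendsto (fun n : ℕ => Real.log (1 + 2 * k * (Real.log n / n))) atTop (𝓝 0) := by
    have h3 : Tendsto (fun n : ℕ => 1 + 2 * k * (Real.log n / n)) atTop (𝓝 1) := by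
      simpa using (tendsto_log_div_natCast.const_mul (2 * (k : ℝ))).const_add 1
    have := (Real.continuousAt_log one_ne_zero).tendsto.comp h3
    simpa using! this
  filter_upwards [eventually_re_le hk ρ, eventually_gt_atTop 0,
    h1.eventually (gt_mem_nhds (show (0 : ℝ) < s / 2 by positivity)),
    h2.eventually (gt_mem_nhds (show (0 : ℝ) < s / 2 by positivity))] with n hre hn hDn hlog g hg y hy
  have hn' : (0 : ℝ) < n := by exact_mod_cast hn
  have hDnn : 0 ≤ D / n := by positivity
  have him : ∀ x : ℝ, ((x : ℂ) + y * Complex.I).im = y := by intro x; simp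
  have hre' : ∀ x : ℝ, ((x : ℂ) + y * Complex.I).re = x := by intro x; simp
  have hnorm : ∀ x ∈ Icc (-(D / n)) (s / 2), ‖(x : ℂ) + y * Complex.I‖ < r / 4 := by
    intro x hx
    have := Complex.norm_le_abs_re_add_abs_im ((x : ℂ) + y * Complex.I)
    rw [him, hre'] at this
    have h4 : |x| ≤ s / 2 := by
      rw [abs_le]; constructor <;> linarith [hx.1, hx.2]
    linarith
  have hmemb : ∀ x ∈ Icc (-(D / n)) (s / 2), (x : ℂ) + y * Complex.I ∈ ball (0 : ℂ) r := by
    intro x hx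
    rw [mem_ball, dist_zero_right]
    linarith [hnorm x hx]
  have hcont : ContinuousOn (fun x : ℝ => ‖Complex.exp (n * ((x : ℂ) + y * Complex.I)) *
      ((x : ℂ) + y * Complex.I) ^ k‖ - ρ * ‖g ((x : ℂ) + y * Complex.I)‖)
      (Icc (-(D / n)) (s / 2)) := by
    have hgc : ContinuousOn (fun x : ℝ => g ((x : ℂ) + y * Complex.I)) (Icc (-(D / n)) (s / 2)) :=
      hg.differentiableOn.continuousOn.comp (by fun_prop) hmemb
    refine ContinuousOn.sub (Continuous.continuousOn (by fun_prop)) (hgc.norm.const_smul ρ)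
  have hab : -(D / n) ≤ s / 2 := by linarith
  have hlow := left_mem_Icc.2 hab
  have hhigh := right_mem_Icc.2 hab
  -- At `x = -D / n` the left side is at most `exp (-D) ≤ ρ / 2`, below `ρ ‖g‖`; at `x = s / 2` the
  -- opposite inequality would violate `eventually_re_le`.
  obtain ⟨x, hx, hx0⟩ := intermediate_value_Icc hab hcont (show (0 : ℝ) ∈ _ by
    constructor
    · rw [norm_exp_mul_pow, hre', sub_nonpos]
      have e1 := hg.norm_ge (hmemb _ hlow)
      have e2 : Real.exp (n * -(D / n)) ≤ ρ / 2 := by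
        have : n * -(D / n) = -D := by field_simp
        rw [this, ← Real.le_log_iff_exp_le (by positivity)]
        exact neg_abs_le _
      have e3 : ‖((-(D / n) : ℝ) : ℂ) + y * Complex.I‖ ^ k ≤ 1 := by
        apply pow_le_one₀ (norm_nonneg _)
        linarith [hnorm _ hlow]
      calc _ ≤ ρ / 2 * 1 := by gcongr
        _ ≤ _ := by nlinarith
    · rw [norm_exp_mul_pow, hre', sub_nonneg]
      have e1 := hg.norm_le (hmemb _ hhigh)
      by_contra! hcon
      have e4 : s / 2 ≤ ‖((s / 2 : ℝ) : ℂ) + y * Complex.I‖ := by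
        have := Complex.re_le_norm (((s / 2 : ℝ) : ℂ) + y * Complex.I)
        rwa [hre'] at this
      have := hre (s / 2) _ e4 (by nlinarith)
      linarith)
  exact ⟨(x : ℂ) + y * Complex.I, him x, hnorm x hx, sub_eq_zero.1 hx0⟩

/-- Solutions have small real part. -/
lemma eventually_abs_re_lt (hr1 : r ≤ 1) (hρ : 0 < ρ) (hk : 1 ≤ k) {s : ℝ} (hs : 0 < s) :
    ∀ᶠ n : ℕ in atTop, ∀ g, NearOne r g → ∀ u ∈ ball (0 : ℂ) r,
      ‖Complex.exp (n * u) * u ^ k‖ = ρ * ‖g u‖ →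
      1 - |Real.log (ρ / 2)| / n ≤ Real.exp u.re ∧
      Real.exp u.re ≤ 1 + 2 * k * (Real.log n / n) ∧ |u.re| < s := by
  set D := |Real.log (ρ / 2)| with hD
  have h1 : Tendsto (fun n : ℕ => D / n) atTop (𝓝 0) := tendsto_const_div_atTop_nhds_zero_nat D
  have h2 : Tendsto (fun n : ℕ => Real.log (1 + 2 * k * (Real.log n / n))) atTop (𝓝 0) := by
    have h3 : Tendsto (fun n : ℕ => 1 + 2 * k * (Real.log n / n)) atTop (𝓝 1) := by
      simpa using (tendsto_log_div_natCast.const_mul (2 * (k : ℝ))).const_add 1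
    have := (Real.continuousAt_log one_ne_zero).tendsto.comp h3
    simpa using! this
  filter_upwards [eventually_re_le hk ρ, eventually_bounds hr1 hρ hk, eventually_gt_atTop 0,
    h1.eventually (gt_mem_nhds hs), h2.eventually (gt_mem_nhds hs)]
    with n hre hbd hn hDn hlog g hg u hu hmod
  have hn' : (0 : ℝ) < n := by exact_mod_cast hn
  have e1 := (hbd g hg u hu hmod).1
  have e2 : -(D / n) ≤ u.re := by
    rw [← neg_div, div_le_iff₀ hn']; linarith
  rw [norm_exp_mul_pow] at hmod
  have e3 := hg.norm_le hu
  have e4 := hre u.re ‖u‖ (Complex.re_le_norm u) (by nlinarith)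
  refine ⟨?_, ?_, ?_⟩
  · linarith [Real.add_one_le_exp u.re]
  · rw [← Real.le_log_iff_exp_le]
    · exact e4
    · have : 0 ≤ Real.log n / n := div_nonneg (Real.log_natCast_nonneg n) hn'.le
      positivity
  · rw [abs_lt]; constructor <;> linarith

/-- The solutions close to a given one. -/
lemma eventually_unique (hr : 0 < r) (hr1 : r ≤ 1) (hρ : 0 < ρ) (hk : 1 ≤ k) :
    ∀ᶠ n : ℕ in atTop, ∀ g, NearOne r g → ∀ c : ℂ, ‖c‖ = ρ → ∀ u v v' : ℂ,
      ‖u‖ < r / 2 → ‖v‖ < r / 2 → ‖v'‖ < r / 2 →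
      Complex.exp (n * u) * u ^ k = c * g u → Complex.exp (n * v) * v ^ k = c * g v →
      Complex.exp (n * v') * v' ^ k = c * g v' → |(v - u).im| ≤ 11 / n → |(v' - u).im| ≤ 11 / n →
      v ≠ u → v' ≠ u → (0 < (v - u).im ↔ 0 < (v' - u).im) → v = v' := by
  have hη : Tendsto (fun n : ℕ => (8 * k + 1) / Real.log n * (4 * Real.pi)) atTop (𝓝 0) := by
    have := (tendsto_log_natCast.const_div_atTop (8 * (k : ℝ) + 1)).mul_const (4 * Real.pi)
    simpa using this
  filter_upwards [eventually_exists_int hr hr1 hρ hk, eventually_gt_atTop 0,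
    hη.eventually (gt_mem_nhds (show (0 : ℝ) < 1 / 4 by norm_num))]
    with n hint hn hsmall g hg c hc u v v' hu hv hv' hsu hsv hsv' hvu hvu' hne hne' hiff
  have hn' : (0 : ℝ) < n := by exact_mod_cast hn
  have hnc : (n : ℂ) ≠ 0 := by exact_mod_cast hn'.ne'
  have h1120 : (11 : ℝ) / n ≤ 20 / n := by gcongr; norm_num
  have hpi := Real.pi_gt_three
  have hbound : ∀ x y : ℂ, ∀ m : ℤ, ‖n * (x - y) - m * (2 * Real.pi * Complex.I)‖ ≤
      (8 * k + 1) / Real.log n * (4 * Real.pi * |(m : ℝ)|) →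
      |n * (x - y).im - 2 * Real.pi * m| ≤ 1 / 4 * |(m : ℝ)| := by
    intro x y m h
    have h1 := (Complex.abs_im_le_norm _).trans h
    have h2 : (n * (x - y) - m * (2 * Real.pi * Complex.I)).im =
        n * (x - y).im - 2 * Real.pi * m := by
      simp [Complex.mul_im]
      ring
    rw [h2, ← mul_assoc] at h1
    refine h1.trans ?_
    gcongr
  have hzero : ∀ x y : ℂ, ‖n * (x - y) - (0 : ℤ) * (2 * Real.pi * Complex.I)‖ ≤
      (8 * k + 1) / Real.log n * (4 * Real.pi * |((0 : ℤ) : ℝ)|) → x = y := by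
    intro x y h
    simp only [Int.cast_zero, zero_mul, sub_zero, abs_zero, mul_zero, norm_le_zero_iff,
      mul_eq_zero, hnc, false_or] at h
    exact sub_eq_zero.1 h
  have hcase : ∀ x : ℂ, ‖x‖ < r / 2 → Complex.exp (n * x) * x ^ k = c * g x →
      |(x - u).im| ≤ 11 / n → x ≠ u → |n * (x - u).im - 2 * Real.pi| ≤ 1 / 4 ∨
        |n * (x - u).im + 2 * Real.pi| ≤ 1 / 4 := by
    intro x hx hsx hxu hxne
    obtain ⟨m, hm⟩ := hint g hg c hc u x hu hx hsu hsx (hxu.trans h1120)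
    have hm0 : m ≠ 0 := by
      rintro rfl
      exact hxne (hzero x u hm)
    have hb := hbound x u m hm
    have h11 : |n * (x - u).im| ≤ 11 := by
      rw [abs_mul, abs_of_pos hn']
      calc n * |(x - u).im| ≤ n * (11 / n) := by gcongr
        _ = 11 := by field_simp
    have hm2 : |(m : ℝ)| < 2 := by
      have h3 := abs_sub_abs_le_abs_sub (2 * Real.pi * m) (n * (x - u).im)
      rw [abs_sub_comm, abs_mul, abs_of_pos (by positivity : 0 < 2 * Real.pi)] at h3
      nlinarith [abs_nonneg (m : ℝ)]
    have hm1 : m = 1 ∨ m = -1 := by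
      have : |m| < 2 := by exact_mod_cast hm2
      rw [abs_lt] at this
      omega
    rcases hm1 with rfl | rfl
    · left; simpa using hb
    · right; simpa using hb
  -- On the same side of `u`, both solutions are within `1 / (4 n)` of the same height, so the
  -- integer attached to the pair `v', v` is `0`.
  have hclose : |n * (v - v').im| ≤ 1 / 2 := by
    have key : n * (v - v').im = n * (v - u).im - n * (v' - u).im := by simp; ring
    rw [key]
    have pos_of : ∀ t : ℝ, |n * t - 2 * Real.pi| ≤ 1 / 4 → 0 < t := by
      intro t ht
      rw [abs_le] at ht
      by_contra! hcon
      nlinarith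
    have neg_of : ∀ t : ℝ, |n * t + 2 * Real.pi| ≤ 1 / 4 → ¬ 0 < t := by
      intro t ht hcon
      rw [abs_le] at ht
      nlinarith
    rcases hcase v hv hsv hvu hne with h1 | h1 <;>
      rcases hcase v' hv' hsv' hvu' hne' with h2 | h2
    · rw [abs_le] at *; constructor <;> linarith
    · exact absurd (hiff.1 (pos_of _ h1)) (neg_of _ h2)
    · exact absurd (hiff.2 (pos_of _ h2)) (neg_of _ h1)
    · rw [abs_le] at *; constructor <;> linarith
  have him : |(v - v').im| ≤ 20 / n := by
    rw [abs_mul, abs_of_pos hn'] at hclose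
    rw [le_div_iff₀ hn']
    linarith
  obtain ⟨m, hm⟩ := hint g hg c hc v' v hv' hv hsv' hsv him
  have hb := hbound v v' m hm
  have hm0 : m = 0 := by
    have h3 := abs_sub_abs_le_abs_sub (2 * Real.pi * m) (n * (v - v').im)
    rw [abs_sub_comm, abs_mul, abs_of_pos (by positivity : 0 < 2 * Real.pi)] at h3
    have : |(m : ℝ)| < 1 := by nlinarith [abs_nonneg (m : ℝ)]
    have : |m| < 1 := by exact_mod_cast this
    exact Int.abs_lt_one_iff.1 this
  subst hm0
  exact hzero v v' hm

end ZeroSpacing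

/-! ### From solutions of the equation to zeros of polynomials -/

namespace ZeroSpacing

open Metric Set Topology

/-- Near the directions of `z₀`, the zeros of `p` in the annulus are, in the coordinate
`z = b z₀ exp u`, the solutions of `exp (n u) * u ^ k = c * g u`. -/
structure LocalForm (b : ℝ) (z₀ : ℂ) (k n : ℕ) (r ρ : ℝ) (p : ℂ[X]) (Q g : ℂ → ℂ) (c : ℂ) :
    Prop where
  ne_zero : p ≠ 0
  nearOne : NearOne r g
  norm_eq : ‖c‖ = ρ
  differentiableOn : DifferentiableOn ℂ Q (ball 0 r)
  factor_ne_zero : ∀ u ∈ ball (0 : ℂ) r, Q u ≠ 0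
  eval_eq : ∀ u ∈ ball (0 : ℂ) r, p.eval (b * z₀ * Complex.exp u) =
    Q u * (Complex.exp (n * u) * u ^ k - c * g u)

variable {b : ℝ} {z₀ : ℂ} {k n : ℕ} {r ρ : ℝ} {p : ℂ[X]} {Q g : ℂ → ℂ} {c u : ℂ}

lemma LocalForm.isRoot_iff (h : LocalForm b z₀ k n r ρ p Q g c) (hu : u ∈ ball (0 : ℂ) r) :
    p.IsRoot (b * z₀ * Complex.exp u) ↔ Complex.exp (n * u) * u ^ k = c * g u := by
  rw [IsRoot.def, h.eval_eq u hu, mul_eq_zero, sub_eq_zero]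
  simp [h.factor_ne_zero u hu]

lemma LocalForm.norm_eq_of_isRoot (h : LocalForm b z₀ k n r ρ p Q g c) (hu : u ∈ ball (0 : ℂ) r)
    (hroot : p.IsRoot (b * z₀ * Complex.exp u)) :
    ‖Complex.exp (n * u) * u ^ k‖ = ρ * ‖g u‖ := by
  rw [(h.isRoot_iff hu).1 hroot, norm_mul, h.norm_eq]

/-- At a multiple root both `p` and its derivative vanish, and then so does the derivative of the
quotient by the nonvanishing factor `Q`. -/
lemma LocalForm.rootMultiplicity_eq_one (h : LocalForm b z₀ k n r ρ p Q g c)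
    (hu : u ∈ ball (0 : ℂ) r) (hroot : p.IsRoot (b * z₀ * Complex.exp u))
    (hder : ¬ HasDerivAt (fun w => Complex.exp (n * w) * w ^ k - c * g w) 0 u) :
    p.rootMultiplicity (b * z₀ * Complex.exp u) = 1 := by
  have h1 := (rootMultiplicity_pos h.ne_zero).2 hroot
  by_contra hcon
  have h2 : 1 < p.rootMultiplicity (b * z₀ * Complex.exp u) := by omega
  obtain ⟨-, h3⟩ := (one_lt_rootMultiplicity_iff_isRoot h.ne_zero).1 h2
  apply hder
  have hQ := (h.differentiableOn.differentiableAt (isOpen_ball.mem_nhds hu)).hasDerivAt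
  have hp : HasDerivAt (fun w => p.eval (b * z₀ * Complex.exp w))
      (p.derivative.eval (b * z₀ * Complex.exp u) * (b * z₀ * Complex.exp u)) u :=
    HasDerivAt.comp (h₂ := fun x => p.eval x) (h := fun w => b * z₀ * Complex.exp w) u
      (p.hasDerivAt _) ((Complex.hasDerivAt_exp u).const_mul _)
  have h4 := hp.div hQ (h.factor_ne_zero u hu)
  rw [IsRoot.def] at h3 hroot
  rw [h3, hroot, zero_mul, zero_mul, zero_mul, sub_zero, zero_div] at h4
  refine h4.congr_of_eventuallyEq ?_
  filter_upwards [isOpen_ball.mem_nhds hu] with w hw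
  change _ = p.eval (b * z₀ * Complex.exp w) / Q w
  rw [h.eval_eq w hw, mul_div_cancel_left₀ _ (h.factor_ne_zero w hw)]

lemma eventually_localization (hb : 0 < b) (hz₀ : ‖z₀‖ = 1) (hr1 : r ≤ 1)
    (hρ : 0 < ρ) (hk : 1 ≤ k) {s : ℝ} (hs : 0 < s) (hsr : s ≤ r / 8) :
    ∀ᶠ n : ℕ in atTop, ∀ p Q g c, LocalForm b z₀ k n r ρ p Q g c →
      ∀ z ∈ OPUC.sector b (Real.exp (-s)) s z₀, p.IsRoot z →
          1 - |Real.log (ρ / 2)| / n ≤ ‖z / (b : ℂ)‖ ∧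
          ‖z / (b : ℂ)‖ ≤ 1 + 2 * k * (Real.log n / n) := by
  filter_upwards [eventually_abs_re_lt hr1 hρ hk hs] with n hn p Q g c h z hz hroot
  obtain ⟨u, rfl, hre, him⟩ := exists_eq_of_mem_sector hb hz₀ hz
  have hu : u ∈ ball (0 : ℂ) r := by
    rw [mem_ball, dist_zero_right]
    have := Complex.norm_le_abs_re_add_abs_im u
    linarith
  have := hn g h.nearOne u hu (h.norm_eq_of_isRoot hu hroot)
  rw [norm_mul_exp_div hb hz₀]
  exact ⟨this.1, this.2.1⟩

lemma eventually_distance (hb : 0 < b) (hz₀ : ‖z₀‖ = 1) (hr1 : r ≤ 1)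
    (hρ : 0 < ρ) {s : ℝ} (hs : 0 < s) (hsr : s ≤ r / 8) {κ : ℝ} (hκ : κ < k) :
    ∀ᶠ n : ℕ in atTop, ∀ p Q g c, LocalForm b z₀ k n r ρ p Q g c →
      ∀ z ∈ OPUC.sector b (Real.exp (-s)) s z₀, p.IsRoot z →
          κ * (Real.log n / n) ≤ ‖z / (b : ℂ) - z₀‖ := by
  rcases le_or_gt κ 0 with h0 | h0
  · filter_upwards with n p Q g c h z hz hroot
    have h1 : 0 ≤ Real.log n / n := div_nonneg (Real.log_natCast_nonneg n) (Nat.cast_nonneg n)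
    exact (mul_nonpos_of_nonpos_of_nonneg h0 h1).trans (norm_nonneg _)
  -- The gap between `κ` and `κ'` pays for replacing `‖u‖` by `‖exp u - 1‖`.
  obtain ⟨κ', hκ1, hκ2⟩ := exists_between hκ
  have hlim : Tendsto (fun n : ℕ => κ * (Real.log n / n)) atTop (𝓝 0) := by
    simpa using tendsto_log_div_natCast.const_mul κ
  have hlim2 : Tendsto (fun n : ℕ => κ * (1 + κ * (Real.log n / n))) atTop (𝓝 κ) := by
    simpa using (hlim.const_add 1).const_mul κ
  filter_upwards [eventually_le_norm hρ hκ2, eventually_gt_atTop 1,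
    hlim.eventually (gt_mem_nhds (show (0 : ℝ) < 1 / 2 by norm_num)),
    hlim2.eventually (gt_mem_nhds hκ1)] with n hn hn1 hhalf hlt p Q g c h z hz hroot
  have hn' : (0 : ℝ) < n := by
    have : 0 < n := by omega
    exact_mod_cast this
  have hlogpos : 0 < Real.log n := Real.log_pos (by exact_mod_cast hn1)
  obtain ⟨u, rfl, hre, him⟩ := exists_eq_of_mem_sector hb hz₀ hz
  have hu : u ∈ ball (0 : ℂ) r := by
    rw [mem_ball, dist_zero_right]
    have := Complex.norm_le_abs_re_add_abs_im u
    linarith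
  have hmod := h.norm_eq_of_isRoot hu hroot
  rw [norm_exp_mul_pow] at hmod
  have h1 := h.nearOne.norm_ge hu
  have h2 := hn u.re ‖u‖ (norm_nonneg _) (Complex.re_le_norm u) (by nlinarith)
  have h3 : b * z₀ * Complex.exp u / b - z₀ = z₀ * (Complex.exp u - 1) := by
    have : (b : ℂ) ≠ 0 := by exact_mod_cast hb.ne'
    field_simp
  rw [h3, norm_mul, hz₀, one_mul]
  by_contra! hcon
  have h4 := norm_le_of_norm_exp_sub_one (by linarith [Real.pi_gt_three]) hhalf.le hcon.le
  have h5 : κ * (Real.log n / n) * (1 + κ * (Real.log n / n)) =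
      κ * (1 + κ * (Real.log n / n)) * (Real.log n / n) := by ring
  rw [h5] at h4
  have h6 : κ * (1 + κ * (Real.log n / n)) * (Real.log n / n) < κ' * (Real.log n / n) := by gcongr
  linarith

/-- A point with the argument of `z₁` solves the modulus equation. Its phase is then wrong by at
most `π`, and correcting it moves the point by at most `2 π / n`. -/
lemma eventually_exists_root (hb : 0 < b) (hz₀ : ‖z₀‖ = 1) (hr : 0 < r) (hr1 : r ≤ 1)
    (hρ : 0 < ρ) (hk : 1 ≤ k) {s : ℝ} (hs : 0 < s) (hsr : s ≤ r / 8) :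
    ∀ᶠ n : ℕ in atTop, ∀ p Q g c, LocalForm b z₀ k n r ρ p Q g c →
      ∀ z₁ ∈ OPUC.sector b (Real.exp (-s)) s z₀, ∃ z ∈ OPUC.annulus b (Real.exp (-s)),
        p.IsRoot z ∧ |(z / z₁).arg| ≤ 2 * Real.pi / n ∧
          (|(z₁ / z₀).arg| + 2 * Real.pi / n < s → z ∈ OPUC.sector b (Real.exp (-s)) s z₀) := by
  have hlim : Tendsto (fun n : ℕ => 2 * Real.pi / n) atTop (𝓝 0) :=
    tendsto_const_div_atTop_nhds_zero_nat _
  filter_upwards [eventually_abs_re_lt hr1 hρ hk hs, eventually_exists_modulus hr1 hρ hk hs hsr,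
    eventually_exists_shift hr hr1 hρ hk, hlim.eventually (gt_mem_nhds one_pos)]
    with n hre hmod hshift hsmall p Q g c h z₁ hz₁
  have hpi := Real.pi_gt_three
  have hz₀' : z₀ ≠ 0 := by
    rw [← norm_pos_iff, hz₀]; exact one_pos
  have hb' : (b : ℂ) ≠ 0 := by exact_mod_cast hb.ne'
  have hζ : (b : ℂ) * z₀ ≠ 0 := mul_ne_zero hb' hz₀'
  obtain ⟨u₁, rfl, hre₁, him₁⟩ := exists_eq_of_mem_sector hb hz₀ hz₁
  obtain ⟨u, huim, hur, humod⟩ := hmod g h.nearOne u₁.im him₁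
  have hu : u ∈ ball (0 : ℂ) r := by
    rw [mem_ball, dist_zero_right]; linarith
  have hg0 := h.nearOne.ne_zero hu
  have hc0 : c ≠ 0 := by
    rw [← norm_pos_iff, h.norm_eq]; exact hρ
  set w := Complex.exp (n * u) * u ^ k / (c * g u) with hw
  have hwnorm : ‖w‖ = 1 := by
    have : 0 < ‖g u‖ := norm_pos_iff.2 hg0
    rw [hw, norm_div, humod, norm_mul, h.norm_eq]
    field_simp
  have hwexp : Complex.exp (w.arg * Complex.I) = w := by
    have := Complex.norm_mul_exp_arg_mul_I w
    rwa [hwnorm, Complex.ofReal_one, one_mul] at this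
  have hτ : ‖(-(w.arg * Complex.I) : ℂ)‖ ≤ Real.pi := by
    rw [norm_neg, norm_mul, Complex.norm_I, mul_one, Complex.norm_real]
    exact Complex.abs_arg_le_pi w
  obtain ⟨v, hv, hvu, -, hveq⟩ := hshift g h.nearOne u hur humod _ (by linarith)
  have hvb : v ∈ ball (0 : ℂ) r := by
    rw [mem_ball, dist_zero_right]; linarith
  have hgv := h.nearOne.ne_zero hvb
  have hroot : p.IsRoot (b * z₀ * Complex.exp v) := by
    rw [h.isRoot_iff hvb, ← div_eq_iff hgv, hveq, Complex.exp_neg, hwexp, hw]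
    have : Complex.exp (n * u) * u ^ k ≠ 0 := by
      rw [← norm_ne_zero_iff, humod]
      exact mul_ne_zero hρ.ne' (norm_ne_zero_iff.2 hg0)
    generalize Complex.exp (n * u) * u ^ k = t at *
    field_simp
  have hvre := (hre g h.nearOne v hvb (h.norm_eq_of_isRoot hvb hroot)).2.2
  have hvim : |(v - u₁).im| ≤ 2 * Real.pi / n := by
    have h1 : (v - u₁).im = (v - u).im := by simp [huim]
    rw [h1]
    refine (Complex.abs_im_le_norm _).trans (hvu.trans ?_)
    gcongr
  refine ⟨_, (mem_annulus_iff hb hz₀ v).2 hvre, hroot, ?_, ?_⟩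
  · rw [mul_exp_div_mul_exp hζ, arg_exp (by linarith)]
    exact hvim
  · intro hlt
    rw [mul_exp_div hz₀, Complex.arg_real_mul _ hb, arg_exp (by linarith)] at hlt
    have h1 : |v.im| < s := by
      have h2 := abs_sub_abs_le_abs_sub v.im u₁.im
      rw [← Complex.sub_im] at h2
      linarith
    exact (mem_sector_iff hb hz₀ (by linarith)).2 ⟨hvre, h1⟩

/-- Shifting the phase by `± 2 π i` produces the two neighbours, and `eventually_unique` excludes
any other root with `|Im (v - u)| ≤ 11 / n`. Nearness in distance and nearness in angle are both
reduced to that window. -/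
lemma eventually_neighbours (hb : 0 < b) (hz₀ : ‖z₀‖ = 1) (hr : 0 < r) (hr1 : r ≤ 1)
    (hρ : 0 < ρ) (hk : 1 ≤ k) {s : ℝ} (hs : 0 < s) (hsr : s ≤ r / 8) :
    ∀ᶠ n : ℕ in atTop, ∀ p Q g c, LocalForm b z₀ k n r ρ p Q g c →
      ∀ z ∈ OPUC.sector b (Real.exp (-s)) s z₀, p.IsRoot z →
          p.rootMultiplicity z = 1 ∧
          ∃ zp zm : ℂ, p.IsRoot zp ∧ p.IsRoot zm ∧
            zp ≠ z ∧ zm ≠ z ∧ zp ≠ zm ∧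
            (∀ w : ℂ, p.IsRoot w → w ≠ z → w ≠ zp → w ≠ zm →
              ‖zp - z‖ < ‖w - z‖ ∧ ‖zm - z‖ < ‖w - z‖) ∧
            (∀ w ∈ OPUC.annulus b (Real.exp (-s)), p.IsRoot w →
              w ≠ z → w ≠ zp → w ≠ zm →
              (w / z).arg < (zm / z).arg ∨ (zp / z).arg < (w / z).arg) ∧
            |(zp / z).arg - 2 * Real.pi / n| ≤ (8 * k + 1) * (8 * Real.pi) / (n * Real.log n) ∧
            |(zm / z).arg + 2 * Real.pi / n| ≤ (8 * k + 1) * (8 * Real.pi) / (n * Real.log n) ∧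
            |‖zp / z‖ - 1| ≤ (8 * k + 1) * (8 * Real.pi) / (n * Real.log n) ∧
            |‖zm / z‖ - 1| ≤ (8 * k + 1) * (8 * Real.pi) / (n * Real.log n) := by
  have hη : Tendsto (fun n : ℕ => (8 * k + 1) / Real.log n * (4 * Real.pi)) atTop (𝓝 0) := by
    have := (tendsto_log_natCast.const_div_atTop (8 * (k : ℝ) + 1)).mul_const (4 * Real.pi)
    simpa using this
  have hlim : Tendsto (fun n : ℕ => (11 : ℝ) / n) atTop (𝓝 0) :=
    tendsto_const_div_atTop_nhds_zero_nat _
  filter_upwards [eventually_deriv_ne_zero hr hr1 hρ hk, eventually_unique hr hr1 hρ hk,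
    eventually_exists_shift hr hr1 hρ hk, eventually_gt_atTop 100,
    hη.eventually (gt_mem_nhds (show (0 : ℝ) < 1 / 8 by norm_num)),
    hlim.eventually (gt_mem_nhds (show (0 : ℝ) < r / 8 by positivity))]
    with n hder huniq hshift hn hη8 hsmall p Q g c h z hz hroot
  have hpi := Real.pi_gt_three
  have hpi' := Real.pi_lt_d2
  have hn100 : (100 : ℝ) < n := by exact_mod_cast hn
  have hn' : (0 : ℝ) < n := by linarith
  have hlogpos : 0 < Real.log n := Real.log_pos (by linarith)
  have hz₀' : z₀ ≠ 0 := by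
    rw [← norm_pos_iff, hz₀]; exact one_pos
  have hb' : (b : ℂ) ≠ 0 := by exact_mod_cast hb.ne'
  have hζ : (b : ℂ) * z₀ ≠ 0 := mul_ne_zero hb' hz₀'
  obtain ⟨u, rfl, hure, huim⟩ := exists_eq_of_mem_sector hb hz₀ hz
  have hzne : b * z₀ * Complex.exp u ≠ 0 := mul_ne_zero hζ (Complex.exp_ne_zero u)
  have hunorm : ‖u‖ < r / 4 := by
    have := Complex.norm_le_abs_re_add_abs_im u
    linarith
  have hu : u ∈ ball (0 : ℂ) r := by
    rw [mem_ball, dist_zero_right]; linarith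
  have hsu := (h.isRoot_iff hu).1 hroot
  have humod := h.norm_eq_of_isRoot hu hroot
  set η := (8 * k + 1) / Real.log n * (4 * Real.pi) with hηdef
  have hη0 : 0 ≤ η := by positivity
  -- the neighbour in the direction of the sign `σ`
  have hnb : ∀ σ : ℝ, |σ| = 1 → ∃ v : ℂ, ‖v‖ < r / 2 ∧ p.IsRoot (b * z₀ * Complex.exp v) ∧
      Complex.exp (n * v) * v ^ k = c * g v ∧
      |(v - u).im - σ * (2 * Real.pi / n)| ≤ η / n ∧ |(v - u).re| ≤ η / n ∧
      ‖v - u‖ ≤ 6.45 / n := by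
    intro σ hσ
    have hτ : ‖(σ * (2 * Real.pi * Complex.I) : ℂ)‖ = 2 * Real.pi := by
      simp [hσ, abs_of_pos Real.pi_pos]
    obtain ⟨v, hv, -, hvu, hveq⟩ := hshift g h.nearOne u hunorm humod _ hτ.le
    have hvb : v ∈ ball (0 : ℂ) r := by
      rw [mem_ball, dist_zero_right]; linarith
    have hexp : Complex.exp (σ * (2 * Real.pi * Complex.I)) = 1 := by
      rcases (abs_eq zero_le_one).1 hσ with rfl | rfl
      · simp [Complex.exp_two_pi_mul_I]
      · simp [Complex.exp_neg, Complex.exp_two_pi_mul_I]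
    have hsv : Complex.exp (n * v) * v ^ k = c * g v := by
      rw [hexp, one_mul, hsu, mul_div_cancel_right₀ _ (h.nearOne.ne_zero hu),
        div_eq_iff (h.nearOne.ne_zero hvb)] at hveq
      exact hveq
    refine ⟨v, hv, (h.isRoot_iff hvb).2 hsv, hsv, ?_, ?_, ?_⟩
    · have h1 := (Complex.abs_im_le_norm _).trans hvu
      have h2 : (n * (v - u) - σ * (2 * Real.pi * Complex.I)).im =
          n * ((v - u).im - σ * (2 * Real.pi / n)) := by
        simp [Complex.mul_im]
        field_simp
      rw [h2, abs_mul, abs_of_pos hn'] at h1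
      rw [le_div_iff₀ hn']
      linarith
    · have h1 := (Complex.abs_re_le_norm _).trans hvu
      have h2 : (n * (v - u) - σ * (2 * Real.pi * Complex.I)).re = n * (v - u).re := by
        simp [Complex.mul_re]
      rw [h2, abs_mul, abs_of_pos hn'] at h1
      rw [le_div_iff₀ hn']
      linarith
    -- `6.45` bounds `2 π + η`, since `π < 3.15` and `η < 1 / 8`.
    · have h1 := norm_le_norm_add_norm_sub' ((n : ℂ) * (v - u)) (σ * (2 * Real.pi * Complex.I))
      rw [hτ, norm_mul, Complex.norm_natCast] at h1
      rw [le_div_iff₀ hn']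
      linarith
  have hηn : η / n ≤ (1 / 8) / n := by gcongr
  have hηA : η / n * 2 = (8 * k + 1) * (8 * Real.pi) / (n * Real.log n) := by
    rw [hηdef]; field_simp; ring
  have hηn0 : 0 ≤ η / n := by positivity
  have hinv : (11 : ℝ) / n < 0.11 := by
    rw [div_lt_iff₀ hn']; linarith
  have hinv' : (11 : ℝ) / n = 11 * (1 / n) := by ring
  have h8 : (1 / 8) / (n : ℝ) = 1 / 8 * (1 / n) := by ring
  have h2pi : 2 * Real.pi / (n : ℝ) = 2 * Real.pi * (1 / n) := by ring
  have hin : 0 < 1 / (n : ℝ) := by positivity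
  have hpin : 3 * (1 / (n : ℝ)) < Real.pi * (1 / n) := by gcongr
  have hpin' : Real.pi * (1 / n) < 3.15 * (1 / (n : ℝ)) := by gcongr
  obtain ⟨vp, hvp, hrp, hsp, himp, hrep, hnp⟩ := hnb 1 (by simp)
  obtain ⟨vm, hvm, hrm, hsm, himm, hrem, hnm⟩ := hnb (-1) (by simp)
  rw [one_mul] at himp
  rw [neg_one_mul, sub_neg_eq_add] at himm
  have himp' := abs_le.1 himp
  have himm' := abs_le.1 himm
  have hpim : |(vp - u).im| < Real.pi := by
    rw [abs_lt]; constructor <;> linarith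
  have hmim : |(vm - u).im| < Real.pi := by
    rw [abs_lt]; constructor <;> linarith
  have hargp : (b * z₀ * Complex.exp vp / (b * z₀ * Complex.exp u)).arg = (vp - u).im := by
    rw [mul_exp_div_mul_exp hζ, arg_exp hpim]
  have hargm : (b * z₀ * Complex.exp vm / (b * z₀ * Complex.exp u)).arg = (vm - u).im := by
    rw [mul_exp_div_mul_exp hζ, arg_exp hmim]
  have hvpu : vp ≠ u := by
    rintro rfl
    simp only [sub_self, Complex.zero_im] at himp'
    linarith
  have hvmu : vm ≠ u := by
    rintro rfl
    simp only [sub_self, Complex.zero_im] at himm'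
    linarith
  -- a root close to `z` is one of the two neighbours
  have hcl : ∀ v : ℂ, ‖v‖ < r / 2 → p.IsRoot (b * z₀ * Complex.exp v) → |(v - u).im| ≤ 11 / n →
      v = u ∨ v = vp ∨ v = vm := by
    intro v hv hrv hvu
    by_cases hne : v = u
    · exact Or.inl hne
    right
    have hvb : v ∈ ball (0 : ℂ) r := by
      rw [mem_ball, dist_zero_right]; linarith
    have hsv := (h.isRoot_iff hvb).1 hrv
    by_cases hpos : 0 < (v - u).im
    · left
      refine huniq g h.nearOne c h.norm_eq u v vp (by linarith) hv hvp hsu hsv hsp hvu ?_ hne hvpu ?_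
      · rw [abs_le]; constructor <;> linarith
      · exact iff_of_true hpos (by linarith)
    · right
      refine huniq g h.nearOne c h.norm_eq u v vm (by linarith) hv hvm hsu hsv hsm hvu ?_ hne hvmu ?_
      · rw [abs_le]; constructor <;> linarith
      · exact iff_of_false hpos (by linarith)
  -- A root `w` no farther than a neighbour has `‖w / z - 1‖ ≤ 7 / n`, as `6.45 * 1.07 < 7`. Then
  -- `‖log (w / z)‖ ≤ 10.5 / n`, inside the window `11 / n` of `hcl`.
  have hdist : ∀ v : ℂ, ‖v - u‖ ≤ 6.45 / n → ∀ w : ℂ, p.IsRoot w → w ≠ b * z₀ * Complex.exp u →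
      w ≠ b * z₀ * Complex.exp vp → w ≠ b * z₀ * Complex.exp vm →
      ‖b * z₀ * Complex.exp v - b * z₀ * Complex.exp u‖ < ‖w - b * z₀ * Complex.exp u‖ := by
    intro v hv w hw h1 h2 h3
    by_contra! hcon
    have e1 : b * z₀ * Complex.exp v - b * z₀ * Complex.exp u =
        b * z₀ * Complex.exp u * (Complex.exp (v - u) - 1) := by
      rw [Complex.exp_sub]
      field_simp
    set x := w / (b * z₀ * Complex.exp u) - 1 with hx
    have e2 : w - b * z₀ * Complex.exp u = b * z₀ * Complex.exp u * x := by
      rw [hx, mul_sub, mul_div_cancel₀ _ hzne, mul_one]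
    rw [e1, e2, norm_mul _ x, norm_mul _ (Complex.exp (v - u) - 1)] at hcon
    have e3 : ‖x‖ ≤ ‖Complex.exp (v - u) - 1‖ :=
      le_of_mul_le_mul_left hcon (norm_pos_iff.2 hzne)
    have hv1 : ‖v - u‖ ≤ 6.45 * (1 / n) := by rw [mul_one_div]; exact hv
    have e4 := norm_exp_sub_one_le (x := v - u) (by linarith)
    have e5 : ‖x‖ ≤ 7 * (1 / n) := by
      have : ‖v - u‖ ^ 2 ≤ 6.45 * (1 / n) * 0.07 := by
        rw [sq]
        apply mul_le_mul hv1 _ (norm_nonneg _) (by positivity)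
        linarith
      linarith
    have e6 := Complex.norm_log_one_add_half_le_self (z := x) (by linarith)
    have e7 : 1 + x = w / (b * z₀ * Complex.exp u) := by rw [hx]; ring
    have hw0 : 1 + x ≠ 0 := by
      intro h0
      have : x = -1 := by linear_combination h0
      rw [this, norm_neg, norm_one] at e5
      linarith
    have e8 : w = b * z₀ * Complex.exp (u + Complex.log (1 + x)) := by
      rw [Complex.exp_add, Complex.exp_log hw0, e7]
      field_simp
    have e9 := norm_add_le u (Complex.log (1 + x))
    have e10 := Complex.abs_im_le_norm (Complex.log (1 + x))
    rw [e8] at hw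
    have := hcl _ (by linarith) hw (by rw [add_sub_cancel_left]; linarith)
    rcases this with h' | h' | h' <;> rw [h'] at e8
    · exact h1 e8
    · exact h2 e8
    · exact h3 e8
  have hmodulus : ∀ v : ℂ, |(v - u).re| ≤ η / n →
      |‖b * z₀ * Complex.exp v / (b * z₀ * Complex.exp u)‖ - 1| ≤
        (8 * k + 1) * (8 * Real.pi) / (n * Real.log n) := by
    intro v hv
    rw [mul_exp_div_mul_exp hζ, Complex.norm_exp, ← hηA]
    -- `|exp x - 1| ≤ 2 |x|` doubles `4 π` to the `8 π` of the final constant.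
    have := Real.abs_exp_sub_one_le (x := (v - u).re) (by linarith)
    linarith
  refine ⟨h.rootMultiplicity_eq_one hu hroot (hder g h.nearOne c h.norm_eq u hunorm hsu),
    b * z₀ * Complex.exp vp, b * z₀ * Complex.exp vm, hrp, hrm, ?_, ?_, ?_, ?_, ?_, ?_, ?_,
    hmodulus vp hrep, hmodulus vm hrem⟩
  · intro heq
    rw [heq, div_self hzne, Complex.arg_one] at hargp
    linarith
  · intro heq
    rw [heq, div_self hzne, Complex.arg_one] at hargm
    linarith
  · intro heq
    rw [heq, hargm] at hargp
    linarith
  · exact fun w hw h1 h2 h3 => ⟨hdist vp hnp w hw h1 h2 h3, hdist vm hnm w hw h1 h2 h3⟩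
  · intro w hwA hw h1 h2 h3
    by_contra! hcon
    obtain ⟨v, hv, hvre, hvim⟩ := exists_eq_of_mem_annulus hb hz₀ hwA u
    rw [hargm, hargp, ← hvim] at hcon
    have e1 : |(v - u).im| ≤ 11 / n := by
      rw [abs_le]; constructor <;> linarith
    have e2 : ‖v‖ < r / 2 := by
      have e3 := Complex.norm_le_abs_re_add_abs_im v
      have e4 := abs_sub_abs_le_abs_sub v.im u.im
      rw [← Complex.sub_im] at e4
      linarith
    rw [hv] at hw h1 h2 h3
    rcases hcl v e2 hw e1 with rfl | rfl | rfl
    · exact h1 rfl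
    · exact h2 rfl
    · exact h3 rfl
  · rw [hargp, ← hηA]; linarith
  · rw [hargm, ← hηA]; linarith

end ZeroSpacing

/-! ### Orthogonal polynomials on the unit circle -/

namespace OPUC

/-- `p ↦ z ^ n * conj (p (1 / conj z))`. -/
noncomputable def starPoly (n : ℕ) (p : ℂ[X]) : ℂ[X] := (p.map (starRingEnd ℂ)).reflect n

lemma coeff_starPoly (n : ℕ) (p : ℂ[X]) {i : ℕ} (hi : i ≤ n) :
    (starPoly n p).coeff i = conj (p.coeff (n - i)) := by
  rw [starPoly, coeff_reflect, revAt_le hi, coeff_map]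

lemma coeff_starPoly_of_lt (n : ℕ) (p : ℂ[X]) (hp : p.natDegree ≤ n) {i : ℕ} (hi : n < i) :
    (starPoly n p).coeff i = 0 := by
  rw [starPoly, coeff_reflect, revAt_eq_self_of_lt hi, coeff_map,
    coeff_eq_zero_of_natDegree_lt (by omega), map_zero]

lemma eval_starPoly {n : ℕ} {p : ℂ[X]} (hp : p.natDegree ≤ n) {z : ℂ} (hz : z ≠ 0) :
    (starPoly n p).eval z = z ^ n * conj (p.eval (conj z)⁻¹) := by
  have hz' : z⁻¹ ≠ 0 := inv_ne_zero hz
  let _ : Invertible z⁻¹ := invertibleOfNonzero hz'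
  have h1 := eval₂_reflect_mul_pow (RingHom.id ℂ) z⁻¹ n (p.map (starRingEnd ℂ))
    (by rwa [natDegree_map])
  rw [invOf_eq_inv, inv_inv, ← eval, ← eval] at h1
  have h2 : conj (p.eval (conj z)⁻¹) = (p.map (starRingEnd ℂ)).eval z⁻¹ := by
    rw [eval_map, hom_eval₂_conj]
  rw [h2, ← h1, starPoly, inv_pow]
  field_simp
where
  hom_eval₂_conj : conj (p.eval (conj z)⁻¹) = p.eval₂ (starRingEnd ℂ) z⁻¹ := by
    rw [← coe_eval₂RingHom, eval, ← coe_eval₂RingHom, coe_eval₂RingHom, hom_eval₂]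
    simp

lemma conj_inv_coe (ζ : Circle) : (conj (ζ : ℂ))⁻¹ = ζ := by
  rw [← Circle.coe_inv_eq_conj, ← Circle.coe_inv, inv_inv]

lemma eval_starPoly_coe {n : ℕ} {p : ℂ[X]} (hp : p.natDegree ≤ n) (ζ : Circle) :
    (starPoly n p).eval (ζ : ℂ) = (ζ : ℂ) ^ n * conj (p.eval (ζ : ℂ)) := by
  rw [eval_starPoly hp ζ.coe_ne_zero, conj_inv_coe]

lemma norm_eval_starPoly_coe {n : ℕ} {p : ℂ[X]} (hp : p.natDegree ≤ n) (ζ : Circle) :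
    ‖(starPoly n p).eval (ζ : ℂ)‖ = ‖p.eval (ζ : ℂ)‖ := by
  rw [eval_starPoly_coe hp, norm_mul, norm_pow, Circle.norm_coe, one_pow, one_mul, RCLike.norm_conj]

lemma continuous_eval_coe (p : ℂ[X]) : Continuous fun ζ : Circle => p.eval (ζ : ℂ) :=
  p.continuous.comp continuous_subtype_val

lemma integrable_of_continuous (μ : Measure Circle) [IsFiniteMeasure μ] {E : Type*}
    [NormedAddCommGroup E] [SecondCountableTopologyEither Circle E] {f : Circle → E}
    (hf : Continuous f) : Integrable f μ :=
  hf.integrable_of_hasCompactSupport (HasCompactSupport.of_compactSpace f)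

section Inner

variable (μ : Measure Circle)

lemma polyInner_C_mul_right (p q : ℂ[X]) (a : ℂ) :
    polyInner μ p (C a * q) = a * polyInner μ p q := by
  simp only [polyInner]
  rw [← integral_const_mul]
  simp only [eval_mul, eval_C]
  congr 1
  ext ζ
  ring

lemma polyInner_zero_right (p : ℂ[X]) : polyInner μ p 0 = 0 := by simp [polyInner]

lemma conj_polyInner (p q : ℂ[X]) : conj (polyInner μ p q) = polyInner μ q p := by
  simp only [polyInner]
  rw [← integral_conj]
  congr 1
  ext ζ
  simp [mul_comm]

lemma polyInner_X_mul (p q : ℂ[X]) : polyInner μ (X * p) (X * q) = polyInner μ p q := by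
  simp only [polyInner]
  congr 1
  ext ζ
  have h : conj (ζ : ℂ) * ζ = 1 := by
    rw [mul_comm, Complex.mul_conj, Complex.normSq_eq_norm_sq, Circle.norm_coe]
    simp
  simp only [eval_mul, eval_X, map_mul]
  linear_combination (conj (p.eval (ζ : ℂ)) * q.eval (ζ : ℂ)) * h

lemma polyInner_self (p : ℂ[X]) :
    polyInner μ p p = ((∫ ζ : Circle, ‖p.eval (ζ : ℂ)‖ ^ 2 ∂μ : ℝ) : ℂ) := by
  rw [polyInner, ← integral_complex_ofReal]
  congr 1
  ext ζ
  rw [mul_comm, Complex.mul_conj, Complex.normSq_eq_norm_sq]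

/-- On the circle both integrands equal `ζ ^ n * conj p * conj q`, which is symmetric in `p` and
`q`. -/
lemma polyInner_starPoly_right {n : ℕ} {p q : ℂ[X]} (hp : p.natDegree ≤ n) (hq : q.natDegree ≤ n) :
    polyInner μ p (starPoly n q) = polyInner μ q (starPoly n p) := by
  simp only [polyInner]
  congr 1
  ext ζ
  rw [eval_starPoly_coe hp, eval_starPoly_coe hq]
  ring

variable [IsProbabilityMeasure μ]

lemma integrable_polyInner (p q : ℂ[X]) :
    Integrable (fun ζ : Circle => conj (p.eval (ζ : ℂ)) * q.eval (ζ : ℂ)) μ :=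
  integrable_of_continuous μ
    ((Complex.continuous_conj.comp (continuous_eval_coe p)).mul (continuous_eval_coe q))

lemma polyInner_add_right (p q q' : ℂ[X]) :
    polyInner μ p (q + q') = polyInner μ p q + polyInner μ p q' := by
  simp only [polyInner]
  rw [← integral_add (integrable_polyInner μ p q) (integrable_polyInner μ p q')]
  simp only [eval_add, mul_add]

lemma polyInner_sub_right (p q q' : ℂ[X]) :
    polyInner μ p (q - q') = polyInner μ p q - polyInner μ p q' := by
  simp only [polyInner]
  rw [← integral_sub (integrable_polyInner μ p q) (integrable_polyInner μ p q')]
  simp only [eval_sub, mul_sub]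

lemma polyInner_sum_right {ι : Type*} (s : Finset ι) (p : ℂ[X]) (q : ι → ℂ[X]) :
    polyInner μ p (∑ j ∈ s, q j) = ∑ j ∈ s, polyInner μ p (q j) := by
  classical
  induction s using Finset.induction_on with
  | empty => simp [polyInner]
  | insert a s ha ih => rw [Finset.sum_insert ha, Finset.sum_insert ha, polyInner_add_right, ih]

variable {μ}

lemma integral_norm_sq_pos (hμ : Nontrivial μ) {p : ℂ[X]} (hp : p ≠ 0) :
    0 < ∫ ζ : Circle, ‖p.eval (ζ : ℂ)‖ ^ 2 ∂μ := by
  have hint : Integrable (fun ζ : Circle => ‖p.eval (ζ : ℂ)‖ ^ 2) μ :=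
    integrable_of_continuous μ ((continuous_eval_coe p).norm.pow 2)
  rw [integral_pos_iff_support_of_nonneg (fun ζ => by positivity) hint, pos_iff_ne_zero]
  have hfin : {ζ : Circle | p.eval (ζ : ℂ) = 0}.Finite := by
    have h1 : {z : ℂ | p.IsRoot z}.Finite := finite_setOfPred_isRoot hp
    exact h1.preimage Circle.coe_injective.injOn
  convert hμ _ hfin using 2
  ext ζ
  simp

lemma polyInner_self_ne_zero (hμ : Nontrivial μ) {p : ℂ[X]} (hp : p ≠ 0) :
    polyInner μ p p ≠ 0 := by
  rw [polyInner_self]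
  exact_mod_cast (integral_norm_sq_pos hμ hp).ne'

end Inner

section MonicOP

variable (μ : Measure Circle)

lemma monicOP_eq (n : ℕ) : monicOP μ n = X ^ n - ∑ j : Fin n,
    C (polyInner μ (monicOP μ j) (X ^ n) / polyInner μ (monicOP μ j) (monicOP μ j)) *
      monicOP μ j := by
  rw [monicOP]

lemma monic_natDegree_monicOP (n : ℕ) : (monicOP μ n).Monic ∧ (monicOP μ n).natDegree = n := by
  induction n using Nat.strong_induction_on with
  | _ n ih =>
    have hdeg : (∑ j : Fin n,
        C (polyInner μ (monicOP μ j) (X ^ n) / polyInner μ (monicOP μ j) (monicOP μ j)) *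
        monicOP μ j).degree < n := by
      refine (degree_sum_le _ _).trans_lt ?_
      rw [Finset.sup_lt_iff (by exact WithBot.bot_lt_coe n)]
      intro j _
      rw [← smul_eq_C_mul]
      refine (degree_smul_le _ _).trans_lt ?_
      refine degree_le_natDegree.trans_lt ?_
      rw [(ih j j.2).2]
      exact_mod_cast j.2
    rw [monicOP_eq]
    have hm : (X ^ n - ∑ j : Fin n,
        C (polyInner μ (monicOP μ j) (X ^ n) / polyInner μ (monicOP μ j) (monicOP μ j)) *
        monicOP μ j).Monic := monic_X_pow_sub hdeg
    refine ⟨hm, ?_⟩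
    have := degree_sub_eq_left_of_degree_lt (hdeg.trans_eq (degree_X_pow (R := ℂ) n).symm)
    rw [degree_X_pow] at this
    exact natDegree_eq_of_degree_eq_some this

lemma monic_monicOP (n : ℕ) : (monicOP μ n).Monic := (monic_natDegree_monicOP μ n).1

lemma natDegree_monicOP (n : ℕ) : (monicOP μ n).natDegree = n := (monic_natDegree_monicOP μ n).2

lemma coeff_monicOP_self (n : ℕ) : (monicOP μ n).coeff n = 1 := by
  have := (monic_monicOP μ n).coeff_natDegree
  rwa [natDegree_monicOP] at this

lemma monicOP_zero : monicOP μ 0 = 1 := by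
  rw [monicOP_eq]; simp

variable {μ} [IsProbabilityMeasure μ]

lemma polyInner_monicOP (hμ : Nontrivial μ) {m n : ℕ} (h : m < n) :
    polyInner μ (monicOP μ m) (monicOP μ n) = 0 := by
  induction n using Nat.strong_induction_on generalizing m with
  | _ n ih =>
    rw [monicOP_eq μ n, polyInner_sub_right, polyInner_sum_right,
      Finset.sum_eq_single (⟨m, h⟩ : Fin n)]
    · rw [polyInner_C_mul_right, div_mul_cancel₀, sub_self]
      exact polyInner_self_ne_zero hμ (monic_monicOP μ m).ne_zero
    · intro j _ hj
      rw [polyInner_C_mul_right]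
      have hne : (j : ℕ) ≠ m := fun h' => hj (Fin.ext h')
      rcases lt_or_gt_of_ne hne with hlt | hlt
      · rw [← conj_polyInner μ (monicOP μ j) (monicOP μ m), ih m h hlt, map_zero, mul_zero]
      · rw [ih j j.2 hlt, mul_zero]
    · simp

lemma polyInner_monicOP_of_degree_lt (hμ : Nontrivial μ) {n : ℕ} {p : ℂ[X]} (hp : p.degree < n) :
    polyInner μ (monicOP μ n) p = 0 := by
  have key : ∀ d ≤ n, ∀ p : ℂ[X], p.degree < d → polyInner μ (monicOP μ n) p = 0 := by
    intro d
    induction d with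
    | zero =>
      intro _ p hp
      have : p = 0 := by
        rw [← degree_eq_bot]; exact Nat.WithBot.lt_zero_iff.1 hp
      rw [this, polyInner_zero_right]
    | succ d ih =>
      intro hd p hp
      have h1 : p = (p - C (p.coeff d) * monicOP μ d) + C (p.coeff d) * monicOP μ d := by ring
      rw [h1, polyInner_add_right, polyInner_C_mul_right, ← conj_polyInner μ (monicOP μ d),
        polyInner_monicOP hμ (by omega), map_zero, mul_zero, add_zero]
      refine ih (by omega) _ ?_
      rw [degree_lt_iff_coeff_zero] at hp ⊢
      intro m hm
      rw [coeff_sub, coeff_C_mul]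
      rcases hm.eq_or_lt with rfl | hlt
      · rw [coeff_monicOP_self, mul_one, sub_self]
      · rw [hp m hlt, coeff_eq_zero_of_natDegree_lt (p := monicOP μ d)
          (by rw [natDegree_monicOP]; exact hlt), mul_zero, sub_zero]
  exact key n le_rfl p hp

lemma degree_starPoly_lt {n : ℕ} {p : ℂ[X]} (hp : p.natDegree ≤ n) (h0 : p.coeff 0 = 0) :
    (starPoly n p).degree < n := by
  rw [degree_lt_iff_coeff_zero]
  intro m hm
  rcases hm.eq_or_lt with rfl | hlt
  · rw [coeff_starPoly _ _ le_rfl, Nat.sub_self, h0, map_zero]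
  · exact coeff_starPoly_of_lt _ _ hp hlt

/-- The Szegő recursion. -/
theorem monicOP_succ (hμ : Nontrivial μ) (n : ℕ) :
    monicOP μ (n + 1) = X * monicOP μ n -
      C (conj (verblunsky μ n)) * starPoly n (monicOP μ n) := by
  have hα : conj (verblunsky μ n) = -(monicOP μ (n + 1)).coeff 0 := by
    simp [verblunsky, coeff_zero_eq_eval_zero]
  set a := conj (verblunsky μ n) with ha
  -- The defect `R` has degree at most `n` and, by the choice of `a`, vanishes at `0`. So `R = X *
  -- S` with `deg S < n`, and it suffices to see that `⟨R, R⟩ = ⟨S, S⟩` is `0`.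
  set R := monicOP μ (n + 1) - X * monicOP μ n + C a * starPoly n (monicOP μ n) with hR
  have hdΦ := natDegree_monicOP μ n
  have hR0 : R.coeff 0 = 0 := by
    rw [hR, coeff_add, coeff_sub, mul_coeff_zero, coeff_X_zero, zero_mul, coeff_C_mul,
      coeff_starPoly _ _ (Nat.zero_le n), Nat.sub_zero, coeff_monicOP_self, map_one, hα]
    ring
  have hRdeg : R.degree < (n + 1 : ℕ) := by
    rw [degree_lt_iff_coeff_zero]
    intro m hm
    obtain ⟨m, rfl⟩ : ∃ l, m = l + 1 := ⟨m - 1, by omega⟩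
    rw [hR, coeff_add, coeff_sub, coeff_X_mul, coeff_C_mul,
      coeff_starPoly_of_lt _ _ hdΦ.le (by omega), mul_zero, add_zero]
    rcases hm.eq_or_lt with h | h
    · obtain rfl : n = m := by omega
      rw [coeff_monicOP_self, coeff_monicOP_self, sub_self]
    · rw [coeff_eq_zero_of_natDegree_lt (p := monicOP μ n) (by omega),
        coeff_eq_zero_of_natDegree_lt (p := monicOP μ (n + 1)) (by rw [natDegree_monicOP]; omega),
        sub_self]
  have hRX : X * R.divX = R := by
    have := X_mul_divX_add R
    rwa [hR0, C_0, add_zero] at this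
  have hdiv : R.divX.degree < n := by
    rw [degree_lt_iff_coeff_zero] at hRdeg ⊢
    intro m hm
    rw [coeff_divX]
    exact hRdeg _ (by omega)
  have hRnat : R.natDegree ≤ n := by
    rw [natDegree_le_iff_degree_le]
    exact Order.le_of_lt_succ (by exact_mod_cast hRdeg)
  -- `R` is orthogonal to each of its three parts: to `Φ_{n+1}` by degree, to `X Φ_n` because `⟨X S,
  -- X Φ_n⟩ = ⟨S, Φ_n⟩`, and to `Φ_n^*` because `⟨R, Φ_n^*⟩ = ⟨Φ_n, R^*⟩` and `R(0) = 0` lowers the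
  -- degree of `R^*`.
  have hzero : polyInner μ R.divX R.divX = 0 := by
    rw [← polyInner_X_mul, hRX]
    nth_rewrite 2 [hR]
    rw [polyInner_add_right, polyInner_sub_right, polyInner_C_mul_right,
      polyInner_starPoly_right μ hRnat hdΦ.le,
      polyInner_monicOP_of_degree_lt hμ (degree_starPoly_lt hRnat hR0),
      ← conj_polyInner μ (monicOP μ (n + 1)), polyInner_monicOP_of_degree_lt hμ hRdeg]
    nth_rewrite 1 [← hRX]
    rw [polyInner_X_mul, ← conj_polyInner, polyInner_monicOP_of_degree_lt hμ hdiv]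
    simp
  have hdiv0 : R.divX = 0 := by
    by_contra hne
    exact polyInner_self_ne_zero hμ hne hzero
  have hR00 : R = 0 := by rw [← hRX, hdiv0, mul_zero]
  rw [hR] at hR00
  linear_combination hR00

lemma eval_monicOP_succ (hμ : Nontrivial μ) (n : ℕ) (z : ℂ) :
    (monicOP μ (n + 1)).eval z = z * (monicOP μ n).eval z -
      conj (verblunsky μ n) * (starPoly n (monicOP μ n)).eval z := by
  rw [monicOP_succ hμ]
  simp

lemma eval_starPoly_zero (μ : Measure Circle) (n : ℕ) :
    (starPoly n (monicOP μ n)).eval 0 = 1 := by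
  rw [← coeff_zero_eq_eval_zero, coeff_starPoly _ _ (Nat.zero_le n), Nat.sub_zero,
    coeff_monicOP_self, map_one]

/-- The Szegő recursion at `1 / conj z`, conjugated and multiplied by `z ^ (n + 1)`. -/
lemma eval_starPoly_succ (hμ : Nontrivial μ) (n : ℕ) (z : ℂ) :
    (starPoly (n + 1) (monicOP μ (n + 1))).eval z = (starPoly n (monicOP μ n)).eval z -
      verblunsky μ n * (z * (monicOP μ n).eval z) := by
  rcases eq_or_ne z 0 with rfl | hz
  · simp [eval_starPoly_zero]
  have hcz : conj z ≠ 0 := by simpa using hz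
  rw [eval_starPoly (natDegree_monicOP μ (n + 1)).le hz, eval_monicOP_succ hμ,
    eval_starPoly (natDegree_monicOP μ n).le hz,
    eval_starPoly (natDegree_monicOP μ n).le (inv_ne_zero hcz)]
  simp only [map_sub, map_mul, map_inv₀, Complex.conj_conj, inv_inv, map_pow]
  have h1 : z ^ n * (z⁻¹) ^ n = 1 := by rw [← mul_pow, mul_inv_cancel₀ hz, one_pow]
  have h2 : z * z⁻¹ = 1 := mul_inv_cancel₀ hz
  linear_combination (z ^ n * conj ((monicOP μ n).eval (conj z)⁻¹)) * h2 -
    (z * verblunsky μ n * (monicOP μ n).eval z) * h1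

/-- In `X Φ_n = Φ_{n+1} + conj α_n Φ_n^*` the summands are orthogonal and `‖Φ_n^*‖ = ‖Φ_n‖`.
Pythagoras gives `‖Φ_{n+1}‖² = (1 - |α_n|²) ‖Φ_n‖²`, and the left side is positive. -/
lemma norm_verblunsky_lt_one (hμ : Nontrivial μ) (n : ℕ) : ‖verblunsky μ n‖ < 1 := by
  set Φ := monicOP μ n with hΦ
  set Ψ := monicOP μ (n + 1) with hΨ
  set a := verblunsky μ n with ha
  have hd : Φ.natDegree ≤ n := (natDegree_monicOP μ n).le
  have horth : polyInner μ Ψ (starPoly n Φ) = 0 := by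
    refine polyInner_monicOP_of_degree_lt hμ ?_
    rw [degree_lt_iff_coeff_zero]
    intro m hm
    exact coeff_starPoly_of_lt _ _ hd (by omega)
  have hX : X * Φ = Ψ + C (conj a) * starPoly n Φ := by
    rw [hΨ, monicOP_succ hμ]; ring
  have h1 : polyInner μ Φ Φ = polyInner μ Ψ Ψ + a * conj a *
      polyInner μ (starPoly n Φ) (starPoly n Φ) := by
    rw [← polyInner_X_mul, hX, polyInner_add_right, polyInner_C_mul_right,
      ← conj_polyInner μ Ψ (Ψ + _), ← conj_polyInner μ (starPoly n Φ) (Ψ + _),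
      polyInner_add_right, polyInner_add_right, polyInner_C_mul_right, polyInner_C_mul_right,
      horth, ← conj_polyInner μ Ψ (starPoly n Φ), horth]
    simp only [map_mul, Complex.conj_conj, mul_zero, map_zero, add_zero, zero_add,
      conj_polyInner]
    ring
  have hpos := integral_norm_sq_pos hμ (monic_monicOP μ (n + 1)).ne_zero
  have hpos' := integral_norm_sq_pos hμ (monic_monicOP μ n).ne_zero
  rw [polyInner_self, polyInner_self, polyInner_self, Complex.mul_conj,
    Complex.normSq_eq_norm_sq] at h1
  simp only [norm_eval_starPoly_coe hd] at h1
  norm_cast at h1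
  by_contra! hcon
  have : 1 ≤ ‖a‖ ^ 2 := one_le_pow₀ hcon
  nlinarith

end MonicOP

end OPUC

/-! ### The limit of the reversed polynomials -/

namespace OPUC

open Metric Set Topology

lemma one_sub_sum_le_prod {x : ℕ → ℝ} (h0 : ∀ j, 0 ≤ x j) (h1 : ∀ j, x j ≤ 1) (n : ℕ) :
    0 ≤ ∏ j ∈ Finset.range n, (1 - x j) ∧ ∏ j ∈ Finset.range n, (1 - x j) ≤ 1 ∧
      1 - ∑ j ∈ Finset.range n, x j ≤ ∏ j ∈ Finset.range n, (1 - x j) := by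
  induction n with
  | zero => simp
  | succ n ih =>
    obtain ⟨ha, hb, hc⟩ := ih
    rw [Finset.prod_range_succ, Finset.sum_range_succ]
    have h2 := h0 n
    have h3 := h1 n
    refine ⟨by nlinarith, by nlinarith, by nlinarith⟩

/-- A tail of sum below `1 / 2` contributes a factor at least `1 / 2`, and the finite head is
positive. -/
lemma exists_pos_le_prod {x : ℕ → ℝ} (h0 : ∀ j, 0 ≤ x j) (h1 : ∀ j, x j < 1) (hs : Summable x) :
    ∃ m > 0, ∀ n, m ≤ ∏ j ∈ Finset.range n, (1 - x j) := by
  obtain ⟨N, hN⟩ := ((tendsto_sum_nat_add x).eventually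
    (gt_mem_nhds (show (0 : ℝ) < 1 / 2 by norm_num))).exists
  have hpos : 0 < ∏ j ∈ Finset.range N, (1 - x j) :=
    Finset.prod_pos fun j _ => by linarith [h1 j]
  refine ⟨(∏ j ∈ Finset.range N, (1 - x j)) * (1 / 2), by positivity, fun n => ?_⟩
  have hanti : Antitone fun n => ∏ j ∈ Finset.range n, (1 - x j) := by
    refine antitone_nat_of_succ_le fun n => ?_
    rw [Finset.prod_range_succ]
    have h2 := (one_sub_sum_le_prod h0 (fun j => (h1 j).le) n).1
    nlinarith [h0 n]
  refine le_trans ?_ (hanti (Nat.le_add_left n N))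
  simp only
  rw [Finset.prod_range_add]
  refine mul_le_mul_of_nonneg_left ?_ hpos.le
  have h3 := (one_sub_sum_le_prod (x := fun i => x (N + i)) (fun j => h0 _)
    (fun j => (h1 _).le) n).2.2
  have h4 : ∑ i ∈ Finset.range n, x (N + i) ≤ ∑' i, x (i + N) := by
    simp only [add_comm N]
    exact Summable.sum_le_tsum _ (fun i _ => h0 _) ((summable_nat_add_iff N).2 hs)
  linarith

variable {μ : Measure Circle} [IsProbabilityMeasure μ]

lemma norm_eval_le_prod (hμ : Nontrivial μ) (n : ℕ) (z : ℂ) :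
    ‖(monicOP μ n).eval z‖ ≤
      (∏ j ∈ Finset.range n, (1 + ‖verblunsky μ j‖)) * max 1 ‖z‖ ^ n ∧
    ‖(starPoly n (monicOP μ n)).eval z‖ ≤
      (∏ j ∈ Finset.range n, (1 + ‖verblunsky μ j‖)) * max 1 ‖z‖ ^ n := by
  induction n with
  | zero =>
    have h : (starPoly 0 (1 : ℂ[X])) = 1 := by
      simp [starPoly]
    simp [monicOP_zero, h]
  | succ n ih =>
    obtain ⟨h1, h2⟩ := ih
    rw [eval_monicOP_succ hμ, eval_starPoly_succ hμ, Finset.prod_range_succ, pow_succ]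
    set R := max 1 ‖z‖
    set B := ∏ j ∈ Finset.range n, (1 + ‖verblunsky μ j‖)
    have hR1 : 1 ≤ R := le_max_left _ _
    have hzR : ‖z‖ ≤ R := le_max_right _ _
    have ha := norm_nonneg (verblunsky μ n)
    set a := ‖verblunsky μ n‖
    have hz1 : ‖z * (monicOP μ n).eval z‖ ≤ B * R ^ n * R := by
      rw [norm_mul, mul_comm]
      gcongr
    have hB : 0 ≤ B * R ^ n := (norm_nonneg _).trans h1
    have h2' : ‖(starPoly n (monicOP μ n)).eval z‖ ≤ B * R ^ n * R := by nlinarith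
    constructor
    · refine (norm_sub_le _ _).trans ?_
      rw [norm_mul (conj _), RCLike.norm_conj]
      have := mul_le_mul_of_nonneg_left h2' ha
      calc _ ≤ B * R ^ n * R + a * (B * R ^ n * R) := add_le_add hz1 this
        _ = _ := by ring
    · refine (norm_sub_le _ _).trans ?_
      rw [norm_mul (verblunsky μ n)]
      have := mul_le_mul_of_nonneg_left hz1 ha
      calc _ ≤ B * R ^ n * R + a * (B * R ^ n * R) := add_le_add h2' this
        _ = _ := by ring

lemma exists_norm_eval_le (hμ : Nontrivial μ) (hs : Summable fun j => ‖verblunsky μ j‖) :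
    ∃ M > 0, ∀ n z, ‖(monicOP μ n).eval z‖ ≤ M * max 1 ‖z‖ ^ n ∧
      ‖(starPoly n (monicOP μ n)).eval z‖ ≤ M * max 1 ‖z‖ ^ n := by
  refine ⟨Real.exp (∑' j, ‖verblunsky μ j‖), Real.exp_pos _, fun n z => ?_⟩
  have h1 : ∏ j ∈ Finset.range n, (1 + ‖verblunsky μ j‖) ≤ Real.exp (∑' j, ‖verblunsky μ j‖) := by
    refine (Real.prod_one_add_le_exp_sum _ (fun j => norm_nonneg _)).trans ?_
    rw [Real.exp_le_exp]
    exact Summable.sum_le_tsum _ (fun i _ => norm_nonneg _) hs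
  obtain ⟨h2, h3⟩ := norm_eval_le_prod hμ n z
  exact ⟨h2.trans (by gcongr), h3.trans (by gcongr)⟩

/-- With `p = Φ_n^*` and `w = z Φ_n`, this carries `|Φ_n| ≤ |Φ_n^*|` on the closed disk from `n` to
`n + 1`. -/
lemma normSq_sub_normSq (a p w : ℂ) :
    Complex.normSq (p - a * w) - Complex.normSq (w - conj a * p) =
      (1 - Complex.normSq a) * (Complex.normSq p - Complex.normSq w) := by
  simp only [Complex.normSq_apply, Complex.sub_re, Complex.sub_im, Complex.mul_re, Complex.mul_im,
    Complex.conj_re, Complex.conj_im]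
  ring

/-- The first bound yields `|Φ_{n+1}^*| ≥ (1 - |α_n|) |Φ_n^*|`. For summable coefficients the lower
bound stays positive in the limit, so `limitStar` has no zeros on the closed disk. -/
lemma prod_le_norm_eval_starPoly (hμ : Nontrivial μ) (n : ℕ) {z : ℂ} (hz : ‖z‖ ≤ 1) :
    ‖(monicOP μ n).eval z‖ ≤ ‖(starPoly n (monicOP μ n)).eval z‖ ∧
      ∏ j ∈ Finset.range n, (1 - ‖verblunsky μ j‖) ≤ ‖(starPoly n (monicOP μ n)).eval z‖ := by
  induction n with
  | zero =>
    have h : (starPoly 0 (1 : ℂ[X])) = 1 := by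
      simp [starPoly]
    simp [monicOP_zero, h]
  | succ n ih =>
    obtain ⟨h1, h2⟩ := ih
    rw [eval_monicOP_succ hμ, eval_starPoly_succ hμ, Finset.prod_range_succ]
    have ha := norm_verblunsky_lt_one hμ n
    have hzΦ : ‖z * (monicOP μ n).eval z‖ ≤ ‖(starPoly n (monicOP μ n)).eval z‖ := by
      rw [norm_mul]
      nlinarith [norm_nonneg ((monicOP μ n).eval z)]
    constructor
    · have h3 := normSq_sub_normSq (verblunsky μ n) ((starPoly n (monicOP μ n)).eval z)
        (z * (monicOP μ n).eval z)
      simp only [Complex.normSq_eq_norm_sq] at h3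
      have h4 : 0 ≤ (1 - ‖verblunsky μ n‖ ^ 2) * (‖(starPoly n (monicOP μ n)).eval z‖ ^ 2 -
          ‖z * (monicOP μ n).eval z‖ ^ 2) := by
        apply mul_nonneg
        · have := pow_le_one₀ (n := 2) (norm_nonneg _) ha.le
          linarith
        · have : ‖z * (monicOP μ n).eval z‖ ^ 2 ≤ ‖(starPoly n (monicOP μ n)).eval z‖ ^ 2 := by
            gcongr
          linarith
      refine (sq_le_sq₀ (norm_nonneg _) (norm_nonneg _)).1 ?_
      linarith
    · have h3 := norm_sub_norm_le ((starPoly n (monicOP μ n)).eval z)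
        (verblunsky μ n * (z * (monicOP μ n).eval z))
      rw [norm_mul (verblunsky μ n)] at h3
      nlinarith [norm_nonneg (verblunsky μ n)]

variable (μ) in
/-- The limit of the reversed monic orthogonal polynomials. -/
noncomputable def limitStar (z : ℂ) : ℂ :=
  1 - ∑' j, verblunsky μ j * (z * (monicOP μ j).eval z)

lemma eval_starPoly_eq_sum (hμ : Nontrivial μ) (n : ℕ) (z : ℂ) :
    (starPoly n (monicOP μ n)).eval z =
      1 - ∑ j ∈ Finset.range n, verblunsky μ j * (z * (monicOP μ j).eval z) := by
  induction n with
  | zero =>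
    have h : (starPoly 0 (1 : ℂ[X])) = 1 := by
      simp [starPoly]
    simp [monicOP_zero, h]
  | succ n ih => rw [eval_starPoly_succ hμ, ih, Finset.sum_range_succ]; ring

lemma limitStar_zero (μ : Measure Circle) : limitStar μ 0 = 1 := by simp [limitStar]

section Geometric

variable {b K M : ℝ}

/-- The decay `b ^ j` of the coefficients beats the growth `R ^ j` of `Φ_j` as long as `R < 1 / b`,
which is the radius up to which `limitStar` is holomorphic. -/
lemma norm_term_le (hb0 : 0 < b) (hK : ∀ j, ‖verblunsky μ j‖ ≤ K * b ^ j)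
    (hM : ∀ n z, ‖(monicOP μ n).eval z‖ ≤ M * max 1 ‖z‖ ^ n) {R : ℝ} (hR : 1 ≤ R) {z : ℂ}
    (hz : ‖z‖ ≤ R) (j : ℕ) :
    ‖verblunsky μ j * (z * (monicOP μ j).eval z)‖ ≤ K * R * M * (b * R) ^ j := by
  have hK0 : 0 ≤ K * b ^ j := (norm_nonneg _).trans (hK j)
  have hR' : max 1 ‖z‖ ≤ R := max_le hR hz
  have hM0 : 0 ≤ M := by
    have := (norm_nonneg _).trans (hM 0 0)
    simpa using this
  rw [norm_mul, norm_mul]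
  calc _ ≤ K * b ^ j * (R * (M * R ^ j)) := by
        gcongr
        · exact hK j
        · refine (hM j z).trans ?_
          gcongr
    _ = _ := by rw [mul_pow]; ring

lemma exists_radius (hb0 : 0 < b) (hb1 : b < 1) {z : ℂ} (hz : z ∈ ball (0 : ℂ) b⁻¹) :
    ∃ R, 1 ≤ R ∧ ‖z‖ < R ∧ b * R < 1 := by
  rw [mem_ball, dist_zero_right] at hz
  have h1 : (1 : ℝ) < b⁻¹ := (one_lt_inv₀ hb0).2 hb1
  obtain ⟨R, h2, h3⟩ := exists_between (max_lt h1 hz)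
  refine ⟨R, (le_max_left _ _).trans h2.le, (le_max_right _ _).trans_lt h2, ?_⟩
  calc b * R < b * b⁻¹ := by gcongr
    _ = 1 := mul_inv_cancel₀ hb0.ne'

lemma summable_geometric_mul (hb0 : 0 < b) {R : ℝ} (hR : 1 ≤ R) (hbR : b * R < 1) (c : ℝ) :
    Summable fun j : ℕ => c * (b * R) ^ j :=
  (summable_geometric_of_lt_one (by positivity) hbR).mul_left c

lemma differentiableOn_limitStar (hb0 : 0 < b) (hb1 : b < 1)
    (hK : ∀ j, ‖verblunsky μ j‖ ≤ K * b ^ j)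
    (hM : ∀ n z, ‖(monicOP μ n).eval z‖ ≤ M * max 1 ‖z‖ ^ n) :
    DifferentiableOn ℂ (limitStar μ) (ball 0 b⁻¹) := by
  intro z hz
  obtain ⟨R, hR1, hzR, hbR⟩ := exists_radius hb0 hb1 hz
  have h1 : DifferentiableOn ℂ (fun w => ∑' j, verblunsky μ j * (w * (monicOP μ j).eval w))
      (ball 0 R) := by
    refine Complex.differentiableOn_tsum_of_summable_norm
      (summable_geometric_mul hb0 hR1 hbR (K * R * M)) (fun j => ?_) isOpen_ball ?_
    · exact ((differentiable_id.mul (monicOP μ j).differentiable).const_mul _).differentiableOn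
    · intro j w hw
      rw [mem_ball, dist_zero_right] at hw
      exact norm_term_le hb0 hK hM hR1 hw.le j
  have h2 := h1.differentiableAt (isOpen_ball.mem_nhds (show z ∈ ball (0 : ℂ) R by
    rwa [mem_ball, dist_zero_right]))
  exact (h2.const_sub 1).differentiableWithinAt

lemma tendsto_starPoly (hμ : Nontrivial μ) (hb0 : 0 < b) (hb1 : b < 1)
    (hK : ∀ j, ‖verblunsky μ j‖ ≤ K * b ^ j)
    (hM : ∀ n z, ‖(monicOP μ n).eval z‖ ≤ M * max 1 ‖z‖ ^ n) {z : ℂ} (hz : z ∈ ball (0 : ℂ) b⁻¹) :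
    Tendsto (fun n => (starPoly n (monicOP μ n)).eval z) atTop (𝓝 (limitStar μ z)) := by
  obtain ⟨R, hR1, hzR, hbR⟩ := exists_radius hb0 hb1 hz
  have hs : Summable fun j => verblunsky μ j * (z * (monicOP μ j).eval z) :=
    Summable.of_norm_bounded (summable_geometric_mul hb0 hR1 hbR (K * R * M))
      (norm_term_le hb0 hK hM hR1 hzR.le)
  simp only [eval_starPoly_eq_sum hμ]
  exact hs.hasSum.tendsto_sum_nat.const_sub 1

lemma norm_starPoly_sub_limitStar_le (hμ : Nontrivial μ) (hb0 : 0 < b) (hb1 : b < 1)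
    (hK : ∀ j, ‖verblunsky μ j‖ ≤ K * b ^ j)
    (hM : ∀ n z, ‖(monicOP μ n).eval z‖ ≤ M * max 1 ‖z‖ ^ n) {z : ℂ} (hz : ‖z‖ ≤ 1) (n : ℕ) :
    ‖(starPoly n (monicOP μ n)).eval z - limitStar μ z‖ ≤ K * M / (1 - b) * b ^ n := by
  have hterm := norm_term_le hb0 hK hM le_rfl hz
  simp only [mul_one] at hterm
  have hsg : Summable fun j : ℕ => K * M * b ^ j :=
    (summable_geometric_of_lt_one hb0.le hb1).mul_left _
  have hs : Summable fun j => verblunsky μ j * (z * (monicOP μ j).eval z) :=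
    Summable.of_norm_bounded hsg hterm
  have h1 := hs.sum_add_tsum_nat_add n
  have h2 : (starPoly n (monicOP μ n)).eval z - limitStar μ z =
      ∑' i, verblunsky μ (i + n) * (z * (monicOP μ (i + n)).eval z) := by
    rw [eval_starPoly_eq_sum hμ, limitStar, ← h1]
    ring
  rw [h2]
  have h3 : HasSum (fun i : ℕ => K * M * b ^ n * b ^ i) (K * M * b ^ n * (1 - b)⁻¹) :=
    (hasSum_geometric_of_lt_one hb0.le hb1).mul_left _
  refine (tsum_of_norm_bounded h3 fun i => ?_).trans (le_of_eq (by ring))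
  refine (hterm (i + n)).trans (le_of_eq ?_)
  rw [pow_add]
  ring

lemma exists_pos_le_norm_limitStar (hμ : Nontrivial μ) (hb0 : 0 < b) (hb1 : b < 1)
    (hK : ∀ j, ‖verblunsky μ j‖ ≤ K * b ^ j)
    (hM : ∀ n z, ‖(monicOP μ n).eval z‖ ≤ M * max 1 ‖z‖ ^ n) :
    ∃ m > 0, ∀ z : ℂ, ‖z‖ ≤ 1 → m ≤ ‖limitStar μ z‖ := by
  have hs : Summable fun j => ‖verblunsky μ j‖ :=
    Summable.of_norm_bounded ((summable_geometric_of_lt_one hb0.le hb1).mul_left K)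
      (fun j => by rw [norm_norm]; exact hK j)
  obtain ⟨m, hm, hle⟩ := exists_pos_le_prod (fun j => norm_nonneg (verblunsky μ j))
    (norm_verblunsky_lt_one hμ) hs
  refine ⟨m, hm, fun z hz => ?_⟩
  have hz' : z ∈ ball (0 : ℂ) b⁻¹ := by
    rw [mem_ball, dist_zero_right]
    exact hz.trans_lt ((one_lt_inv₀ hb0).2 hb1)
  refine ge_of_tendsto (tendsto_starPoly hμ hb0 hb1 hK hM hz').norm
    (Eventually.of_forall fun n => (hle n).trans (prod_le_norm_eval_starPoly hμ n hz).2)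

end Geometric

end OPUC

namespace OPUC

open Metric Set Topology BoundedContinuousFunction

/-! ### Measures on the circle are determined by their moments -/

/-- The star algebra of trigonometric polynomials on the circle. -/
noncomputable def trigPoly : StarSubalgebra ℂ (Circle →ᵇ ℂ) where
  carrier := {f | ∃ (n : ℕ) (p : ℂ[X]), ∀ ζ : Circle, f ζ = conj (ζ : ℂ) ^ n * p.eval (ζ : ℂ)}
  mul_mem' := by
    rintro f g ⟨n, p, hf⟩ ⟨m, q, hg⟩
    refine ⟨n + m, p * q, fun ζ => ?_⟩
    rw [BoundedContinuousFunction.mul_apply, hf, hg, eval_mul]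
    ring
  add_mem' := by
    rintro f g ⟨n, p, hf⟩ ⟨m, q, hg⟩
    refine ⟨n + m, X ^ m * p + X ^ n * q, fun ζ => ?_⟩
    have h : ∀ k, conj (ζ : ℂ) ^ k * (ζ : ℂ) ^ k = 1 := by
      intro k
      rw [← mul_pow, mul_comm, Complex.mul_conj, Complex.normSq_eq_norm_sq, Circle.norm_coe]
      simp
    rw [BoundedContinuousFunction.add_apply, hf, hg, eval_add, eval_mul, eval_mul, eval_pow,
      eval_pow, eval_X, pow_add]
    linear_combination (-conj (ζ : ℂ) ^ n * p.eval (ζ : ℂ)) * h m -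
      (conj (ζ : ℂ) ^ m * q.eval (ζ : ℂ)) * h n
  algebraMap_mem' := by
    intro a
    refine ⟨0, C a, fun ζ => ?_⟩
    simp [BoundedContinuousFunction.algebraMap_apply]
  star_mem' := by
    rintro f ⟨n, p, hf⟩
    refine ⟨p.natDegree, X ^ n * starPoly p.natDegree p, fun ζ => ?_⟩
    have h : conj (ζ : ℂ) ^ p.natDegree * (ζ : ℂ) ^ p.natDegree = 1 := by
      rw [← mul_pow, mul_comm, Complex.mul_conj, Complex.normSq_eq_norm_sq, Circle.norm_coe]
      simp
    rw [BoundedContinuousFunction.star_apply, hf, eval_mul, eval_starPoly_coe le_rfl]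
    simp only [eval_pow, eval_X, star_mul', RCLike.star_def, map_pow, Complex.conj_conj]
    linear_combination (-(ζ : ℂ) ^ n * conj (p.eval (ζ : ℂ))) * h

lemma separatesPoints_trigPoly :
    (trigPoly.map (toContinuousMapStarₐ ℂ)).SeparatesPoints := by
  intro x y hxy
  have hmem : BoundedContinuousFunction.mkOfCompact
      (⟨fun ζ : Circle => (ζ : ℂ), continuous_subtype_val⟩ : C(Circle, ℂ)) ∈ trigPoly :=
    ⟨0, X, fun ζ => by simp; rfl⟩
  refine ⟨fun ζ : Circle => (ζ : ℂ), ⟨_, ⟨_, hmem, rfl⟩, rfl⟩, ?_⟩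
  exact fun h => hxy (Circle.coe_injective h)

/-- Negative moments are conjugates of positive ones, so all trigonometric polynomials have equal
integrals, and these form a star algebra that separates points. -/
theorem ext_of_integral_pow {P P' : Measure Circle} [IsFiniteMeasure P] [IsFiniteMeasure P']
    (h : ∀ j : ℕ, ∫ ζ : Circle, (ζ : ℂ) ^ j ∂P = ∫ ζ : Circle, (ζ : ℂ) ^ j ∂P') : P = P' := by
  have hc : Continuous fun ζ : Circle => (ζ : ℂ) := continuous_subtype_val
  have hconj : ∀ j : ℕ, ∫ ζ : Circle, conj (ζ : ℂ) ^ j ∂P = ∫ ζ : Circle, conj (ζ : ℂ) ^ j ∂P' := by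
    intro j
    have := congrArg (starRingEnd ℂ) (h j)
    rw [← integral_conj, ← integral_conj] at this
    simpa only [map_pow] using this
  have hmono : ∀ n m : ℕ, ∫ ζ : Circle, conj (ζ : ℂ) ^ n * (ζ : ℂ) ^ m ∂P =
      ∫ ζ : Circle, conj (ζ : ℂ) ^ n * (ζ : ℂ) ^ m ∂P' := by
    intro n m
    have h1 : ∀ (ζ : Circle) (k : ℕ), conj (ζ : ℂ) ^ k * (ζ : ℂ) ^ k = 1 := by
      intro ζ k
      rw [← mul_pow, mul_comm, Complex.mul_conj, Complex.normSq_eq_norm_sq, Circle.norm_coe]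
      simp
    rcases le_total n m with hnm | hnm
    · obtain ⟨l, rfl⟩ := Nat.exists_eq_add_of_le hnm
      have h2 : ∀ ζ : Circle, conj (ζ : ℂ) ^ n * (ζ : ℂ) ^ (n + l) = (ζ : ℂ) ^ l := by
        intro ζ
        rw [pow_add, ← mul_assoc, h1, one_mul]
      simp only [h2, h]
    · obtain ⟨l, rfl⟩ := Nat.exists_eq_add_of_le hnm
      have h2 : ∀ ζ : Circle, conj (ζ : ℂ) ^ (m + l) * (ζ : ℂ) ^ m = conj (ζ : ℂ) ^ l := by
        intro ζ
        rw [pow_add, mul_right_comm, h1, one_mul]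
      simp only [h2, hconj]
  refine ext_of_forall_mem_subalgebra_integral_eq_of_pseudoEMetric_complete_countable
    separatesPoints_trigPoly ?_
  rintro g ⟨n, p, hg⟩
  simp only [hg]
  have hcc : ∀ p : ℂ[X], Continuous fun ζ : Circle => conj (ζ : ℂ) ^ n * p.eval (ζ : ℂ) := fun p =>
    ((Complex.continuous_conj.comp hc).pow n).mul (continuous_eval_coe p)
  induction p using Polynomial.induction_on' generalizing g with
  | add p q hp hq =>
    simp only [eval_add, mul_add]
    rw [integral_add (integrable_of_continuous P (hcc p)) (integrable_of_continuous P (hcc q)),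
      integral_add (integrable_of_continuous P' (hcc p)) (integrable_of_continuous P' (hcc q))]
    congr 1
    · exact hp (BoundedContinuousFunction.mkOfCompact ⟨_, hcc p⟩) fun ζ => rfl
    · exact hq (BoundedContinuousFunction.mkOfCompact ⟨_, hcc q⟩) fun ζ => rfl
  | monomial m a =>
    simp only [eval_monomial]
    have h3 : ∀ ζ : Circle, conj (ζ : ℂ) ^ n * (a * (ζ : ℂ) ^ m) =
        a * (conj (ζ : ℂ) ^ n * (ζ : ℂ) ^ m) := fun ζ => by ring
    simp only [h3]
    rw [integral_const_mul, integral_const_mul, hmono]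

/-! ### Normalized arc length -/

lemma integral_arcLength {E : Type*} [NormedAddCommGroup E] [NormedSpace ℝ E]
    {f : ℂ → E} (hf : Continuous fun ζ : Circle => f ζ) :
    ∫ ζ : Circle, f ζ ∂arcLength = Real.circleAverage f 0 1 := by
  have hper : Function.Periodic (fun θ : ℝ => f (circleMap 0 1 θ)) (2 * Real.pi) := by
    intro θ
    simp only
    rw [periodic_circleMap]
  have hstep : ∫ θ in Ioc (-Real.pi) Real.pi, f (Circle.exp θ) =
      ∫ θ in (0 : ℝ)..2 * Real.pi, f (circleMap 0 1 θ) := by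
    rw [← intervalIntegral.integral_of_le (by linarith [Real.pi_pos])]
    have h1 := hper.intervalIntegral_add_eq (-Real.pi) 0
    rw [zero_add, show -Real.pi + 2 * Real.pi = Real.pi by ring] at h1
    rw [← h1]
    simp only [circleMap_zero, Complex.ofReal_one, one_mul, Circle.coe_exp]
  rw [arcLength, integral_smul_measure, integral_map Circle.exp.continuous.aemeasurable
    hf.aestronglyMeasurable_of_compactSpace, hstep, Real.circleAverage_def, ENNReal.toReal_inv,
    ENNReal.toReal_ofReal (by positivity)]

instance : IsFiniteMeasure arcLength := by
  constructor
  rw [arcLength, Measure.smul_apply, Measure.map_apply Circle.exp.continuous.measurable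
    MeasurableSet.univ, preimage_univ, Measure.restrict_apply MeasurableSet.univ, univ_inter,
    Real.volume_Ioc, smul_eq_mul]
  refine ENNReal.mul_lt_top ?_ ENNReal.ofReal_lt_top
  rw [ENNReal.inv_lt_top, ENNReal.ofReal_pos]
  positivity

lemma integral_arcLength_const {E : Type*} [NormedAddCommGroup E] [NormedSpace ℝ E]
    [CompleteSpace E] (a : E) :
    ∫ _ : Circle, a ∂arcLength = a := by
  rw [integral_arcLength (f := fun _ => a) continuous_const, Real.circleAverage_const]

lemma integral_arcLength_pow {j : ℕ} (hj : j ≠ 0) :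
    ∫ ζ : Circle, (ζ : ℂ) ^ j ∂arcLength = 0 := by
  rw [integral_arcLength (f := fun z : ℂ => z ^ j) (continuous_subtype_val.pow j)]
  have hd : DiffContOnCl ℂ (fun z : ℂ => z ^ j) (ball 0 |1|) :=
    (differentiable_pow j).diffContOnCl
  rw [hd.circleAverage, zero_pow hj]

end OPUC

namespace OPUC

open Metric Set Topology

/-- Take `f` to be the primitive of `g' / g` with `f 0 = 0`; then `g * exp (-f)` has zero
derivative. -/
lemma exists_log {g : ℂ → ℂ} {R : ℝ} (hR : 0 < R) (hg : DifferentiableOn ℂ g (ball 0 R))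
    (h0 : ∀ z ∈ ball (0 : ℂ) R, g z ≠ 0) (h1 : g 0 = 1) :
    ∃ f : ℂ → ℂ, DifferentiableOn ℂ f (ball 0 R) ∧ f 0 = 0 ∧
      ∀ z ∈ ball (0 : ℂ) R, Complex.exp (f z) = g z := by
  have hd : DifferentiableOn ℂ (fun z => deriv g z / g z) (ball 0 R) :=
    (hg.deriv isOpen_ball).div hg h0
  obtain ⟨f, hf0, hf⟩ := hd.isExactOn_ball.with_val_at 0 0
  refine ⟨f, fun z hz => (hf z hz).differentiableAt.differentiableWithinAt, hf0, fun z hz => ?_⟩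
  have hconst : ∀ w ∈ ball (0 : ℂ) R, HasDerivAt (fun w => g w * Complex.exp (-f w)) 0 w := by
    intro w hw
    have hgd : HasDerivAt g (deriv g w) w :=
      (hg.differentiableAt (isOpen_ball.mem_nhds hw)).hasDerivAt
    refine (hgd.mul (hf w hw).neg.cexp).congr_deriv ?_
    have := h0 w hw
    field_simp
    ring
  have h2 : g z * Complex.exp (-f z) = g 0 * Complex.exp (-f 0) := by
    refine isOpen_ball.is_const_of_deriv_eq_zero (convex_ball (0 : ℂ) R).isPreconnected
      (fun w hw => (hconst w hw).differentiableAt.differentiableWithinAt)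
      (fun w hw => (hconst w hw).deriv) hz (mem_ball_self hR)
  rw [h1, hf0, neg_zero, Complex.exp_zero, one_mul, Complex.exp_neg] at h2
  field_simp at h2
  exact h2.symm

/-! ### The Schwarz integral formula on the circle -/

section Schwarz

variable {f : ℂ → ℂ} {z : ℂ}

lemma coe_sub_ne_zero (hz : ‖z‖ < 1) (ζ : Circle) : (ζ : ℂ) - z ≠ 0 := by
  intro h
  rw [sub_eq_zero] at h
  rw [← h, Circle.norm_coe] at hz
  exact lt_irrefl _ hz

lemma continuous_coe_of_continuousOn (hf : ContinuousOn f (closedBall 0 1)) :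
    Continuous fun ζ : Circle => f ζ := by
  refine hf.comp_continuous continuous_subtype_val fun ζ => ?_
  rw [mem_closedBall, dist_zero_right]
  exact (Circle.norm_coe ζ).le

lemma continuous_kernel (hz : ‖z‖ < 1) :
    Continuous fun ζ : Circle => ((ζ : ℂ) + z) / ((ζ : ℂ) - z) :=
  (continuous_subtype_val.add continuous_const).div
    (continuous_subtype_val.sub continuous_const) (coe_sub_ne_zero hz)

lemma integral_arcLength_eq (hf : DifferentiableOn ℂ f (closedBall 0 1)) :
    ∫ ζ : Circle, f ζ ∂arcLength = f 0 := by
  rw [integral_arcLength (continuous_coe_of_continuousOn hf.continuousOn)]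
  have : DiffContOnCl ℂ f (ball 0 |1|) := by
    refine DifferentiableOn.diffContOnCl ?_
    rwa [abs_one, closure_ball _ one_ne_zero]
  exact this.circleAverage

/-- The kernel is `2 ζ / (ζ - z) - 1`: Cauchy's formula for the first part, the mean value property
for the second. -/
lemma integral_kernel_mul (hf : DifferentiableOn ℂ f (closedBall 0 1)) (hz : ‖z‖ < 1) :
    ∫ ζ : Circle, ((ζ : ℂ) + z) / ((ζ : ℂ) - z) * f ζ ∂arcLength = 2 * f z - f 0 := by
  have hfc := continuous_coe_of_continuousOn hf.continuousOn
  have hc : Continuous fun ζ : Circle => ((ζ : ℂ) - 0) / ((ζ : ℂ) - z) * f ζ :=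
    (((continuous_subtype_val.sub continuous_const).div
      (continuous_subtype_val.sub continuous_const) (coe_sub_ne_zero hz))).mul hfc
  have h1 : ∫ ζ : Circle, ((ζ : ℂ) - 0) / ((ζ : ℂ) - z) * f ζ ∂arcLength = f z := by
    rw [integral_arcLength (f := fun w => (w - 0) / (w - z) * f w) hc]
    have : DiffContOnCl ℂ f (ball 0 |1|) := by
      refine DifferentiableOn.diffContOnCl ?_
      rwa [abs_one, closure_ball _ one_ne_zero]
    simpa only [smul_eq_mul] using this.circleAverage_smul_div (by simpa using hz)
  have h2 : ∀ ζ : Circle, ((ζ : ℂ) + z) / ((ζ : ℂ) - z) * f ζ =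
      2 * (((ζ : ℂ) - 0) / ((ζ : ℂ) - z) * f ζ) - f ζ := by
    intro ζ
    have := coe_sub_ne_zero hz ζ
    field_simp
    ring
  simp only [h2]
  rw [integral_sub ((integrable_of_continuous _ hc).const_mul 2) (integrable_of_continuous _ hfc),
    integral_const_mul, h1, integral_arcLength_eq hf]

/-- On the circle the kernel is the conjugate of `(1 + conj z ζ) / (1 - conj z ζ)`, which is
holomorphic in `ζ` on the closed disk and equals `1` at `0`; the mean value property applies. -/
lemma integral_kernel_mul_conj (hf : DifferentiableOn ℂ f (closedBall 0 1)) (hz : ‖z‖ < 1) :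
    ∫ ζ : Circle, ((ζ : ℂ) + z) / ((ζ : ℂ) - z) * conj (f ζ) ∂arcLength = conj (f 0) := by
  have hne : ∀ w ∈ closedBall (0 : ℂ) 1, 1 - conj z * w ≠ 0 := by
    intro w hw h
    rw [mem_closedBall, dist_zero_right] at hw
    have h1 : conj z * w = 1 := by linear_combination -h
    have h2 := congrArg norm h1
    rw [norm_mul, RCLike.norm_conj, norm_one] at h2
    nlinarith [norm_nonneg w, norm_nonneg z]
  have hd : DifferentiableOn ℂ (fun w => (1 + conj z * w) / (1 - conj z * w) * f w)
      (closedBall 0 1) := by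
    refine DifferentiableOn.mul (DifferentiableOn.div ?_ ?_ hne) hf <;> fun_prop
  have h1 := integral_arcLength_eq hd
  have h2 : ∀ ζ : Circle, ((ζ : ℂ) + z) / ((ζ : ℂ) - z) * conj (f ζ) =
      conj ((1 + conj z * ζ) / (1 - conj z * ζ) * f ζ) := by
    intro ζ
    have h3 : (ζ : ℂ) * conj (ζ : ℂ) = 1 := by
      rw [Complex.mul_conj, Complex.normSq_eq_norm_sq, Circle.norm_coe]
      simp
    have h4 : 1 - z * conj (ζ : ℂ) ≠ 0 := by
      have := hne ζ (by rw [mem_closedBall, dist_zero_right]; exact (Circle.norm_coe ζ).le)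
      intro h
      apply this
      have := congrArg (starRingEnd ℂ) h
      simpa using this
    have h5 := coe_sub_ne_zero hz ζ
    simp only [map_mul, map_div₀, map_add, map_sub, map_one, Complex.conj_conj]
    congr 1
    rw [div_eq_div_iff h5 h4]
    linear_combination (2 * z : ℂ) * (-h3)
  simp only [h2]
  rw [integral_conj, h1]
  simp

end Schwarz

/-! ### The weight of the measure -/

variable {μ : Measure Circle} [IsProbabilityMeasure μ] {b K M : ℝ}

lemma norm_polyInner_le {p q : ℂ[X]} {A B : ℝ} (hA : ∀ ζ : Circle, ‖p.eval (ζ : ℂ)‖ ≤ A)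
    (hB : ∀ ζ : Circle, ‖q.eval (ζ : ℂ)‖ ≤ B) : ‖polyInner μ p q‖ ≤ A * B := by
  have := norm_integral_le_of_norm_le_const (μ := μ) (C := A * B)
    (f := fun ζ : Circle => conj (p.eval (ζ : ℂ)) * q.eval (ζ : ℂ))
    (Eventually.of_forall fun ζ => by
      rw [norm_mul, RCLike.norm_conj]
      exact mul_le_mul (hA ζ) (hB ζ) (norm_nonneg _) ((norm_nonneg _).trans (hA ζ)))
  simpa using! this

/-- Trading `X Φ_m` for `Φ_{m+1}` costs `conj α_m Φ_m^*`, that is `O(b ^ m)`. After `i` trades the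
remaining `Φ_{m+i}` is orthogonal to `Φ_n`. -/
lemma norm_polyInner_X_pow_mul_le (hμ : Nontrivial μ) (hb0 : 0 < b) (hb1 : b < 1)
    (hK : ∀ j, ‖verblunsky μ j‖ ≤ K * b ^ j)
    (hM : ∀ (n : ℕ) (ζ : Circle), ‖(monicOP μ n).eval (ζ : ℂ)‖ ≤ M) (n i : ℕ) :
    ∀ m, n ≤ m → n < m + i →
      ‖polyInner μ (monicOP μ n) (X ^ i * monicOP μ m)‖ ≤ i * (K * M ^ 2 * b ^ m) := by
  induction i with
  | zero =>
    intro m _ hm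
    rw [pow_zero, one_mul, polyInner_monicOP hμ (by omega)]
    simp
  | succ i ih =>
    intro m hnm _
    have h1 : X ^ (i + 1) * monicOP μ m = X ^ i * monicOP μ (m + 1) +
        C (conj (verblunsky μ m)) * (X ^ i * starPoly m (monicOP μ m)) := by
      rw [monicOP_succ hμ]; ring
    have hK0 : 0 ≤ K := by simpa using (norm_nonneg _).trans (hK 0)
    have hM0 : 0 ≤ M := (norm_nonneg _).trans (hM 0 1)
    have h2 := ih (m + 1) (by omega) (by omega)
    have h3 : ‖polyInner μ (monicOP μ n) (X ^ i * starPoly m (monicOP μ m))‖ ≤ M * M := by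
      refine norm_polyInner_le (hM n) fun ζ => ?_
      rw [eval_mul, norm_mul, eval_pow, eval_X, norm_pow, Circle.norm_coe, one_pow, one_mul,
        norm_eval_starPoly_coe (natDegree_monicOP μ m).le]
      exact hM m ζ
    rw [h1, polyInner_add_right, polyInner_C_mul_right]
    refine (norm_add_le _ _).trans ?_
    rw [norm_mul, RCLike.norm_conj]
    have h4 : (i : ℝ) * (K * M ^ 2 * b ^ (m + 1)) ≤ i * (K * M ^ 2 * b ^ m) := by
      gcongr ?_ * (_ * ?_)
      exact pow_le_pow_of_le_one hb0.le hb1.le (Nat.le_succ m)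
    have h5 : ‖verblunsky μ m‖ * ‖polyInner μ (monicOP μ n) (X ^ i * starPoly m (monicOP μ m))‖ ≤
        K * b ^ m * (M * M) := by
      gcongr
      exact hK m
    push_cast
    linarith

lemma continuous_limitStar_coe (hb0 : 0 < b) (hb1 : b < 1)
    (hK : ∀ j, ‖verblunsky μ j‖ ≤ K * b ^ j)
    (hM : ∀ n z, ‖(monicOP μ n).eval z‖ ≤ M * max 1 ‖z‖ ^ n) :
    Continuous fun ζ : Circle => limitStar μ ζ :=
  continuous_coe_of_continuousOn ((differentiableOn_limitStar hb0 hb1 hK hM).continuousOn.mono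
    (closedBall_subset_ball ((one_lt_inv₀ hb0).2 hb1)))

/-- On the circle `|Φ_n| = |Φ_n^*|` tends to `|limitStar|`, and the moment for `|Φ_n|²` is `⟨Φ_n, X
^ j Φ_n⟩ = O(b ^ n)`. -/
lemma integral_pow_mul_norm_limitStar (hμ : Nontrivial μ) (hb0 : 0 < b) (hb1 : b < 1)
    (hK : ∀ j, ‖verblunsky μ j‖ ≤ K * b ^ j)
    (hM : ∀ n z, ‖(monicOP μ n).eval z‖ ≤ M * max 1 ‖z‖ ^ n) {j : ℕ} (hj : j ≠ 0) :
    ∫ ζ : Circle, (‖limitStar μ ζ‖ ^ 2) • (ζ : ℂ) ^ j ∂μ = 0 := by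
  have hM' : ∀ (n : ℕ) (ζ : Circle), ‖(monicOP μ n).eval (ζ : ℂ)‖ ≤ M := by
    intro n ζ
    have h := hM n ζ
    rwa [Circle.norm_coe, max_self, one_pow, mul_one] at h
  have hcirc : ∀ ζ : Circle, (ζ : ℂ) ∈ ball (0 : ℂ) b⁻¹ := by
    intro ζ
    rw [mem_ball, dist_zero_right, Circle.norm_coe]
    exact (one_lt_inv₀ hb0).2 hb1
  have hlim : Tendsto (fun n => ∫ ζ : Circle, (‖(monicOP μ n).eval (ζ : ℂ)‖ ^ 2) • (ζ : ℂ) ^ j ∂μ)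
      atTop (𝓝 (∫ ζ : Circle, (‖limitStar μ ζ‖ ^ 2) • (ζ : ℂ) ^ j ∂μ)) := by
    refine tendsto_integral_of_dominated_convergence (fun _ => M ^ 2) (fun n => ?_)
      (integrable_const _) (fun n => Eventually.of_forall fun ζ => ?_)
      (Eventually.of_forall fun ζ => ?_)
    · exact (((continuous_eval_coe _).norm.pow 2).smul
        (continuous_subtype_val.pow j)).aestronglyMeasurable_of_compactSpace
    · rw [norm_smul, norm_pow, norm_pow, Circle.norm_coe, one_pow, mul_one, norm_norm]
      exact pow_le_pow_left₀ (norm_nonneg _) (hM' n ζ) 2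
    · have := tendsto_starPoly hμ hb0 hb1 hK hM (hcirc ζ)
      have h2 := (this.norm.pow 2).smul_const ((ζ : ℂ) ^ j)
      simpa only [norm_eval_starPoly_coe (natDegree_monicOP μ _).le] using h2
  have hzero : Tendsto (fun n => ∫ ζ : Circle, (‖(monicOP μ n).eval (ζ : ℂ)‖ ^ 2) • (ζ : ℂ) ^ j ∂μ)
      atTop (𝓝 0) := by
    have hg : Tendsto (fun n : ℕ => j * (K * M ^ 2 * b ^ n)) atTop (𝓝 0) := by
      simpa using ((tendsto_pow_atTop_nhds_zero_of_lt_one hb0.le hb1).const_mul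
        (K * M ^ 2)).const_mul (j : ℝ)
    refine squeeze_zero_norm (fun n => ?_) hg
    refine le_trans (le_of_eq ?_)
      (norm_polyInner_X_pow_mul_le hμ hb0 hb1 hK hM' n j n le_rfl (by omega))
    congr 2
    ext ζ
    rw [eval_mul, eval_pow, eval_X, Complex.real_smul, Complex.ofReal_pow, ← Complex.conj_mul']
    ring
  exact tendsto_nhds_unique hlim hzero

/-- `|limitStar|² μ` has the moments of a multiple of arc length, hence equals it, and the
nonvanishing density can be divided out. In particular `μ` has no singular part. -/
lemma eq_withDensity (hμ : Nontrivial μ) (hb0 : 0 < b) (hb1 : b < 1)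
    (hK : ∀ j, ‖verblunsky μ j‖ ≤ K * b ^ j)
    (hM : ∀ n z, ‖(monicOP μ n).eval z‖ ≤ M * max 1 ‖z‖ ^ n) :
    ∃ κ > 0, μ = arcLength.withDensity fun ζ => ENNReal.ofReal (κ / ‖limitStar μ ζ‖ ^ 2) := by
  obtain ⟨m, hm, hlow⟩ := exists_pos_le_norm_limitStar hμ hb0 hb1 hK hM
  have hcont := continuous_limitStar_coe hb0 hb1 hK hM
  have hcont2 : Continuous fun ζ : Circle => ‖limitStar μ ζ‖ ^ 2 := hcont.norm.pow 2
  have hpos : ∀ ζ : Circle, 0 < ‖limitStar μ ζ‖ ^ 2 := by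
    intro ζ
    exact pow_pos (hm.trans_le (hlow ζ (Circle.norm_coe ζ).le)) 2
  set κ := ∫ ζ : Circle, ‖limitStar μ ζ‖ ^ 2 ∂μ with hκ
  have hκpos : 0 < κ := by
    have h1 : ∫ _ : Circle, m ^ 2 ∂μ ≤ κ := by
      refine integral_mono (integrable_const _) (integrable_of_continuous μ hcont2) fun ζ => ?_
      have := hlow ζ (Circle.norm_coe ζ).le
      gcongr
    rw [integral_const, probReal_univ, one_smul] at h1
    exact lt_of_lt_of_le (by positivity) h1
  set f : Circle → ENNReal := fun ζ => ENNReal.ofReal (‖limitStar μ ζ‖ ^ 2) with hf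
  have hfm : Measurable f := hcont2.measurable.ennreal_ofReal
  have hfin : IsFiniteMeasure (μ.withDensity f) :=
    isFiniteMeasure_withDensity_ofReal (integrable_of_continuous μ hcont2).2
  have hfin2 : IsFiniteMeasure (ENNReal.ofReal κ • arcLength) :=
    Measure.smul_finite _ ENNReal.ofReal_ne_top
  have hmeas : μ.withDensity f = ENNReal.ofReal κ • arcLength := by
    refine ext_of_integral_pow fun j => ?_
    rw [integral_withDensity_eq_integral_toReal_smul hfm
      (Eventually.of_forall fun ζ => ENNReal.ofReal_lt_top), integral_smul_measure,
      ENNReal.toReal_ofReal hκpos.le]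
    have h1 : ∀ ζ, (f ζ).toReal = ‖limitStar μ ζ‖ ^ 2 := fun ζ =>
      ENNReal.toReal_ofReal (hpos ζ).le
    simp only [h1]
    rcases eq_or_ne j 0 with rfl | hj
    · simp only [pow_zero]
      rw [integral_smul_const, integral_arcLength_const]
    · rw [integral_arcLength_pow hj, integral_pow_mul_norm_limitStar hμ hb0 hb1 hK hM hj, smul_zero]
  refine ⟨κ, hκpos, ?_⟩
  have hinv := withDensity_inv_same (μ := μ) hfm
    (Eventually.of_forall fun ζ => (ENNReal.ofReal_pos.2 (hpos ζ)).ne')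
    (Eventually.of_forall fun ζ => ENNReal.ofReal_ne_top)
  rw [hmeas, withDensity_smul_measure, 
    ← withDensity_smul (f := fun ζ => (f ζ)⁻¹) _ hfm.inv] at hinv
  refine hinv.symm.trans ?_
  congr 1
  ext ζ
  simp only [hf, Pi.smul_apply, smul_eq_mul]
  rw [ENNReal.ofReal_div_of_pos (hpos ζ), ENNReal.div_eq_inv_mul, mul_comm]

/-- For exponentially decaying Verblunsky coefficients the Szegő function is, up to a constant,
the reciprocal of the limit of the reversed orthogonal polynomials. -/
theorem exists_inv_szego_eq (hμ : Nontrivial μ) (hb0 : 0 < b) (hb1 : b < 1)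
    (hK : ∀ j, ‖verblunsky μ j‖ ≤ K * b ^ j)
    (hM : ∀ n z, ‖(monicOP μ n).eval z‖ ≤ M * max 1 ‖z‖ ^ n) :
    ∃ a : ℝ, 0 < a ∧ ∀ z ∈ ball (0 : ℂ) 1, (szego μ z)⁻¹ = a * limitStar μ z := by
  obtain ⟨κ, hκ, heq⟩ := eq_withDensity hμ hb0 hb1 hK hM
  obtain ⟨m, hm, hlow⟩ := exists_pos_le_norm_limitStar hμ hb0 hb1 hK hM
  have hcont := continuous_limitStar_coe hb0 hb1 hK hM
  have hd := differentiableOn_limitStar hb0 hb1 hK hM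
  have hne : ∀ ζ : Circle, limitStar μ ζ ≠ 0 := fun ζ =>
    norm_pos_iff.1 (hm.trans_le (hlow ζ (Circle.norm_coe ζ).le))
  have hweight : ∀ᵐ ζ ∂arcLength, weight μ ζ = κ / ‖limitStar μ ζ‖ ^ 2 := by
    have h1 : Measurable fun ζ : Circle => ENNReal.ofReal (κ / ‖limitStar μ ζ‖ ^ 2) :=
      (measurable_const.div (hcont.norm.pow 2).measurable).ennreal_ofReal
    have h2 := Measure.rnDeriv_withDensity arcLength h1
    rw [← heq] at h2
    filter_upwards [h2] with ζ hζ
    rw [weight, hζ, ENNReal.toReal_ofReal (by positivity)]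
  -- By compactness zeros are absent from a slightly larger disk, so a logarithm `f` of `limitStar`
  -- exists across the unit circle.
  obtain ⟨R, hR1, hR, hRne⟩ : ∃ R, 1 < R ∧ DifferentiableOn ℂ (limitStar μ) (ball 0 R) ∧
      ∀ z ∈ ball (0 : ℂ) R, limitStar μ z ≠ 0 := by
    have hopen : IsOpen (ball (0 : ℂ) b⁻¹ ∩ limitStar μ ⁻¹' {0}ᶜ) :=
      hd.continuousOn.isOpen_inter_preimage isOpen_ball isOpen_compl_singleton
    obtain ⟨ε, hε, hsub⟩ := (isCompact_closedBall (0 : ℂ) 1).exists_thickening_subset_open hopen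
      (fun w hw => by
        refine ⟨closedBall_subset_ball ((one_lt_inv₀ hb0).2 hb1) hw, ?_⟩
        rw [mem_closedBall, dist_zero_right] at hw
        exact norm_pos_iff.1 (hm.trans_le (hlow w hw)))
    rw [thickening_closedBall hε zero_le_one] at hsub
    exact ⟨ε + 1, by linarith, hd.mono fun w hw => (hsub hw).1, fun w hw => (hsub hw).2⟩
  obtain ⟨f, hf, hf0, hexp⟩ := exists_log (by linarith) hR hRne (limitStar_zero μ)
  have hsub : closedBall (0 : ℂ) 1 ⊆ ball 0 R := closedBall_subset_ball hR1
  have hf1 : DifferentiableOn ℂ f (closedBall 0 1) := hf.mono hsub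
  refine ⟨(√κ)⁻¹, by positivity, fun z hz => ?_⟩
  have hz1 : ‖z‖ < 1 := by simpa using hz
  have hlog : ∀ᵐ ζ : Circle ∂arcLength,
      ((ζ : ℂ) + z) / ((ζ : ℂ) - z) * (Real.log (weight μ ζ) : ℂ) =
      Real.log κ * (((ζ : ℂ) + z) / ((ζ : ℂ) - z) * 1) -
        (((ζ : ℂ) + z) / ((ζ : ℂ) - z) * f ζ + ((ζ : ℂ) + z) / ((ζ : ℂ) - z) * conj (f ζ)) := by
    filter_upwards [hweight] with ζ hζ
    have h1 : Real.log ‖limitStar μ ζ‖ = (f ζ).re := by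
      rw [← hexp ζ (hsub (by
        rw [mem_closedBall, dist_zero_right]; exact (Circle.norm_coe ζ).le)), Complex.norm_exp, Real.log_exp]
    have h2 : (Real.log (weight μ ζ) : ℂ) = Real.log κ - (f ζ + conj (f ζ)) := by
      rw [hζ, Real.log_div hκ.ne' (pow_ne_zero 2 (norm_ne_zero_iff.2 (hne ζ))), Real.log_pow, h1,
        Complex.add_conj]
      push_cast
      ring
    rw [h2]
    ring
  have hk := continuous_kernel hz1
  have hfc := continuous_coe_of_continuousOn hf1.continuousOn
  have hconj : Continuous fun ζ : Circle => conj (f ζ) := Complex.continuous_conj.comp hfc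
  have hone := integral_kernel_mul (f := fun _ => 1) (differentiableOn_const 1) hz1
  -- Since `log w = log κ - f - conj f` on the circle and `f 0 = 0`, only `-2 f(z)` survives besides
  -- the constant.
  have hint : ∫ ζ : Circle, (((ζ : ℂ) + z) / ((ζ : ℂ) - z)) * (Real.log (weight μ ζ) : ℂ) ∂arcLength
      = Real.log κ - 2 * f z := by
    rw [integral_congr_ae hlog, integral_sub, integral_const_mul, integral_add, hone,
      integral_kernel_mul hf1 hz1, integral_kernel_mul_conj hf1 hz1, hf0, map_zero]
    · ring
    · exact integrable_of_continuous _ (hk.mul hfc)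
    · exact integrable_of_continuous _ (hk.mul hconj)
    · exact integrable_of_continuous _ (continuous_const.mul (hk.mul continuous_const))
    · exact integrable_of_continuous _ ((hk.mul hfc).add (hk.mul hconj))
  have hsqrt : Complex.exp (1 / 2 * Real.log κ) = (√κ : ℝ) := by
    have : (1 / 2 * Real.log κ : ℂ) = ((Real.log κ / 2 : ℝ) : ℂ) := by push_cast; ring
    rw [this, ← Complex.ofReal_exp, Real.exp_half, Real.exp_log hκ]
  rw [szego, hint, mul_sub, Complex.exp_sub, hsqrt,
    show (1 / 2 * (2 * f z) : ℂ) = f z by ring, hexp z (ball_subset_ball hR1.le hz), inv_div]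
  push_cast
  ring

end OPUC

namespace OPUC

open Metric Set Topology

variable {μ : Measure Circle} [IsProbabilityMeasure μ] {b K M : ℝ} {c : ℂ}

/-! ### Asymptotics inside the unit disk -/

/-- The Szegő recursion divided by `z ^ (n + 1)` telescopes. -/
lemma eval_monicOP_eq_sum (hμ : Nontrivial μ) (n : ℕ) {z : ℂ} (hz : z ≠ 0) :
    (monicOP μ n).eval z = z ^ n * (1 - ∑ j ∈ Finset.range n,
      (z ^ (j + 1))⁻¹ * (conj (verblunsky μ j) * (starPoly j (monicOP μ j)).eval z)) := by
  induction n with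
  | zero => simp [monicOP_zero]
  | succ n ih =>
    rw [eval_monicOP_succ hμ, ih, Finset.sum_range_succ]
    field_simp
    ring

lemma sub_mul_sum_eq {z : ℂ} (hz : z ≠ 0) (b : ℂ) (n : ℕ) :
    (z - b) * ∑ j ∈ Finset.range n, (z ^ (j + 1))⁻¹ * b ^ j = 1 - b ^ n / z ^ n := by
  induction n with
  | zero => simp
  | succ n ih =>
    rw [Finset.sum_range_succ, mul_add, ih]
    field_simp
    ring

/-- Inside the disk, `Φ_n(z)` is `z ^ n (1 - H - T) + b ^ n H` up to a smaller error, where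
`H(z) = conj c * F(z) / (z - b)` and `F` is the limit of the reversed polynomials. -/
theorem exists_asymptotics (hμ : Nontrivial μ) (hb0 : 0 < b) (hb1 : b < 1)
    (hK : ∀ j, ‖verblunsky μ j‖ ≤ K * b ^ j)
    (hM : ∀ n z, ‖(monicOP μ n).eval z‖ ≤ M * max 1 ‖z‖ ^ n ∧
      ‖(starPoly n (monicOP μ n)).eval z‖ ≤ M * max 1 ‖z‖ ^ n)
    {Δ K₁ s : ℝ} (hbΔ : b ≤ Δ) (hK₁ : ∀ j : ℕ, ‖verblunsky μ j - c * b ^ j‖ ≤ K₁ * (b * Δ) ^ j)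
    (hs : b * Δ < s) :
    ∃ (T : ℂ → ℂ) (K₃ : ℝ), DifferentiableOn ℂ T {z | s < ‖z‖ ∧ ‖z‖ < 1} ∧
      ∀ z : ℂ, s < ‖z‖ → ‖z‖ < 1 → z ≠ b → ∀ n : ℕ,
        ‖(monicOP μ n).eval z - (z ^ n * (1 - conj c * limitStar μ z / (z - b) - T z) +
          b ^ n * (conj c * limitStar μ z / (z - b)))‖ ≤ K₃ * (b * Δ) ^ n := by
  have hΔ0 : 0 < Δ := hb0.trans_le hbΔ
  have hs0 : 0 < s := lt_trans (by positivity) hs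
  have hM1 : ∀ n z, ‖(monicOP μ n).eval z‖ ≤ M * max 1 ‖z‖ ^ n := fun n z => (hM n z).1
  have hK0 : 0 ≤ K := by simpa using (norm_nonneg _).trans (hK 0)
  have hK₁0 : 0 ≤ K₁ := by simpa using (norm_nonneg _).trans (hK₁ 0)
  have hM0 : 0 ≤ M := by simpa using (norm_nonneg _).trans (hM1 0 0)
  have hF := differentiableOn_limitStar hb0 hb1 hK hM1
  have h1b : 0 < 1 - b := by linarith
  -- The error of replacing `conj α_j Φ_j^*` by `conj c b^j F`. It combines `α_j - c b^j =
  -- O((bΔ)^j)` with `b^j (Φ_j^* - F) = O(b^(2j))`; the second is absorbed because `b ≤ Δ`.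
  set e : ℕ → ℂ → ℂ := fun j z => conj (verblunsky μ j) * (starPoly j (monicOP μ j)).eval z -
    conj c * b ^ j * limitStar μ z with he
  set K₂ := K₁ * M + ‖c‖ * (K * M / (1 - b)) with hK₂
  have hK₂0 : 0 ≤ K₂ := by positivity
  have hebound : ∀ j z, ‖z‖ < 1 → ‖e j z‖ ≤ K₂ * (b * Δ) ^ j := by
    intro j z hz
    have h1 : e j z = conj (verblunsky μ j - c * b ^ j) * (starPoly j (monicOP μ j)).eval z +
        conj c * b ^ j * ((starPoly j (monicOP μ j)).eval z - limitStar μ z) := by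
      simp only [he, map_sub, map_mul, map_pow, Complex.conj_ofReal]
      ring
    have h2 := norm_starPoly_sub_limitStar_le hμ hb0 hb1 hK hM1 hz.le j
    have h3 : ‖(starPoly j (monicOP μ j)).eval z‖ ≤ M := by
      have := (hM j z).2
      rwa [max_eq_left hz.le, one_pow, mul_one] at this
    rw [h1]
    refine (norm_add_le _ _).trans ?_
    rw [norm_mul, norm_mul, norm_mul, RCLike.norm_conj, RCLike.norm_conj, norm_pow,
      Complex.norm_real, Real.norm_eq_abs, abs_of_pos hb0]
    have h4 : b ^ j * b ^ j ≤ (b * Δ) ^ j := by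
      rw [← mul_pow]; gcongr
    calc _ ≤ K₁ * (b * Δ) ^ j * M + ‖c‖ * b ^ j * (K * M / (1 - b) * b ^ j) := by
          gcongr; exact hK₁ j
      _ = K₁ * M * (b * Δ) ^ j + ‖c‖ * (K * M / (1 - b)) * (b ^ j * b ^ j) := by ring
      _ ≤ K₁ * M * (b * Δ) ^ j + ‖c‖ * (K * M / (1 - b)) * (b * Δ) ^ j := by gcongr
      _ = _ := by rw [hK₂]; ring
  have hterm : ∀ j z, s < ‖z‖ → ‖z‖ < 1 →
      ‖(z ^ (j + 1))⁻¹ * e j z‖ ≤ K₂ / s * (b * Δ / s) ^ j := by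
    intro j z hz hz1
    rw [norm_mul, norm_inv, norm_pow]
    calc _ ≤ (s ^ (j + 1))⁻¹ * (K₂ * (b * Δ) ^ j) := by
          gcongr
          exact hebound j z hz1
      _ = _ := by rw [div_pow, pow_succ]; field_simp
  have hratio : b * Δ / s < 1 := (div_lt_one hs0).2 hs
  have hgeo : Summable fun j : ℕ => K₂ / s * (b * Δ / s) ^ j :=
    (summable_geometric_of_lt_one (by positivity) hratio).mul_left _
  have hopen : IsOpen {z : ℂ | s < ‖z‖ ∧ ‖z‖ < 1} :=
    (isOpen_lt continuous_const continuous_norm).inter (isOpen_lt continuous_norm continuous_const)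
  refine ⟨fun z => ∑' j, (z ^ (j + 1))⁻¹ * e j z, K₂ / (s - b * Δ), ?_, ?_⟩
  · refine Complex.differentiableOn_tsum_of_summable_norm hgeo (fun j => ?_) hopen
      fun j z hz => hterm j z hz.1 hz.2
    have hsub : {z : ℂ | s < ‖z‖ ∧ ‖z‖ < 1} ⊆ ball 0 b⁻¹ := by
      intro z hz
      rw [mem_ball, dist_zero_right]
      exact hz.2.trans ((one_lt_inv₀ hb0).2 hb1)
    refine DifferentiableOn.mul (DifferentiableOn.inv (by fun_prop) fun z hz => ?_) ?_
    · refine pow_ne_zero _ (norm_pos_iff.1 (hs0.trans hz.1))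
    · refine DifferentiableOn.sub ?_ ((hF.mono hsub).const_mul _)
      exact ((starPoly j (monicOP μ j)).differentiable.const_mul _).differentiableOn
  · intro z hz hz1 hzb n
    have hz0 : z ≠ 0 := norm_pos_iff.1 (hs0.trans hz)
    have hzb' : z - b ≠ 0 := sub_ne_zero.2 hzb
    have hsum : Summable fun j => (z ^ (j + 1))⁻¹ * e j z :=
      Summable.of_norm_bounded hgeo fun j => hterm j z hz hz1
    have hsplit := hsum.sum_add_tsum_nat_add n
    have hgeom := sub_mul_sum_eq hz0 b n
    -- The main terms contribute a geometric sum. Completing the sum of the errors to the series `T`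
    -- leaves the tail from `n` on, and multiplied by `z ^ n` it is `O((bΔ)^n)`.
    have hkey : (monicOP μ n).eval z - (z ^ n * (1 - conj c * limitStar μ z / (z - b) -
        ∑' j, (z ^ (j + 1))⁻¹ * e j z) + b ^ n * (conj c * limitStar μ z / (z - b))) =
        z ^ n * ∑' i, (z ^ (i + n + 1))⁻¹ * e (i + n) z := by
      have h1 : ∑ j ∈ Finset.range n,
          (z ^ (j + 1))⁻¹ * (conj (verblunsky μ j) * (starPoly j (monicOP μ j)).eval z) =
          conj c * limitStar μ z * ∑ j ∈ Finset.range n, (z ^ (j + 1))⁻¹ * (b : ℂ) ^ j +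
          ∑ j ∈ Finset.range n, (z ^ (j + 1))⁻¹ * e j z := by
        rw [Finset.mul_sum, ← Finset.sum_add_distrib]
        refine Finset.sum_congr rfl fun j _ => ?_
        simp only [he]
        ring
      have h2 : ∑ j ∈ Finset.range n, (z ^ (j + 1))⁻¹ * (b : ℂ) ^ j =
          (1 - b ^ n / z ^ n) / (z - b) := by
        rw [← hgeom]; field_simp
      rw [eval_monicOP_eq_sum hμ n hz0, h1, h2, ← hsplit]
      field_simp
      ring
    rw [hkey, ← tsum_mul_left]
    have hgs : HasSum (fun i : ℕ => K₂ * (b * Δ) ^ n / s * (b * Δ / s) ^ i)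
        (K₂ * (b * Δ) ^ n / s * (1 - b * Δ / s)⁻¹) :=
      (hasSum_geometric_of_lt_one (by positivity) hratio).mul_left _
    refine (tsum_of_norm_bounded hgs fun i => ?_).trans (le_of_eq ?_)
    · have h3 : z ^ n * ((z ^ (i + n + 1))⁻¹ * e (i + n) z) = (z ^ (i + 1))⁻¹ * e (i + n) z := by
        rw [show i + n + 1 = n + (i + 1) by ring, pow_add]
        field_simp
      rw [h3, norm_mul, norm_inv, norm_pow]
      calc _ ≤ (s ^ (i + 1))⁻¹ * (K₂ * (b * Δ) ^ (i + n)) := by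
            gcongr
            exact hebound _ z hz1
        _ = _ := by rw [div_pow, pow_succ, pow_add]; field_simp
    · have : s - b * Δ ≠ 0 := by linarith
      field_simp

/-- Outside the critical circle, `1 - H - T` is the reflection of `F`. -/
lemma reflection_eq (hμ : Nontrivial μ) (hb0 : 0 < b) (hb1 : b < 1)
    (hK : ∀ j, ‖verblunsky μ j‖ ≤ K * b ^ j)
    (hM : ∀ n z, ‖(monicOP μ n).eval z‖ ≤ M * max 1 ‖z‖ ^ n) {Δ K₃ : ℝ} (hΔ0 : 0 < Δ) (hΔ1 : Δ < 1)
    {z G H : ℂ} (hz : b < ‖z‖)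
    (h : ∀ n : ℕ, ‖(monicOP μ n).eval z - (z ^ n * G + b ^ n * H)‖ ≤ K₃ * (b * Δ) ^ n) :
    conj (limitStar μ (conj z)⁻¹) = G := by
  have hz0 : z ≠ 0 := norm_pos_iff.1 (hb0.trans hz)
  have hcz : conj z ≠ 0 := by simpa using hz0
  have hw : (conj z)⁻¹ ∈ ball (0 : ℂ) b⁻¹ := by
    rw [mem_ball, dist_zero_right, norm_inv, RCLike.norm_conj]
    exact (inv_lt_inv₀ (hb0.trans hz) hb0).2 hz
  have h1 : Tendsto (fun n => (monicOP μ n).eval z / z ^ n) atTop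
      (𝓝 (conj (limitStar μ (conj z)⁻¹))) := by
    refine ((Complex.continuous_conj.tendsto _).comp
      (tendsto_starPoly hμ hb0 hb1 hK hM hw)).congr fun n => ?_
    simp only [Function.comp]
    rw [eval_starPoly (natDegree_monicOP μ n).le (inv_ne_zero hcz)]
    simp only [map_mul, map_pow, map_inv₀, Complex.conj_conj, inv_inv]
    rw [inv_pow]
    field_simp
  have hzpos : 0 < ‖z‖ := hb0.trans hz
  have h2 : Tendsto (fun n : ℕ => G + ((b : ℂ) / z) ^ n * H) atTop (𝓝 G) := by
    have : ‖(b : ℂ) / z‖ < 1 := by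
      rw [norm_div, Complex.norm_real, Real.norm_eq_abs, abs_of_pos hb0]
      exact (div_lt_one hzpos).2 hz
    simpa using ((tendsto_pow_atTop_nhds_zero_of_norm_lt_one this).mul_const H).const_add G
  have h3 : Tendsto (fun n => (monicOP μ n).eval z / z ^ n - (G + ((b : ℂ) / z) ^ n * H)) atTop
      (𝓝 0) := by
    have hr : b * Δ / ‖z‖ < 1 := by
      rw [div_lt_one hzpos]
      nlinarith
    have h4 : Tendsto (fun n : ℕ => K₃ * (b * Δ / ‖z‖) ^ n) atTop (𝓝 0) := by
      simpa using (tendsto_pow_atTop_nhds_zero_of_lt_one (by positivity) hr).const_mul K₃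
    refine squeeze_zero_norm (fun n => ?_) h4
    have h5 : (monicOP μ n).eval z / z ^ n - (G + ((b : ℂ) / z) ^ n * H) =
        ((monicOP μ n).eval z - (z ^ n * G + b ^ n * H)) / z ^ n := by
      rw [div_pow]; field_simp
    rw [h5, norm_div, norm_pow, div_pow, ← mul_div_assoc]
    gcongr
    exact h n
  have h6 := h3.add h2
  simp only [sub_add_cancel, zero_add] at h6
  exact tendsto_nhds_unique h1 h6

end OPUC

namespace OPUC

open Metric Set Topology

/-! ### The local form of the orthogonal polynomials near a zero of the reflected function -/

/-- A continuation of `1 / D` to a star-shaped domain agrees with every holomorphic continuation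
to a disk. -/
lemma eqOn_of_starConvex {U : Set ℂ} {E F : ℂ → ℂ} {R : ℝ}
    (hstar : StarConvex ℝ 0 U) (hball : ball (0 : ℂ) 1 ⊆ U) (hE : AnalyticOnNhd ℂ E U) (hR : 1 < R)
    (hF : DifferentiableOn ℂ F (ball 0 R)) (hEF : EqOn E F (ball 0 1)) :
    EqOn E F (U ∩ ball 0 R) := by
  have h0 : (0 : ℂ) ∈ U ∩ ball 0 R :=
    ⟨hball (mem_ball_self one_pos), mem_ball_self (by linarith)⟩
  have hpre : IsPreconnected (U ∩ ball (0 : ℂ) R) :=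
    ((hstar.inter ((convex_ball (0 : ℂ) R).starConvex h0.2)).isPathConnected
      h0).isConnected.isPreconnected
  refine AnalyticOnNhd.eqOn_of_preconnected_of_eventuallyEq (z₀ := 0)
    (hE.mono inter_subset_left) ((hF.analyticOnNhd isOpen_ball).mono inter_subset_right) hpre h0 ?_
  exact hEF.eventuallyEq_of_mem (ball_mem_nhds _ one_pos)

/-- Move outwards along the ray through `p`. The reflection identity is known only outside the
circle through `p`, and this accumulation lets the identity theorem extend it to a neighborhood. -/
lemma frequently_norm_gt {p : ℂ} (hp : p ≠ 0) : ∃ᶠ z in 𝓝[≠] p, ‖p‖ < ‖z‖ := by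
  have h1 : Tendsto (fun t : ℝ => p * (1 + t)) (𝓝[>] 0) (𝓝[≠] p) := by
    refine tendsto_nhdsWithin_of_tendsto_nhds_of_eventually_within _ ?_ ?_
    · have : Continuous fun t : ℝ => p * (1 + (t : ℂ)) := by fun_prop
      have h2 := this.tendsto 0
      simp only [Complex.ofReal_zero, add_zero, mul_one] at h2
      exact h2.mono_left nhdsWithin_le_nhds
    · filter_upwards [self_mem_nhdsWithin] with t ht
      simp only [mem_compl_iff, mem_singleton_iff]
      intro h
      have h3 : p * t = 0 := by linear_combination h
      rcases mul_eq_zero.1 h3 with h4 | h4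
      · exact hp h4
      · rw [Complex.ofReal_eq_zero] at h4
        exact (ne_of_gt ht) h4
  refine h1.frequently (Eventually.frequently ?_)
  filter_upwards [self_mem_nhdsWithin] with t ht
  have h2 : ‖(1 + (t : ℂ))‖ = 1 + t := by
    rw [← Complex.ofReal_one, ← Complex.ofReal_add, Complex.norm_real, Real.norm_eq_abs, abs_of_pos]
    have : (0 : ℝ) < t := ht
    linarith
  rw [norm_mul, h2]
  have : (0 : ℝ) < t := ht
  nlinarith [norm_pos_iff.2 hp]

lemma norm_ofReal_mul_eq {b : ℝ} (hb0 : 0 < b) {z₀ : ℂ} (hz₀ : ‖z₀‖ = 1) :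
    ‖(b : ℂ) * z₀‖ = b := by
  rw [norm_mul, hz₀, mul_one, Complex.norm_real, Real.norm_eq_abs, abs_of_pos hb0]

/-- If `G = 1 - H - T` is, outside the critical circle, the reflection of `F`, and if the reflected
function has a zero at `b z₀`, then `z₀ ≠ 1` and `G` has a zero of the same order. -/
lemma exists_factorization {b s a : ℝ} (hb0 : 0 < b) (hb1 : b < 1) (hs : s < b) (ha : 0 < a)
    {c z₀ : ℂ} (hc : c ≠ 0) (hz₀ : ‖z₀‖ = 1) {k : ℕ} (hk : 1 ≤ k) {D F T : ℂ → ℂ}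
    (hF : DifferentiableOn ℂ F (ball 0 b⁻¹)) (hFb : F b ≠ 0)
    (hT : DifferentiableOn ℂ T {z | s < ‖z‖ ∧ ‖z‖ < 1})
    (hrefl : ∀ z : ℂ, b < ‖z‖ → ‖z‖ < 1 →
      conj (F (conj z)⁻¹) = 1 - conj c * F z / (z - b) - T z)
    (hD : ∀ z ∈ ball (0 : ℂ) 1, (D z)⁻¹ = a * F z)
    (hsing : HasReflectedZeroOfOrder D (b * z₀) k) :
    z₀ ≠ 1 ∧ ∃ q : ℂ → ℂ, AnalyticAt ℂ q (b * z₀) ∧ q (b * z₀) ≠ 0 ∧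
      ∀ᶠ z in 𝓝 (b * z₀), 1 - conj c * F z / (z - b) - T z = (z - b * z₀) ^ k * q z := by
  obtain ⟨U, E, hU, hstar, hball, hpU, hE, hED, hord⟩ := hsing
  set p := (b : ℂ) * z₀ with hp
  have hpn : ‖p‖ = b := norm_ofReal_mul_eq hb0 hz₀
  have hp0 : p ≠ 0 := by rw [← norm_pos_iff, hpn]; exact hb0
  have hb1' : 1 < b⁻¹ := (one_lt_inv₀ hb0).2 hb1
  have hac : (a : ℂ) ≠ 0 := by exact_mod_cast ha.ne'
  have hEF : EqOn E (fun z => a * F z) (U ∩ ball 0 b⁻¹) :=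
    eqOn_of_starConvex hstar hball hE hb1' (hF.const_mul _) fun z hz => (hED hz).trans (hD z hz)
  set h : ℂ → ℂ := fun z => conj (E (conj z)⁻¹) with hh
  have hnear : ∀ᶠ z in 𝓝 p, s < ‖z‖ ∧ ‖z‖ < 1 ∧ (conj z)⁻¹ ∈ U := by
    have e1 : ∀ᶠ z in 𝓝 p, s < ‖z‖ :=
      continuous_norm.continuousAt.eventually_const_lt (hs.trans_eq hpn.symm)
    have e2 : ∀ᶠ z in 𝓝 p, ‖z‖ < 1 :=
      continuous_norm.continuousAt.eventually_lt_const (hpn.trans_lt hb1)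
    have e3 : ContinuousAt (fun z : ℂ => (conj z)⁻¹) p :=
      ContinuousAt.inv₀ Complex.continuous_conj.continuousAt (by simpa using hp0)
    filter_upwards [e1, e2, e3.preimage_mem_nhds (hU.mem_nhds hpU)] with z h1 h2 h3
    exact ⟨h1, h2, h3⟩
  have heq : ∀ᶠ z in 𝓝 p, b < ‖z‖ → h z = a * (1 - conj c * F z / (z - b) - T z) := by
    filter_upwards [hnear] with z hz hbz
    have hw : (conj z)⁻¹ ∈ U ∩ ball (0 : ℂ) b⁻¹ := by
      refine ⟨hz.2.2, ?_⟩
      rw [mem_ball, dist_zero_right, norm_inv, RCLike.norm_conj]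
      exact (inv_lt_inv₀ (hb0.trans hbz) hb0).2 hbz
    rw [← hrefl z hbz hz.2.1, hh]
    simp only
    rw [hEF hw, map_mul, Complex.conj_ofReal]
  -- The order of a function that is not analytic is `0` by convention, so `k ≥ 1` yields
  -- analyticity.
  have hha : AnalyticAt ℂ h p := by
    by_contra hcon
    rw [analyticOrderAt_of_not_analyticAt hcon] at hord
    have : k = 0 := by exact_mod_cast hord.symm
    omega
  have hopen : IsOpen {z : ℂ | s < ‖z‖ ∧ ‖z‖ < 1} :=
    (isOpen_lt continuous_const continuous_norm).inter (isOpen_lt continuous_norm continuous_const)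
  have hTa : AnalyticAt ℂ T p :=
    hT.analyticAt (hopen.mem_nhds ⟨by rw [hpn]; exact hs, by rw [hpn]; exact hb1⟩)
  have hFa : AnalyticAt ℂ F p := hF.analyticAt (isOpen_ball.mem_nhds (by
    rw [mem_ball, dist_zero_right, hpn]; linarith))
  have hfreq : ∃ᶠ z in 𝓝[≠] p, b < ‖z‖ := by
    have := frequently_norm_gt hp0
    rwa [hpn] at this
  -- At `b` the term `H` has a pole, since `F b ≠ 0`. Multiplying the identity by `z - b` and
  -- evaluating at `b` would give `0 = -a * conj c * F b`.
  have hz1 : z₀ ≠ 1 := by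
    rintro rfl
    rw [mul_one] at hp
    have hfr : ∃ᶠ z in 𝓝[≠] p, (z - b) * h z = a * ((z - b) * (1 - T z) - conj c * F z) := by
      refine (hfreq.and_eventually (heq.filter_mono nhdsWithin_le_nhds)).mono ?_
      rintro z ⟨hz, hz'⟩
      have hzb : z - b ≠ 0 := by
        rw [sub_ne_zero]
        rintro rfl
        rw [Complex.norm_real, Real.norm_eq_abs, abs_of_pos hb0] at hz
        exact lt_irrefl _ hz
      rw [hz' hz]
      field_simp
      ring
    have hev := (AnalyticAt.frequently_eq_iff_eventually_eq (by fun_prop) (by fun_prop)).1 hfr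
    have := hev.self_of_nhds
    rw [← hp, sub_self, zero_mul, zero_mul, zero_sub] at this
    have h2 : conj c * F p ≠ 0 := by
      rw [hp]
      exact mul_ne_zero (by simpa using hc) hFb
    exact mul_ne_zero hac (neg_ne_zero.2 h2) this.symm
  refine ⟨hz1, ?_⟩
  have hpb : p - b ≠ 0 := by
    intro h0
    apply hz1
    have hb' : (b : ℂ) ≠ 0 := by exact_mod_cast hb0.ne'
    have : (b : ℂ) * (z₀ - 1) = 0 := by rw [← h0, hp]; ring
    exact sub_eq_zero.1 ((mul_eq_zero.1 this).resolve_left hb')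
  have hGa : AnalyticAt ℂ (fun z => a * (1 - conj c * F z / (z - b) - T z)) p := by
    have : AnalyticAt ℂ (fun z : ℂ => z - b) p := by fun_prop
    exact analyticAt_const.mul
      ((analyticAt_const.sub ((analyticAt_const.mul hFa).div this hpb)).sub hTa)
  have hev : ∀ᶠ z in 𝓝 p, h z = a * (1 - conj c * F z / (z - b) - T z) := by
    refine (AnalyticAt.frequently_eq_iff_eventually_eq hha hGa).1 ?_
    refine (hfreq.and_eventually (heq.filter_mono nhdsWithin_le_nhds)).mono ?_
    rintro z ⟨hz, hz'⟩
    exact hz' hz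
  obtain ⟨q, hqa, hq0, hq⟩ := hha.analyticOrderAt_eq_natCast.1 hord
  refine ⟨fun z => q z / a, hqa.div analyticAt_const hac, div_ne_zero hq0 hac, ?_⟩
  filter_upwards [hev, hq] with z h1 h2
  rw [h1, smul_eq_mul] at h2
  field_simp
  linear_combination h2

/-- The factorization in exponential coordinates. -/
lemma exists_factorization_exp {p : ℂ} (hp : p ≠ 0) {k : ℕ} {G q : ℂ → ℂ} (hq : AnalyticAt ℂ q p)
    (hq0 : q p ≠ 0) (hG : ∀ᶠ z in 𝓝 p, G z = (z - p) ^ k * q z) :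
    ∃ Q : ℂ → ℂ, AnalyticAt ℂ Q 0 ∧ Q 0 ≠ 0 ∧ ∀ᶠ u in 𝓝 0, G (p * Complex.exp u) = u ^ k * Q u := by
  have hexp : AnalyticAt ℂ (fun u => p * Complex.exp u) 0 := by fun_prop
  have hd : Differentiable ℂ (dslope Complex.exp 0) := by
    rw [← differentiableOn_univ, Complex.differentiableOn_dslope univ_mem]
    exact Complex.differentiable_exp.differentiableOn
  -- Here `exp u - 1 = u * dslope Complex.exp 0 u`, and the slope equals `1` at `0`.
  refine ⟨fun u => (p * dslope Complex.exp 0 u) ^ k * q (p * Complex.exp u), ?_, ?_, ?_⟩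
  · have h1 : AnalyticAt ℂ (fun u => q (p * Complex.exp u)) 0 := by
      refine AnalyticAt.fun_comp (g := q) ?_ hexp
      simpa using hq
    exact ((analyticAt_const.mul (hd.analyticAt 0)).pow k).mul h1
  · simp [hp, hq0]
  · have ht : Tendsto (fun u => p * Complex.exp u) (𝓝 0) (𝓝 p) := by
      simpa using hexp.continuousAt.tendsto
    filter_upwards [ht.eventually hG] with u hu
    have h2 := sub_smul_dslope Complex.exp 0 u
    rw [sub_zero, Complex.exp_zero, smul_eq_mul] at h2
    rw [hu, show p * Complex.exp u - p = u * (p * dslope Complex.exp 0 u) by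
      linear_combination -p * h2, mul_pow]
    ring

end OPUC

/-! ### From the asymptotics to the local equation -/

namespace ZeroSpacing

open Metric Set Topology

lemma LocalForm.C_mul {b : ℝ} {z₀ : ℂ} {k n : ℕ} {r ρ : ℝ} {p : ℂ[X]} {Q g : ℂ → ℂ} {c : ℂ}
    (h : LocalForm b z₀ k n r ρ p Q g c) {a : ℂ} (ha : a ≠ 0) :
    LocalForm b z₀ k n r ρ (C a * p) (fun u => a * Q u) g c where
  ne_zero := mul_ne_zero (C_ne_zero.2 ha) h.ne_zero
  nearOne := h.nearOne
  norm_eq := h.norm_eq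
  differentiableOn := h.differentiableOn.const_mul a
  factor_ne_zero u hu := mul_ne_zero ha (h.factor_ne_zero u hu)
  eval_eq u hu := by rw [eval_mul, eval_C, h.eval_eq u hu, mul_assoc]

/-- A sequence of polynomials with asymptotics `z ^ n G(z) + b ^ n H(z)`, where `G` has a zero of
order `k` at `b z₀` and `H` does not vanish there, has the local form. -/
lemma exists_localForm {b : ℝ} (hb : 0 < b) {z₀ : ℂ} (hz₀ : ‖z₀‖ = 1) {k : ℕ} {p : ℕ → ℂ[X]}
    (hp : ∀ n, p n ≠ 0) {G H Q : ℂ → ℂ} {Δ K : ℝ} (hΔ0 : 0 < Δ) (hΔ1 : Δ < 1)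
    (hH : AnalyticAt ℂ H (b * z₀)) (hH0 : H (b * z₀) ≠ 0)
    (hQ : AnalyticAt ℂ Q 0) (hQ0 : Q 0 ≠ 0)
    (hG : ∀ᶠ u in 𝓝 0, G (b * z₀ * Complex.exp u) = u ^ k * Q u)
    (hasymp : ∀ᶠ z in 𝓝 (b * z₀), ∀ n : ℕ,
      ‖(p n).eval z - (z ^ n * G z + b ^ n * H z)‖ ≤ K * (b * Δ) ^ n) :
    ∃ r ρ : ℝ, 0 < r ∧ r ≤ 1 ∧ 0 < ρ ∧ ∀ᶠ n : ℕ in atTop, ∃ Q g c,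
      LocalForm b z₀ k n r ρ (p n) Q g c := by
  have hb' : (b : ℂ) ≠ 0 := by exact_mod_cast hb.ne'
  have hz₀' : z₀ ≠ 0 := by
    rw [← norm_pos_iff, hz₀]; exact one_pos
  set ζ := (b : ℂ) * z₀ with hζ
  have hζ0 : ζ ≠ 0 := mul_ne_zero hb' hz₀'
  have ht : Tendsto (fun u => ζ * Complex.exp u) (𝓝 0) (𝓝 ζ) := by
    have : Continuous fun u => ζ * Complex.exp u := by fun_prop
    simpa using this.tendsto 0
  have hHexp : ContinuousAt (fun u => H (ζ * Complex.exp u)) 0 := by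
    refine ContinuousAt.comp' (g := H) ?_ (by fun_prop)
    simpa using hH.continuousAt
  -- Balancing `ζ^n exp (n u) u^k Q` against `b^n H` gives `exp (n u) u^k ≈ -z₀^(-n) H / Q`; its
  -- leading constant is `c' / z₀^n`, of norm independent of `n`.
  set c' := -(H ζ / Q 0) with hc'
  have hc0 : c' ≠ 0 := neg_ne_zero.2 (div_ne_zero hH0 hQ0)
  have hratio : Tendsto (fun u => H (ζ * Complex.exp u) / (-c' * Q u)) (𝓝 0) (𝓝 1) := by
    have h1 : ContinuousAt (fun u => H (ζ * Complex.exp u) / (-c' * Q u)) 0 :=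
      hHexp.div (continuousAt_const.mul hQ.continuousAt)
        (mul_ne_zero (neg_ne_zero.2 hc0) hQ0)
    have h2 : H (ζ * Complex.exp 0) / (-c' * Q 0) = 1 := by
      rw [hc', Complex.exp_zero, mul_one, neg_neg, div_mul_cancel₀ _ hQ0, div_self hH0]
    have h3 := h1.tendsto
    rwa [h2] at h3
  have hQnorm : ∀ᶠ u in 𝓝 0, ‖Q 0‖ / 2 < ‖Q u‖ :=
    hQ.continuousAt.norm.eventually_const_lt (half_lt_self (norm_pos_iff.2 hQ0))
  have hclose : ∀ᶠ u in 𝓝 0, ‖H (ζ * Complex.exp u) / (-c' * Q u) - 1‖ < 1 / 4 := by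
    have := (hratio.sub_const 1).norm
    rw [sub_self, norm_zero] at this
    exact this.eventually (gt_mem_nhds (by norm_num))
  obtain ⟨r', hr'0, hr'⟩ := Metric.eventually_nhds_iff_ball.1
    (hG.and (hQ.eventually_analyticAt.and (hQnorm.and (hclose.and (ht.eventually hasymp)))))
  have hQpos : 0 < ‖Q 0‖ := norm_pos_iff.2 hQ0
  have hcpos : 0 < ‖c'‖ := norm_pos_iff.2 hc0
  have hlim : Tendsto (fun n : ℕ => K / (‖c'‖ * (‖Q 0‖ / 2)) * Δ ^ n) atTop (𝓝 0) := by
    simpa using (tendsto_pow_atTop_nhds_zero_of_lt_one hΔ0.le hΔ1).const_mul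
      (K / (‖c'‖ * (‖Q 0‖ / 2)))
  refine ⟨min r' 1, ‖c'‖, lt_min hr'0 one_pos, min_le_right _ _, hcpos, ?_⟩
  have hsub : ball (0 : ℂ) (min r' 1) ⊆ ball 0 r' := ball_subset_ball (min_le_left _ _)
  filter_upwards [hlim.eventually (gt_mem_nhds (show (0 : ℝ) < 1 / 4 by norm_num))] with n hn
  have hζn : ζ ^ n ≠ 0 := pow_ne_zero n hζ0
  have hbn : (b : ℂ) ^ n ≠ 0 := pow_ne_zero n hb'
  have hz₀n : z₀ ^ n ≠ 0 := pow_ne_zero n hz₀'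
  have hQne : ∀ u ∈ ball (0 : ℂ) (min r' 1), Q u ≠ 0 := by
    intro u hu
    have := (hr' u (hsub hu)).2.2.1
    exact norm_pos_iff.1 (lt_trans (by positivity) this)
  have hQd : DifferentiableOn ℂ Q (ball 0 (min r' 1)) := fun u hu =>
    (hr' u (hsub hu)).2.1.differentiableAt.differentiableWithinAt
  -- `g` is defined by solving the required identity, so the remainder is absorbed in it. Its
  -- distance from `1` splits into `H / (-c' Q) - 1` and an `O(Δ^n)` term, each below `1 / 4`.
  refine ⟨fun u => ζ ^ n * Q u,
    fun u => ((p n).eval (ζ * Complex.exp u) - ζ ^ n * Complex.exp (n * u) * u ^ k * Q u) /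
      (-b ^ n * c' * Q u), c' / z₀ ^ n, hp n, ⟨?_, ?_⟩, ?_, hQd.const_mul _,
      fun u hu => mul_ne_zero hζn (hQne u hu), ?_⟩
  · refine DifferentiableOn.div (DifferentiableOn.sub ?_ ?_) (hQd.const_mul _) fun u hu =>
      mul_ne_zero (mul_ne_zero (neg_ne_zero.2 hbn) hc0) (hQne u hu)
    · exact ((p n).differentiable.comp
        (Complex.differentiable_exp.const_mul ζ)).differentiableOn
    · exact DifferentiableOn.mul (by fun_prop) hQd
  · intro u hu
    obtain ⟨h1, -, h3, h4, h5⟩ := hr' u (hsub hu)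
    have h6 := h5 n
    rw [h1, mul_pow, ← Complex.exp_nat_mul] at h6
    have hQu := hQne u hu
    have h7 : ((p n).eval (ζ * Complex.exp u) - ζ ^ n * Complex.exp (n * u) * u ^ k * Q u) /
        (-b ^ n * c' * Q u) - 1 = (H (ζ * Complex.exp u) / (-c' * Q u) - 1) +
        ((p n).eval (ζ * Complex.exp u) - (ζ ^ n * Complex.exp (n * u) * (u ^ k * Q u) +
          b ^ n * H (ζ * Complex.exp u))) / (-b ^ n * c' * Q u) := by
      field_simp
      ring
    rw [h7]
    refine (norm_add_le _ _).trans ?_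
    have h8 : ‖((p n).eval (ζ * Complex.exp u) - (ζ ^ n * Complex.exp (n * u) * (u ^ k * Q u) +
          b ^ n * H (ζ * Complex.exp u))) / (-b ^ n * c' * Q u)‖ ≤
          K / (‖c'‖ * (‖Q 0‖ / 2)) * Δ ^ n := by
      rw [norm_div, norm_mul, norm_mul, norm_neg, norm_pow, Complex.norm_real, Real.norm_eq_abs,
        abs_of_pos hb]
      have hnum : 0 ≤ K * (b * Δ) ^ n := (norm_nonneg _).trans h6
      calc _ ≤ K * (b * Δ) ^ n / (b ^ n * ‖c'‖ * (‖Q 0‖ / 2)) := by gcongr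
        _ = _ := by rw [mul_pow]; field_simp
    linarith
  · rw [norm_div, norm_pow, hz₀, one_pow, div_one]
  · intro u hu
    have hQu := hQne u hu
    rw [hζ, mul_pow]
    field_simp
    ring

end ZeroSpacing

/-! ### The local form under the BLS condition, and the theorem -/

namespace OPUC

open Metric Set Topology

/-- `Δ` may be enlarged, and `b ≤ Δ` ensures that errors of order `b^(2j)` are `O((bΔ)^j)`. -/
lemma BLS.exists_bounds {α : ℕ → ℂ} {b : ℝ} {c : ℂ} (hb0 : 0 < b) (hb1 : b < 1)
    (h : BLS α b c) : ∃ Δ K K₁ : ℝ, b ≤ Δ ∧ Δ < 1 ∧ (∀ j, ‖α j‖ ≤ K * b ^ j) ∧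
      ∀ j : ℕ, ‖α j - c * b ^ j‖ ≤ K₁ * (b * Δ) ^ j := by
  obtain ⟨Δ, hΔ0, hΔ1, hO⟩ := h
  obtain ⟨K₁, hK₁, hle⟩ := Asymptotics.bound_of_isBigO_nat_atTop hO
  have h1 : ∀ j : ℕ, ‖α j - c * b ^ j‖ ≤ K₁ * (b * Δ) ^ j := by
    intro j
    have hpos : 0 < (b * Δ) ^ j := by positivity
    have := hle (x := j) hpos.ne'
    rwa [Real.norm_eq_abs, abs_of_pos hpos] at this
  refine ⟨max Δ b, ‖c‖ + K₁, K₁, le_max_right _ _, max_lt hΔ1 hb1, fun j => ?_, fun j => ?_⟩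
  · have h2 := norm_le_norm_add_norm_sub' (α j) (c * b ^ j)
    rw [norm_mul, norm_pow, Complex.norm_real, Real.norm_eq_abs, abs_of_pos hb0] at h2
    have h3 : (b * Δ) ^ j ≤ b ^ j := by
      gcongr
      nlinarith
    have h4 : K₁ * (b * Δ) ^ j ≤ K₁ * b ^ j := by gcongr
    linarith [h1 j]
  · refine (h1 j).trans ?_
    gcongr
    exact le_max_left _ _

/-- Near a zero of the reflected reciprocal Szegő function, the orthonormal polynomials have the
local form. -/
theorem exists_localForm_orthonormalOP {μ : Measure Circle} [IsProbabilityMeasure μ]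
    (hμ : Nontrivial μ) {b : ℝ} (hb0 : 0 < b) (hb1 : b < 1) {c : ℂ} (hc : c ≠ 0)
    (hBLS : BLS (verblunsky μ) b c) {z₀ : ℂ} (hz₀ : ‖z₀‖ = 1) {k : ℕ} (hk : 1 ≤ k)
    (hsing : HasReflectedZeroOfOrder (szego μ) (b * z₀) k) :
    ∃ r ρ : ℝ, 0 < r ∧ r ≤ 1 ∧ 0 < ρ ∧ ∀ᶠ n : ℕ in atTop, ∃ Q g c,
      ZeroSpacing.LocalForm b z₀ k n r ρ (orthonormalOP μ n) Q g c := by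
  obtain ⟨Δ, K, K₁, hbΔ, hΔ1, hK, hK₁⟩ := hBLS.exists_bounds hb0 hb1
  have hΔ0 : 0 < Δ := hb0.trans_le hbΔ
  have hsum : Summable fun j => ‖verblunsky μ j‖ :=
    Summable.of_norm_bounded ((summable_geometric_of_lt_one hb0.le hb1).mul_left K)
      (fun j => by rw [norm_norm]; exact hK j)
  obtain ⟨M, -, hM⟩ := exists_norm_eval_le hμ hsum
  have hM1 : ∀ n z, ‖(monicOP μ n).eval z‖ ≤ M * max 1 ‖z‖ ^ n := fun n z => (hM n z).1
  obtain ⟨s, hs, hsb⟩ := exists_between (show b * Δ < b by nlinarith)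
  obtain ⟨T, K₃, hT, hasymp⟩ := exists_asymptotics (c := c) hμ hb0 hb1 hK hM hbΔ hK₁ hs
  obtain ⟨a, ha, hszego⟩ := exists_inv_szego_eq hμ hb0 hb1 hK hM1
  obtain ⟨m, hm, hlow⟩ := exists_pos_le_norm_limitStar hμ hb0 hb1 hK hM1
  have hF := differentiableOn_limitStar hb0 hb1 hK hM1
  have hFne : ∀ z : ℂ, ‖z‖ ≤ 1 → limitStar μ z ≠ 0 := fun z hz =>
    norm_pos_iff.1 (hm.trans_le (hlow z hz))
  have hbn : ‖(b : ℂ)‖ = b := by rw [Complex.norm_real, Real.norm_eq_abs, abs_of_pos hb0]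
  have hpn := norm_ofReal_mul_eq hb0 hz₀
  have hrefl : ∀ z : ℂ, b < ‖z‖ → ‖z‖ < 1 → conj (limitStar μ (conj z)⁻¹) =
      1 - conj c * limitStar μ z / (z - b) - T z := by
    intro z hz hz1
    have hzb : z ≠ b := by
      rintro rfl
      rw [hbn] at hz
      exact lt_irrefl _ hz
    exact reflection_eq hμ hb0 hb1 hK hM1 hΔ0 hΔ1 hz (hasymp z (hsb.trans hz) hz1 hzb)
  obtain ⟨hz1, q, hqa, hq0, hq⟩ := exists_factorization hb0 hb1 hsb ha hc hz₀ hk hF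
    (hFne b (by rw [hbn]; exact hb1.le)) hT hrefl hszego hsing
  have hb' : (b : ℂ) ≠ 0 := by exact_mod_cast hb0.ne'
  have hz₀' : z₀ ≠ 0 := by
    rw [← norm_pos_iff, hz₀]; exact one_pos
  obtain ⟨Q, hQ, hQ0, hG⟩ := exists_factorization_exp (mul_ne_zero hb' hz₀') hqa hq0 hq
  have hpb : (b : ℂ) * z₀ ≠ b := by
    intro h
    exact hz1 (mul_left_cancel₀ hb' (h.trans (mul_one _).symm))
  have hFa : AnalyticAt ℂ (limitStar μ) (b * z₀) := hF.analyticAt (isOpen_ball.mem_nhds (by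
    rw [mem_ball, dist_zero_right, hpn]
    linarith [(one_lt_inv₀ hb0).2 hb1]))
  have hH : AnalyticAt ℂ (fun z => conj c * limitStar μ z / (z - b)) (b * z₀) := by
    have : AnalyticAt ℂ (fun z : ℂ => z - b) (b * z₀) := by fun_prop
    exact (analyticAt_const.mul hFa).div this (sub_ne_zero.2 hpb)
  have hH0 : conj c * limitStar μ (b * z₀) / (b * z₀ - b) ≠ 0 :=
    div_ne_zero (mul_ne_zero (by simpa using hc) (hFne _ (by rw [hpn]; exact hb1.le)))
      (sub_ne_zero.2 hpb)
  have hev : ∀ᶠ z in 𝓝 ((b : ℂ) * z₀), ∀ n : ℕ, ‖(monicOP μ n).eval z -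
      (z ^ n * (1 - conj c * limitStar μ z / (z - b) - T z) +
        b ^ n * (conj c * limitStar μ z / (z - b)))‖ ≤ K₃ * (b * Δ) ^ n := by
    have e1 : ∀ᶠ z in 𝓝 ((b : ℂ) * z₀), s < ‖z‖ :=
      continuous_norm.continuousAt.eventually_const_lt (hsb.trans_eq hpn.symm)
    have e2 : ∀ᶠ z in 𝓝 ((b : ℂ) * z₀), ‖z‖ < 1 :=
      continuous_norm.continuousAt.eventually_lt_const (hpn.trans_lt hb1)
    filter_upwards [e1, e2, isOpen_ne.mem_nhds hpb] with z h1 h2 h3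
    exact hasymp z h1 h2 h3
  obtain ⟨r, ρ, hr, hr1, hρ, hform⟩ := ZeroSpacing.exists_localForm hb0 hz₀
    (fun n => (monic_monicOP μ n).ne_zero) hΔ0 hΔ1 hH hH0 hQ hQ0 hG hev
  refine ⟨r, ρ, hr, hr1, hρ, hform.mono ?_⟩
  rintro n ⟨Q', g, c', h⟩
  refine ⟨_, g, c', h.C_mul ?_⟩
  rw [polyInner_self, Complex.ofReal_re]
  have hpos := integral_norm_sq_pos hμ (monic_monicOP μ n).ne_zero
  have : 0 < √(∫ ζ : Circle, ‖(monicOP μ n).eval (ζ : ℂ)‖ ^ 2 ∂μ) := Real.sqrt_pos.2 hpos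
  exact inv_ne_zero (by exact_mod_cast this.ne')

end OPUC

theorem theorem12p6
    (μ : Measure Circle) [IsProbabilityMeasure μ] (hμ : OPUC.Nontrivial μ)
    (b : ℝ) (hb0 : 0 < b) (hb1 : b < 1) (c : ℂ) (hc : c ≠ 0)
    (hBLS : OPUC.BLS (OPUC.verblunsky μ) b c)
    (z₀ : ℂ) (hz₀ : ‖z₀‖ = 1) (k : ℕ) (hk : 1 ≤ k)
    (hsing : OPUC.HasReflectedZeroOfOrder (OPUC.szego μ) ((b : ℂ) * z₀) k) :
    ∃ Δ₂ δ D A : ℝ, 0 < Δ₂ ∧ Δ₂ < 1 ∧ 0 < δ ∧ δ < b * Δ₂⁻¹ ∧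
      (∃ N : ℕ, ∀ n : ℕ, N ≤ n →
        -- localization of the zeros in modulus
        (∀ z ∈ OPUC.sector b Δ₂ δ z₀, (OPUC.orthonormalOP μ n).IsRoot z →
          1 - D / n ≤ ‖z / (b : ℂ)‖ ∧ ‖z / (b : ℂ)‖ ≤ 1 + 2 * k * (Real.log n / n)) ∧
        -- there are zeros near every direction
        (∀ z₁ ∈ OPUC.sector b Δ₂ δ z₀, ∃ z ∈ OPUC.annulus b Δ₂,
          (OPUC.orthonormalOP μ n).IsRoot z ∧ |(z / z₁).arg| ≤ 2 * Real.pi / n ∧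
          (|(z₁ / z₀).arg| + 2 * Real.pi / n < δ → z ∈ OPUC.sector b Δ₂ δ z₀)) ∧
        -- zeros are simple, and their two neighbours
        (∀ z ∈ OPUC.sector b Δ₂ δ z₀, (OPUC.orthonormalOP μ n).IsRoot z →
          (OPUC.orthonormalOP μ n).rootMultiplicity z = 1 ∧
          ∃ zp zm : ℂ, (OPUC.orthonormalOP μ n).IsRoot zp ∧ (OPUC.orthonormalOP μ n).IsRoot zm ∧
            zp ≠ z ∧ zm ≠ z ∧ zp ≠ zm ∧
            (∀ w : ℂ, (OPUC.orthonormalOP μ n).IsRoot w → w ≠ z → w ≠ zp → w ≠ zm →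
              ‖zp - z‖ < ‖w - z‖ ∧ ‖zm - z‖ < ‖w - z‖) ∧
            (∀ w ∈ OPUC.annulus b Δ₂, (OPUC.orthonormalOP μ n).IsRoot w →
              w ≠ z → w ≠ zp → w ≠ zm →
              (w / z).arg < (zm / z).arg ∨ (zp / z).arg < (w / z).arg) ∧
            |(zp / z).arg - 2 * Real.pi / n| ≤ A / (n * Real.log n) ∧
            |(zm / z).arg + 2 * Real.pi / n| ≤ A / (n * Real.log n) ∧
            |‖zp / z‖ - 1| ≤ A / (n * Real.log n) ∧
            |‖zm / z‖ - 1| ≤ A / (n * Real.log n))) ∧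
      -- the zeros stay away from the singular point
      (∀ κ : ℝ, κ < k → ∃ N : ℕ, ∀ n : ℕ, N ≤ n →
        ∀ z ∈ OPUC.sector b Δ₂ δ z₀, (OPUC.orthonormalOP μ n).IsRoot z →
          κ * (Real.log n / n) ≤ ‖z / (b : ℂ) - z₀‖) := by
  obtain ⟨r, ρ, hr, hr1, hρ, hform⟩ :=
    OPUC.exists_localForm_orthonormalOP hμ hb0 hb1 hc hBLS hz₀ hk hsing
  -- `s ≤ r / 8` puts the square of side `2 s` inside the disk of radius `r / 4`, leaving room for
  -- neighbours; `s < b` gives `δ < b Δ₂⁻¹`.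
  obtain ⟨s, hs, hsr, hsb⟩ : ∃ s : ℝ, 0 < s ∧ s ≤ r / 8 ∧ s < b :=
    ⟨min (r / 8) (b / 2), lt_min (by linarith) (by linarith), min_le_left _ _,
      (min_le_right _ _).trans_lt (by linarith)⟩
  have hexp : 1 ≤ (Real.exp (-s))⁻¹ := by
    rw [Real.exp_neg, inv_inv]
    exact Real.one_le_exp hs.le
  -- `|log (ρ / 2)|` comes from `exp (n Re u) ≥ ρ / 2` at a solution, and `8 k + 1` from the bound
  -- on the derivative of `phase` minus `n`.
  refine ⟨Real.exp (-s), s, |Real.log (ρ / 2)|, (8 * k + 1) * (8 * Real.pi), Real.exp_pos _,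
    Real.exp_lt_one_iff.2 (by linarith), hs,
    hsb.trans_le (le_mul_of_one_le_right hb0.le hexp), ?_, fun κ hκ => ?_⟩
  · refine eventually_atTop.1 ?_
    filter_upwards [hform, ZeroSpacing.eventually_localization hb0 hz₀ hr1 hρ hk hs hsr,
      ZeroSpacing.eventually_exists_root hb0 hz₀ hr hr1 hρ hk hs hsr,
      ZeroSpacing.eventually_neighbours hb0 hz₀ hr hr1 hρ hk hs hsr]
      with n ⟨Q, g, e, hL⟩ h1 h2 h3
    exact ⟨h1 _ Q g e hL, h2 _ Q g e hL, h3 _ Q g e hL⟩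
  · refine eventually_atTop.1 ?_
    filter_upwards [hform, ZeroSpacing.eventually_distance hb0 hz₀ hr1 hρ hs hsr hκ]
      with n ⟨Q, g, e, hL⟩ h1
    exact h1 _ Q g e hL
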